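/- Let $W:\mathbb R\to[0,+\infty)$ be continuous with $W(-1)=W(1)=0$ and $W(z)\ge \alpha_W\min\{(z+1)^2,(z-1)^2,\beta_W\}$ for all $z$, for some $\alpha_W,\beta_W>0$. Let $k\ge 1$ be an integer, let $(a,b)$ be a bounded open interval, and for $\varepsilon>0$ let $$F_\varepsilon(u)=\int_a^b\Big(\frac1\varepsilon W(u)+\varepsilon^{2k-1}(u^{(k)})^2\Big)\,dt,\qquad u\in H^k(a,b),$$ extended by $+\infty$ outside $H^k(a,b)$. Let $BV((a,b);\{-1,1\})$ be the set of functions of bounded variation on $(a,b)$ with values in $\{-1,1\}$ almost everywhere, let $S(u)$ be the jump set of such a function $u$, and let $$m_k=\inf\Big\{\int_{-\infty}^{+\infty}\big(W(u)+(u^{(k)})^2\big)\,dt:\ u\in H^k_{\mathrm{loc}}(\mathbb R),\ \lim_{t\to\pm\infty}u(t)=\pm1\Big\}.$$ Then the following hold. (a) The family $\{F_\varepsilon\}$ is equicoercive with respect to convergence in measure: for all $\varepsilon_j\to0^+$ and $u_j\in H^k(a,b)$ with $\sup_jF_{\varepsilon_j}(u_j)<+\infty$, there is $u\in BV((a,b);\{-1,1\})$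 such that, up to a subsequence, $u_j\to u$ in measure. (b) As $\varepsilon\to0^+$, the family $\{F_\varepsilon\}$ $\Gamma$-converges, both with respect to convergence in measure (on the measurable functions on $(a,b)$) and in $L^1(a,b)$, to the functional $F$ with domain $BV((a,b);\{-1,1\})$ given there by $F(u)=m_k\,\#S(u)$; that is, $F$ is finite exactly on $BV((a,b);\{-1,1\})$ and equals $+\infty$ elsewhere. (c) More precisely, for every $u\in BV((a,b);\{-1,1\})$: (i) for every family $u_\varepsilon\in H^k(a,b)$ with $u_\varepsilon\to u$ in measure as $\varepsilon\to0^+$, $$\liminf_{\varepsilon\to0^+}F_\varepsilon(u_\varepsilon)\ge m_k\,\#S(u);$$ (ii) there is a family $u_\varepsilon\in H^k(a,b)$ with $u_\varepsilon\to u$ in $L^1(a,b)$ as $\varepsilon\to0^+$ and $$\limsup_{\varepsilon\to0^+}F_\varepsilon(u_\varepsilon)=m_k\,\#S(u).$$ -/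

import Mathlib

open Set Filter Topology MeasureTheory
open scoped ENNReal ContDiff

/-- `g` is a weak (distributional) derivative of order `l` of `u` on the open set `Ω ⊆ ℝ`. -/
structure IsWeakDeriv (Ω : Set ℝ) (l : ℕ) (u g : ℝ → ℝ) : Prop where
  locallyIntegrableOn_fun : LocallyIntegrableOn u Ω volume
  locallyIntegrableOn_deriv : LocallyIntegrableOn g Ω volume
  integral_eq : ∀ φ : ℝ → ℝ, ContDiff ℝ ∞ φ → HasCompactSupport φ → tsupport φ ⊆ Ω →
    ∫ t in Ω, u t * iteratedDeriv l φ t = (-1 : ℝ) ^ l * ∫ t in Ω, g t * φ t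

open Classical in
/-- The weak derivative of order `l` of `u` on `Ω` (unique up to a null set on an open set `Ω`);
the junk value `0` if there is none. -/
noncomputable def weakDeriv (Ω : Set ℝ) (l : ℕ) (u : ℝ → ℝ) : ℝ → ℝ :=
  if h : ∃ g, IsWeakDeriv Ω l u g then h.choose else 0

/-- `u ∈ H^k(Ω)`: `u` is in `L²(Ω)`, with weak derivatives up to order `k` in `L²(Ω)`. -/
def MemHk (Ω : Set ℝ) (k : ℕ) (u : ℝ → ℝ) : Prop :=
  MemLp u 2 (volume.restrict Ω) ∧
    ∀ l ≤ k, ∃ g, IsWeakDeriv Ω l u g ∧ MemLp g 2 (volume.restrict Ω)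

/-- `u ∈ H^k_loc(ℝ)`: `u` is in `L²_loc(ℝ)`, with weak derivatives up to order `k` in
`L²_loc(ℝ)`. -/
def MemHkLoc (k : ℕ) (u : ℝ → ℝ) : Prop :=
  (∀ K : Set ℝ, IsCompact K → MemLp u 2 (volume.restrict K)) ∧
    ∀ l ≤ k, ∃ g, IsWeakDeriv univ l u g ∧
      ∀ K : Set ℝ, IsCompact K → MemLp g 2 (volume.restrict K)

open Classical in
/-- The functional `F_ε(u) = ∫_{(a,b)} (W(u)/ε + ε^{2k-1} (u^{(k)})²) dt` on `H^k(a,b)`,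
extended by `+∞` to the functions that are not in `H^k(a,b)`. -/
noncomputable def phaseEnergy (a b : ℝ) (k : ℕ) (W : ℝ → ℝ) (ε : ℝ) (u : ℝ → ℝ) : ℝ≥0∞ :=
  if MemHk (Ioo a b) k u then
    ∫⁻ t in Ioo a b,
      ENNReal.ofReal (1 / ε * W (u t) + ε ^ (2 * k - 1) * (weakDeriv (Ioo a b) k u t) ^ 2)
  else ⊤

/-- The optimal-profile constant `m_k`: the infimum of `∫_ℝ (W(u) + (u^{(k)})²) dt` over
`u ∈ H^k_loc(ℝ)` with `u → ±1` at `±∞`. As usual for `k ≥ 1`, an element of `H^k_loc(ℝ)` is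
identified with its continuous representative. -/
noncomputable def profileConst (k : ℕ) (W : ℝ → ℝ) : ℝ≥0∞ :=
  ⨅ (u : ℝ → ℝ) (_ : Continuous u ∧ MemHkLoc k u ∧
      Tendsto u atTop (𝓝 1) ∧ Tendsto u atBot (𝓝 (-1))),
    ∫⁻ t, ENNReal.ofReal (W (u t) + (weakDeriv univ k u t) ^ 2)

/-- `u ∈ BV(Ω)`: `u` is in `L¹(Ω)` and has finite total variation
`sup {∫_Ω u φ' : φ ∈ C_c^∞(Ω), |φ| ≤ 1}`. -/
def MemBV (Ω : Set ℝ) (u : ℝ → ℝ) : Prop :=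
  IntegrableOn u Ω volume ∧
    ∃ C : ℝ, ∀ φ : ℝ → ℝ, ContDiff ℝ ∞ φ → HasCompactSupport φ → tsupport φ ⊆ Ω →
      (∀ t, |φ t| ≤ 1) → ∫ t in Ω, u t * deriv φ t ≤ C

/-- `u ∈ BV(Ω; {-1, 1})`. -/
def MemBVPhase (Ω : Set ℝ) (u : ℝ → ℝ) : Prop :=
  MemBV Ω u ∧ ∀ᵐ t ∂(volume.restrict Ω), u t = -1 ∨ u t = 1

/-- The jump set `S(u)` of `u` in `(a,b)`: the points where the essential one-sided limits
`u(t+)` and `u(t-)` exist and differ. -/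
def jumpSet (a b : ℝ) (u : ℝ → ℝ) : Set ℝ :=
  {t | t ∈ Ioo a b ∧ ∃ cl cr : ℝ, cl ≠ cr ∧
    Tendsto u (𝓝[<] t ⊓ ae volume) (𝓝 cl) ∧ Tendsto u (𝓝[>] t ⊓ ae volume) (𝓝 cr)}

open Classical in
/-- The limit functional: `m_k #S(u)` on `BV((a,b); {-1,1})`, and `+∞` elsewhere. -/
noncomputable def limitEnergy (a b : ℝ) (k : ℕ) (W : ℝ → ℝ) (u : ℝ → ℝ) : ℝ≥0∞ :=
  if MemBVPhase (Ioo a b) u then profileConst k W * ((jumpSet a b u).encard : ℝ≥0∞) else ⊤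

/-- Sequential `Γ`-convergence as `ε → 0⁺` of a family `F ε` to `F₀`, on the space of functions
`D`, with respect to a notion `conv` of convergence of sequences: for each sequence
`ε_j → 0⁺`, the liminf inequality holds along all converging sequences in `D`, and each point
of `D` has a recovery sequence in `D`. -/
def GammaConverges (D : Set (ℝ → ℝ)) (conv : (ℕ → ℝ → ℝ) → (ℝ → ℝ) → Prop)
    (F : ℝ → (ℝ → ℝ) → ℝ≥0∞) (F₀ : (ℝ → ℝ) → ℝ≥0∞) : Prop :=
  ∀ ε : ℕ → ℝ, (∀ j, 0 < ε j) → Tendsto ε atTop (𝓝 0) → ∀ u ∈ D,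
    (∀ v : ℕ → ℝ → ℝ, (∀ j, v j ∈ D) → conv v u →
      F₀ u ≤ liminf (fun j => F (ε j) (v j)) atTop) ∧
    ∃ v : ℕ → ℝ → ℝ, (∀ j, v j ∈ D) ∧ conv v u ∧
      limsup (fun j => F (ε j) (v j)) atTop ≤ F₀ u

/-!
Everything is done with *jets*: a function of `H^k` in one variable is represented by the family
`w 0, …, w k` of its continuous derivatives of order `< k` together with the weak derivative of
order `k`, each the primitive of the next (`IsSobolevJet`). Restricted to `(a,b)` or to `ℝ`, the
functions of `H^k` are exactly those with such a jet (`MemHk.exists_isSobolevJet`, by the lemma of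
du Bois-Reymond), and jets can be rescaled, reflected, added and glued by elementary means. In
the variable `t / ε` the functional `F_ε` becomes the unscaled energy `∫ (W(w) + (w^{(k)})²)`.

The analytic core is that small energy on an interval of length one forces the whole jet of order
`< k` to be uniformly close to that of one of the constants `±1` (`exists_energy_threshold`).
Indeed the lower bound on `W` gives many separated points at which `w` is close to `±1`, half of
them close to the same well, while `∫ |w^{(k)}|` is small; repeated use of the mean value theorem
then bounds all derivatives (`exists_jet_bound`). Conversely, a jet close to that of a constant
at one point can be continued to that constant within distance one at little cost (`exists_glue`).
Hence, up to a small error, `m_k` bounds from below the energy of any transition between points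
where the jet is close to the opposite wells (`exists_profileConst_le`), and is approached by
profiles that are equal to `±1` outside a bounded interval (`exists_profile`).

Compactness: after passing to a subsequence the energies of all rational intervals converge; only
finitely many points carry concentrated energy at least the threshold, and around each other point
`u_j` is eventually close to a single well, so that the limit is a step function
(`exists_subseq_tendstoInMeasure`).

Lower bound: `BV` functions with values in `{-1, 1}` have finitely many jumps and are constant in
between (`MemBVPhase.exists_jumps`). On either side of a jump, most intervals of length `ε` have
energy below the threshold and are not filled by points where `u_ε` is far from `u`, so that the
rescaled jet is close to the respective wells on both sides, and the transition costs nearly `m_k`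
(`profileConst_mul_encard_le`). For a liminf one restricts the filter to the indices of
small energy, so that a uniform energy bound is available.

Upper bound: rescaled copies of one profile of nearly optimal energy are placed at the jumps
(`exists_approx_recovery`), and a diagonal argument lets the profile depend on `ε`.
-/

/-! ### Sobolev jets -/

/-- The jet of a function in `H^k_loc(ℝ)`: `w l` is the derivative of order `l ≤ k` of `w 0`, encoded
by each `w l` with `l < k` being a primitive of `w (l + 1)`; thus the `w l` with `l < k` are the
continuous representatives, and `w k` is locally square integrable. The values `w l` for `l > k`
are irrelevant. -/
structure IsSobolevJet (k : ℕ) (w : ℕ → ℝ → ℝ) : Prop where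
  memLp : ∀ K : Set ℝ, IsCompact K → MemLp (w k) 2 (volume.restrict K)
  sub_eq : ∀ l < k, ∀ s t, w l t - w l s = ∫ x in s..t, w (l + 1) x

theorem MemLp.integrableOn_of_isCompact {g : ℝ → ℝ} {K : Set ℝ} (hK : IsCompact K)
    (hg : MemLp g 2 (volume.restrict K)) : IntegrableOn g K := by
  have : IsFiniteMeasure (volume.restrict K) := ⟨by simpa using hK.measure_lt_top⟩
  exact hg.integrable (by norm_num)

namespace IsSobolevJet

variable {k : ℕ} {w w' : ℕ → ℝ → ℝ}

theorem intervalIntegrable_top (h : IsSobolevJet k w) (s t : ℝ) :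
    IntervalIntegrable (w k) volume s t := by
  rw [intervalIntegrable_iff']
  exact MemLp.integrableOn_of_isCompact isCompact_uIcc (h.memLp _ isCompact_uIcc)

theorem continuous_of_intervalIntegrable (h : IsSobolevJet k w) {l : ℕ} (hl : l < k)
    (hi : ∀ s t, IntervalIntegrable (w (l + 1)) volume s t) : Continuous (w l) := by
  have : w l = fun t => w l 0 + ∫ x in (0 : ℝ)..t, w (l + 1) x := by
    ext t; rw [← h.sub_eq l hl 0 t]; ring
  rw [this]
  exact continuous_const.add (intervalIntegral.continuous_primitive hi 0)

theorem intervalIntegrable (h : IsSobolevJet k w) {l : ℕ} (hl : l ≤ k) (s t : ℝ) :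
    IntervalIntegrable (w l) volume s t := by
  induction hl using Nat.decreasingInduction generalizing s t with
  | self => exact h.intervalIntegrable_top s t
  | of_succ l hl ih =>
    exact (h.continuous_of_intervalIntegrable hl ih).intervalIntegrable s t

theorem continuous (h : IsSobolevJet k w) {l : ℕ} (hl : l < k) : Continuous (w l) :=
  h.continuous_of_intervalIntegrable hl (h.intervalIntegrable hl)

theorem hasDerivAt (h : IsSobolevJet k w) {l : ℕ} (hl : l + 1 < k) (t : ℝ) :
    HasDerivAt (w l) (w (l + 1) t) t := by
  have : w l = fun t => w l 0 + ∫ x in (0 : ℝ)..t, w (l + 1) x := by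
    ext t; rw [← h.sub_eq l (by omega) 0 t]; ring
  rw [this]
  exact (intervalIntegral.integral_hasDerivAt_right (h.intervalIntegrable (by omega) _ _)
    (h.continuous hl).aestronglyMeasurable.stronglyMeasurableAtFilter
    (h.continuous hl).continuousAt).const_add _

theorem memLp_of_le (h : IsSobolevJet k w) {l : ℕ} (hl : l ≤ k) {K : Set ℝ} (hK : IsCompact K) :
    MemLp (w l) 2 (volume.restrict K) := by
  rcases hl.lt_or_eq with hl | rfl
  · have : IsFiniteMeasure (volume.restrict K) := ⟨by simpa using hK.measure_lt_top⟩
    obtain ⟨C, hC⟩ := hK.exists_bound_of_continuousOn (h.continuous hl).continuousOn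
    refine MemLp.of_bound (h.continuous hl).aestronglyMeasurable C ?_
    exact (ae_restrict_iff' hK.measurableSet).2 (Eventually.of_forall hC)
  · exact h.memLp K hK

theorem locallyIntegrable (h : IsSobolevJet k w) {l : ℕ} (hl : l ≤ k) :
    LocallyIntegrable (w l) volume :=
  (locallyIntegrable_iff (f := w l) (μ := volume)).2 fun _ hK =>
    MemLp.integrableOn_of_isCompact hK (h.memLp_of_le hl hK)

theorem tail (h : IsSobolevJet (k + 1) w) : IsSobolevJet k fun l => w (l + 1) :=
  ⟨h.memLp, fun l hl => h.sub_eq (l + 1) (by omega)⟩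

theorem add (h : IsSobolevJet k w) (h' : IsSobolevJet k w') :
    IsSobolevJet k fun l t => w l t + w' l t := by
  refine ⟨fun K hK => (h.memLp K hK).add (h'.memLp K hK), fun l hl s t => ?_⟩
  rw [intervalIntegral.integral_add (h.intervalIntegrable hl _ _) (h'.intervalIntegrable hl _ _),
    ← h.sub_eq l hl, ← h'.sub_eq l hl]
  ring

theorem const_mul (h : IsSobolevJet k w) (c : ℝ) : IsSobolevJet k fun l t => c * w l t := by
  refine ⟨fun K hK => (h.memLp K hK).const_mul c, fun l hl s t => ?_⟩
  rw [intervalIntegral.integral_const_mul, ← h.sub_eq l hl]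
  ring

theorem zero (k : ℕ) : IsSobolevJet k fun _ _ => 0 :=
  ⟨fun K _ => by simp, fun l hl s t => by simp⟩

theorem sum {ι : Type*} (S : Finset ι) {f : ι → ℕ → ℝ → ℝ} (h : ∀ i ∈ S, IsSobolevJet k (f i)) :
    IsSobolevJet k fun l t => ∑ i ∈ S, f i l t := by
  classical
  induction S using Finset.induction_on with
  | empty => simpa using zero k
  | insert i S hi ih =>
    simp only [Finset.sum_insert hi]
    exact (h i (by simp)).add (ih fun j hj => h j (by simp [hj]))

end IsSobolevJet

/-- The jet of a constant function. -/
def constJet (c : ℝ) : ℕ → ℝ → ℝ := fun l _ => if l = 0 then c else 0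

@[simp] theorem constJet_zero (c t : ℝ) : constJet c 0 t = c := rfl

@[simp] theorem constJet_of_ne {l : ℕ} (hl : l ≠ 0) (c t : ℝ) : constJet c l t = 0 := by
  simp [constJet, hl]

theorem constJet_succ (c : ℝ) (l : ℕ) (t : ℝ) : constJet c (l + 1) t = 0 := by
  simp [constJet]

theorem isSobolevJet_constJet (k : ℕ) (c : ℝ) : IsSobolevJet k (constJet c) := by
  refine ⟨fun K hK => ?_, fun l hl s t => by simp [constJet]⟩
  have : IsFiniteMeasure (volume.restrict K) := ⟨by simpa using hK.measure_lt_top⟩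
  exact memLp_const _

theorem IsSobolevJet.of_contDiff (k : ℕ) {f : ℝ → ℝ} (hf : ContDiff ℝ ∞ f) :
    IsSobolevJet k fun l => iteratedDeriv l f := by
  have hc : ∀ l : ℕ, Continuous (iteratedDeriv l f) := fun l =>
    hf.continuous_iteratedDeriv l (by exact_mod_cast le_top)
  refine ⟨fun K hK => ?_, fun l hl s t => ?_⟩
  · have : IsFiniteMeasure (volume.restrict K) := ⟨by simpa using hK.measure_lt_top⟩
    obtain ⟨C, hC⟩ := hK.exists_bound_of_continuousOn (hc k).continuousOn
    refine MemLp.of_bound (hc k).aestronglyMeasurable C ?_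
    exact (ae_restrict_iff' hK.measurableSet).2 (Eventually.of_forall hC)
  · symm
    apply intervalIntegral.integral_eq_sub_of_hasDerivAt
    · intro x _
      rw [iteratedDeriv_succ]
      exact (hf.differentiable_iteratedDeriv l
        (by exact_mod_cast WithTop.coe_lt_top _) x).hasDerivAt
    · exact (hc _).intervalIntegrable _ _

/-- The jet of `t ↦ w (c t + d)`. -/
def affineJet (c d : ℝ) (w : ℕ → ℝ → ℝ) : ℕ → ℝ → ℝ := fun l t => c ^ l * w l (c * t + d)

theorem measurableEmbedding_affine {c : ℝ} (hc : c ≠ 0) (d : ℝ) :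
    MeasurableEmbedding fun t : ℝ => c * t + d :=
  ((Homeomorph.mulLeft₀ c hc).trans (Homeomorph.addRight d)).measurableEmbedding

theorem map_affine_volume {c : ℝ} (hc : c ≠ 0) (d : ℝ) :
    Measure.map (fun t : ℝ => c * t + d) volume = ENNReal.ofReal |c⁻¹| • volume := by
  have : (fun t : ℝ => c * t + d) = (fun t => t + d) ∘ fun t => c * t := rfl
  rw [this, ← Measure.map_map (by fun_prop) (by fun_prop), Real.map_volume_mul_left hc,
    Measure.map_smul, map_add_right_eq_self]

theorem IsSobolevJet.affine {k : ℕ} {w : ℕ → ℝ → ℝ} (h : IsSobolevJet k w) {c : ℝ} (hc : c ≠ 0)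
    (d : ℝ) : IsSobolevJet k (affineJet c d w) := by
  refine ⟨fun K hK => ?_, fun l hl s t => ?_⟩
  · refine MemLp.const_mul ?_ (c ^ k)
    set g := fun t : ℝ => c * t + d with hg
    have hge := measurableEmbedding_affine hc d
    have hgK : IsCompact (g '' K) := hK.image (by fun_prop)
    have h1 : (volume.restrict K).map g = ENNReal.ofReal |c⁻¹| • volume.restrict (g '' K) := by
      rw [← Measure.restrict_smul, ← map_affine_volume hc d, hge.restrict_map,
        hge.injective.preimage_image]
    have h2 : MemLp (w k) 2 ((volume.restrict K).map g) := by
      rw [h1]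
      exact (h.memLp _ hgK).smul_measure (by simp)
    exact (hge.memLp_map_measure_iff).1 h2
  · have := intervalIntegral.integral_comp_mul_add (a := s) (b := t) (w (l + 1)) hc d
    simp only [affineJet, intervalIntegral.integral_const_mul, this]
    rw [← h.sub_eq l hl]
    simp only [smul_eq_mul]
    field_simp
    ring

/-- Two jets that agree at `x` up to order `k - 1` can be concatenated there. -/
theorem IsSobolevJet.ite {k : ℕ} {w w' : ℕ → ℝ → ℝ} (h : IsSobolevJet k w)
    (h' : IsSobolevJet k w') {x : ℝ} (hx : ∀ l < k, w l x = w' l x) :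
    IsSobolevJet k fun l t => if t ≤ x then w l t else w' l t := by
  classical
  set v : ℕ → ℝ → ℝ := fun l t => if t ≤ x then w l t else w' l t with hv
  refine ⟨fun K hK => ?_, ?_⟩
  · exact MemLp.piecewise (s := Iic x) measurableSet_Iic ((h.memLp K hK).restrict _)
      ((h'.memLp K hK).restrict _)
  · have key : ∀ l < k, ∀ t, v l t - w l x = ∫ y in x..t, v (l + 1) y := by
      intro l hl t
      rcases le_or_gt t x with ht | ht
      · rw [intervalIntegral.integral_congr (g := w (l + 1)), ← h.sub_eq l hl]
        · simp [hv, ht]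
        · intro y hy
          rw [uIcc_of_ge ht] at hy
          simp [hv, hy.2]
      · rw [intervalIntegral.integral_congr_ae (g := w' (l + 1)), ← h'.sub_eq l hl]
        · simp [hv, ht, hx l hl]
        · refine Eventually.of_forall fun y hy => ?_
          rw [uIoc_of_le ht.le] at hy
          simp [hv, hy.1]
    have hint : ∀ l < k, ∀ s t, IntervalIntegrable (v (l + 1)) volume s t := by
      intro l hl s t
      rw [intervalIntegrable_iff]
      exact Integrable.piecewise (s := Iic x) measurableSet_Iic
        (((intervalIntegrable_iff.1 (h.intervalIntegrable hl s t))).integrableOn)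
        (((intervalIntegrable_iff.1 (h'.intervalIntegrable hl s t))).integrableOn)
    intro l hl s t
    have := intervalIntegral.integral_add_adjacent_intervals (hint l hl s x) (hint l hl x t)
    rw [← this, intervalIntegral.integral_symm, ← key l hl, ← key l hl]
    ring

/-! ### Test functions and weak derivatives -/

/-- `φ ∈ C_c^∞(Ω)`. -/
structure IsTestFun (Ω : Set ℝ) (φ : ℝ → ℝ) : Prop where
  contDiff : ContDiff ℝ ∞ φ
  hasCompactSupport : HasCompactSupport φ
  tsupport_subset : tsupport φ ⊆ Ω

namespace IsTestFun

variable {Ω : Set ℝ} {φ ψ : ℝ → ℝ}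

theorem eq_zero_of_notMem (h : IsTestFun Ω φ) {t : ℝ} (ht : t ∉ Ω) : φ t = 0 :=
  image_eq_zero_of_notMem_tsupport fun h' => ht (h.tsupport_subset h')

theorem mono {Ω' : Set ℝ} (h : IsTestFun Ω φ) (hΩ : Ω ⊆ Ω') : IsTestFun Ω' φ :=
  ⟨h.1, h.2, h.3.trans hΩ⟩

theorem deriv (h : IsTestFun Ω φ) : IsTestFun Ω (deriv φ) :=
  ⟨(contDiff_infty_iff_deriv.1 h.1).2, h.2.deriv, tsupport_deriv_subset.trans h.3⟩

theorem iteratedDeriv (h : IsTestFun Ω φ) (l : ℕ) : IsTestFun Ω (iteratedDeriv l φ) := by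
  induction l with
  | zero => simpa using h
  | succ l ih => rw [iteratedDeriv_succ]; exact ih.deriv

theorem const_mul (h : IsTestFun Ω φ) (c : ℝ) : IsTestFun Ω fun t => c * φ t :=
  ⟨contDiff_const.mul h.1, h.2.mul_left, (tsupport_mul_subset_right (f := fun _ => c)).trans h.3⟩

theorem sub (h : IsTestFun Ω φ) (h' : IsTestFun Ω ψ) : IsTestFun Ω fun t => φ t - ψ t :=
  ⟨h.1.sub h'.1, h.2.sub h'.2, (tsupport_sub φ ψ).trans (union_subset h.3 h'.3)⟩

theorem sum {ι : Type*} (S : Finset ι) {f : ι → ℝ → ℝ} (hf : ∀ i ∈ S, IsTestFun Ω (f i)) :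
    IsTestFun Ω fun t => ∑ i ∈ S, f i t := by
  classical
  induction S using Finset.induction_on with
  | empty => exact ⟨by simpa using contDiff_const, by simp [HasCompactSupport, tsupport],
      by simp [tsupport]⟩
  | insert i S hi ih =>
    simp only [Finset.sum_insert hi]
    have h1 := hf i (by simp)
    have h2 := ih fun j hj => hf j (by simp [hj])
    exact ⟨h1.1.add h2.1, h1.2.add h2.2, (tsupport_add _ _).trans (union_subset h1.3 h2.3)⟩

theorem setIntegral_mul (h : IsTestFun Ω φ) (u : ℝ → ℝ) :
    ∫ t in Ω, u t * φ t = ∫ t, u t * φ t :=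
  setIntegral_eq_integral_of_forall_compl_eq_zero fun t ht => by
    simp [h.eq_zero_of_notMem ht]

theorem integrable_mul (h : IsTestFun Ω φ) {u : ℝ → ℝ} (hu : LocallyIntegrableOn u Ω volume) :
    Integrable (fun t => u t * φ t) volume := by
  have h1 : IntegrableOn u (tsupport φ) volume :=
    hu.integrableOn_compact_subset h.3 h.2
  have h2 : IntegrableOn (fun t => u t * φ t) (tsupport φ) volume :=
    h1.mul_continuousOn h.1.continuous.continuousOn h.2
  refine (integrableOn_iff_integrable_of_support_subset fun t ht => ?_).1 h2
  exact subset_tsupport φ (right_ne_zero_of_mul ht)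

theorem exists_Ioo (h : IsTestFun Ω φ) : ∃ R > 0, ∀ t, R ≤ |t| → φ t = 0 := by
  obtain ⟨R, hR, hRs⟩ := h.2.isCompact.isBounded.subset_ball_lt 0 0
  refine ⟨R, hR, fun t ht => image_eq_zero_of_notMem_tsupport fun h' => ?_⟩
  have := hRs h'
  rw [Metric.mem_ball, dist_zero_right, Real.norm_eq_abs] at this
  linarith

end IsTestFun

/-- Integration by parts, for the absolutely continuous function `w l`. -/
theorem IsSobolevJet.integral_mul_deriv {k l : ℕ} {w : ℕ → ℝ → ℝ} (h : IsSobolevJet k w)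
    (hl : l < k) {φ : ℝ → ℝ} (hφ : IsTestFun univ φ) :
    ∫ t, w l t * deriv φ t = -∫ t, w (l + 1) t * φ t := by
  obtain ⟨R, hR, hRφ⟩ := hφ.exists_Ioo
  have hsub : ∀ {f : ℝ → ℝ}, Function.support (fun t => f t * φ t) ⊆ Ioc (-R) R := by
    intro f t ht
    have h0 : φ t ≠ 0 := right_ne_zero_of_mul ht
    by_contra h'
    apply h0
    apply hRφ
    rw [mem_Ioc, not_and_or] at h'
    rcases h' with h' | h'
    · rw [le_abs]; right; linarith
    · exact (not_le.1 h').le.trans (le_abs_self t)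
  have hsub' : Function.support (fun t => w l t * deriv φ t) ⊆ Ioc (-(R + 1)) (R + 1) := by
    intro t ht
    have h0 : deriv φ t ≠ 0 := right_ne_zero_of_mul ht
    by_contra h'
    apply h0
    have hlt : R < |t| := by
      rw [mem_Ioc, not_and_or] at h'
      rw [lt_abs]
      rcases h' with h' | h'
      · right; linarith
      · left; linarith
    have : φ =ᶠ[𝓝 t] fun _ => 0 := by
      filter_upwards [(isOpen_lt continuous_const continuous_abs).mem_nhds hlt] with y hy
      exact hRφ y (le_of_lt hy)
    rw [this.deriv_eq, deriv_const]
  have hRφ' : ∀ t, R + 1 ≤ |t| → φ t = 0 := fun t ht => hRφ t (by linarith)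
  have hAC : AbsolutelyContinuousOnInterval (w l) (-(R + 1)) (R + 1) := by
    have h1 := (h.intervalIntegrable (show l + 1 ≤ k from hl) (-(R + 1))
      (R + 1)).absolutelyContinuousOnInterval_intervalIntegral (c := -(R + 1)) (by simp)
    have h2 : AbsolutelyContinuousOnInterval (fun _ : ℝ => w l (-(R + 1))) (-(R + 1)) (R + 1) :=
      (contDiff_const (n := 1)).contDiffOn.absolutelyContinuousOnInterval
    have e : w l = (fun _ => w l (-(R + 1))) + fun x => ∫ y in (-(R + 1))..x, w (l + 1) y := by
      ext t
      rw [Pi.add_apply, ← h.sub_eq l hl]; ring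
    rw [e]
    exact h2.add h1
  have hφAC : AbsolutelyContinuousOnInterval φ (-(R + 1)) (R + 1) :=
    ((hφ.1.of_le (by exact_mod_cast le_top) : ContDiff ℝ 1
      φ)).contDiffOn.absolutelyContinuousOnInterval
  have hae : ∀ᵐ t, deriv (w l) t = w (l + 1) t := by
    filter_upwards [_root_.LocallyIntegrable.ae_hasDerivAt_integral
      (h.locallyIntegrable (show l + 1 ≤ k from hl))] with t ht
    have h1 := (ht 0).const_add (w l 0)
    have : w l = fun t => w l 0 + ∫ x in (0 : ℝ)..t, w (l + 1) x := by
      ext t; rw [← h.sub_eq l hl 0 t]; ring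
    rw [this]
    exact h1.deriv
  rw [← intervalIntegral.integral_eq_integral_of_support_subset hsub',
    hAC.integral_mul_deriv_eq_deriv_mul hφAC, hRφ' _ (le_abs_self _),
    hRφ' (-(R + 1)) (by rw [abs_neg]; exact le_abs_self _)]
  have hsub2 : Function.support (fun t => w (l + 1) t * φ t) ⊆ Ioc (-(R + 1)) (R + 1) :=
    hsub.trans (Ioc_subset_Ioc (by linarith) (by linarith))
  rw [← intervalIntegral.integral_eq_integral_of_support_subset hsub2,
    intervalIntegral.integral_congr_ae (g := fun t => w (l + 1) t * φ t)]
  · ring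
  · filter_upwards [hae] with t ht _
    rw [ht]

theorem IsSobolevJet.integral_mul_iteratedDeriv {k l : ℕ} {w : ℕ → ℝ → ℝ} (h : IsSobolevJet k w)
    (hl : l ≤ k) {φ : ℝ → ℝ} (hφ : IsTestFun univ φ) :
    ∫ t, w 0 t * iteratedDeriv l φ t = (-1) ^ l * ∫ t, w l t * φ t := by
  induction l generalizing φ with
  | zero => simp
  | succ l ih =>
    rw [iteratedDeriv_succ', ih (by omega) hφ.deriv, h.integral_mul_deriv hl hφ]
    ring

theorem IsSobolevJet.isWeakDeriv {k l : ℕ} {w : ℕ → ℝ → ℝ} (h : IsSobolevJet k w) (hl : l ≤ k)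
    (Ω : Set ℝ) : IsWeakDeriv Ω l (w 0) (w l) := by
  refine ⟨(h.locallyIntegrable (Nat.zero_le k)).locallyIntegrableOn Ω,
    (h.locallyIntegrable hl).locallyIntegrableOn Ω, fun φ h1 h2 h3 => ?_⟩
  have hφ : IsTestFun Ω φ := ⟨h1, h2, h3⟩
  rw [(hφ.iteratedDeriv l).setIntegral_mul, hφ.setIntegral_mul,
    h.integral_mul_iteratedDeriv hl (hφ.mono (subset_univ _))]

theorem IsWeakDeriv.ae_eq {Ω : Set ℝ} {l : ℕ} {u g g' : ℝ → ℝ} (hΩ : IsOpen Ω)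
    (h : IsWeakDeriv Ω l u g) (h' : IsWeakDeriv Ω l u g') : g =ᵐ[volume.restrict Ω] g' := by
  have key : ∀ᵐ x, x ∈ Ω → (g - g') x = 0 := by
    refine hΩ.ae_eq_zero_of_integral_contDiff_smul_eq_zero (h.2.sub h'.2) fun φ h1 h2 h3 => ?_
    have hφ : IsTestFun Ω φ := ⟨h1, h2, h3⟩
    have e := (h.3 φ h1 h2 h3).symm.trans (h'.3 φ h1 h2 h3)
    rw [mul_right_inj' (by simp), hφ.setIntegral_mul, hφ.setIntegral_mul] at e
    have : ∀ x, φ x • (g - g') x = g x * φ x - g' x * φ x := fun x => by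
      simp only [Pi.sub_apply, smul_eq_mul]; ring
    simp only [this]
    rw [integral_sub (hφ.integrable_mul h.2) (hφ.integrable_mul h'.2), e, sub_self]
  rw [EventuallyEq, ae_restrict_iff' hΩ.measurableSet]
  filter_upwards [key] with x hx hxΩ
  exact sub_eq_zero.1 (hx hxΩ)

theorem IsWeakDeriv.weakDeriv_ae_eq {Ω : Set ℝ} {l : ℕ} {u g : ℝ → ℝ} (hΩ : IsOpen Ω)
    (h : IsWeakDeriv Ω l u g) : weakDeriv Ω l u =ᵐ[volume.restrict Ω] g := by
  have hex : ∃ g, IsWeakDeriv Ω l u g := ⟨g, h⟩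
  rw [weakDeriv, dif_pos hex]
  exact hex.choose_spec.ae_eq hΩ h

/-- A test function of integral zero is the derivative of a test function. -/
theorem exists_isTestFun_deriv_eq {Ω : Set ℝ} (hΩ : Ω.OrdConnected) {ψ : ℝ → ℝ}
    (hψ : IsTestFun Ω ψ) (h0 : ∫ t, ψ t = 0) :
    IsTestFun Ω (fun t => ∫ s in Iic t, ψ s) ∧ ∀ t, deriv (fun t => ∫ s in Iic t, ψ s) t = ψ t := by
  have hint : Integrable ψ := hψ.1.continuous.integrable_of_hasCompactSupport hψ.2
  have hd : ∀ t, HasDerivAt (fun t => ∫ s in Iic t, ψ s) (ψ t) t := by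
    intro t
    have e : (fun t => ∫ s in Iic t, ψ s) = fun t => (∫ s in Iic 0, ψ s) + ∫ s in (0 : ℝ)..t, ψ s := by
      ext t
      rw [← intervalIntegral.integral_Iic_sub_Iic hint.integrableOn hint.integrableOn]
      ring
    rw [e]
    exact (intervalIntegral.integral_hasDerivAt_right (hψ.1.continuous.intervalIntegrable _ _)
      hψ.1.continuous.aestronglyMeasurable.stronglyMeasurableAtFilter
      hψ.1.continuous.continuousAt).const_add _
  have hderiv : deriv (fun t => ∫ s in Iic t, ψ s) = ψ := funext fun t => (hd t).deriv
  refine ⟨?_, fun t => (hd t).deriv⟩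
  have hcd : ContDiff ℝ ∞ (fun t => ∫ s in Iic t, ψ s) := by
    rw [contDiff_infty_iff_deriv, hderiv]
    exact ⟨fun t => (hd t).differentiableAt, hψ.1⟩
  rcases (tsupport ψ).eq_empty_or_nonempty with he | hne
  · have : ψ = 0 := tsupport_eq_empty_iff.1 he
    subst this
    refine ⟨hcd, ?_, ?_⟩ <;> simp [HasCompactSupport, tsupport]
  · have hc : IsCompact (tsupport ψ) := hψ.2
    obtain ⟨p, hp⟩ := hc.exists_isLeast hne
    obtain ⟨q, hq⟩ := hc.exists_isGreatest hne
    have hs : Function.support (fun t => ∫ s in Iic t, ψ s) ⊆ Icc p q := by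
      intro t ht
      by_contra hn
      apply ht
      rw [mem_Icc, not_and_or] at hn
      rcases hn with hn | hn
      · refine setIntegral_eq_zero_of_forall_eq_zero fun s hs => ?_
        refine image_eq_zero_of_notMem_tsupport fun hs' => hn ?_
        exact (hp.2 hs').trans hs
      · show ∫ s in Iic t, ψ s = 0
        rw [setIntegral_eq_integral_of_forall_compl_eq_zero, h0]
        intro s hs
        refine image_eq_zero_of_notMem_tsupport fun hs' => hs ?_
        exact (hq.2 hs').trans (not_le.1 hn).le
    have hts := closure_minimal hs isClosed_Icc
    exact ⟨hcd, isCompact_Icc.of_isClosed_subset (isClosed_tsupport _) hts,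
      hts.trans (hΩ.out (hψ.3 hp.1) (hψ.3 hq.1))⟩

/-- The lemma of du Bois-Reymond. -/
theorem exists_ae_eq_const_of_integral_mul_deriv_eq_zero {Ω : Set ℝ} (hΩ : IsOpen Ω)
    (hΩ' : Ω.OrdConnected) {v : ℝ → ℝ} (hv : LocallyIntegrableOn v Ω volume)
    (h : ∀ φ, IsTestFun Ω φ → ∫ t, v t * deriv φ t = 0) :
    ∃ c : ℝ, ∀ᵐ t ∂(volume.restrict Ω), v t = c := by
  rcases Ω.eq_empty_or_nonempty with rfl | ⟨x, hx⟩
  · exact ⟨0, by simp⟩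
  obtain ⟨f, hf1, hf2, hf3, hf4, hf5⟩ :=
    exists_contDiff_tsupport_subset (n := ⊤) (hΩ.mem_nhds hx)
  have hf : IsTestFun Ω f := ⟨hf3, hf2, hf1⟩
  have hfi : Integrable f := hf3.continuous.integrable_of_hasCompactSupport hf2
  have hpos : 0 < ∫ t, f t := by
    refine hf3.continuous.integral_pos_of_hasCompactSupport_nonneg_nonzero hf2
      (fun t => (hf4 (mem_range_self t)).1) (x := x) ?_
    simp [hf5]
  set c := (∫ t, v t * f t) / ∫ t, f t with hc
  refine ⟨c, ?_⟩
  have key : ∀ᵐ t, t ∈ Ω → (fun t => v t - c) t = 0 := by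
    refine hΩ.ae_eq_zero_of_integral_contDiff_smul_eq_zero
      (hv.sub (locallyIntegrableOn_const c)) fun ψ h1 h2 h3 => ?_
    have hψ : IsTestFun Ω ψ := ⟨h1, h2, h3⟩
    have hψi : Integrable ψ := h1.continuous.integrable_of_hasCompactSupport h2
    set m := (∫ t, ψ t) / ∫ t, f t with hm
    have hχ : IsTestFun Ω fun t => ψ t - m * f t := hψ.sub (hf.const_mul m)
    have hχ0 : ∫ t, (ψ t - m * f t) = 0 := by
      rw [integral_sub hψi (hfi.const_mul m), integral_const_mul, hm]
      field_simp
      ring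
    obtain ⟨hΦ, hΦ'⟩ := exists_isTestFun_deriv_eq hΩ' hχ hχ0
    have e := h _ hΦ
    simp only [hΦ'] at e
    have e2 : ∀ t, v t * (ψ t - m * f t) = v t * ψ t - m * (v t * f t) := fun t => by ring
    simp only [e2] at e
    rw [integral_sub (hψ.integrable_mul hv) ((hf.integrable_mul hv).const_mul m),
      integral_const_mul] at e
    have e3 : ∀ t, ψ t • (v t - c) = v t * ψ t - c * ψ t := fun t => by
      simp only [smul_eq_mul]; ring
    simp only [e3]
    rw [integral_sub (hψ.integrable_mul hv) (hψi.const_mul c), integral_const_mul, ← e, hm, hc]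
    field_simp
  rw [ae_restrict_iff' hΩ.measurableSet]
  filter_upwards [key] with t ht htΩ
  exact sub_eq_zero.1 (ht htΩ)

/-! ### Jets of Sobolev functions and the rescaled energy -/

/-- The jet obtained from `w` by adjoining the primitive of `w 0` with value `c` at `0`. -/
noncomputable def consJet (c : ℝ) (w : ℕ → ℝ → ℝ) : ℕ → ℝ → ℝ
  | 0 => fun t => c + ∫ x in (0 : ℝ)..t, w 0 x
  | l + 1 => w l

theorem IsSobolevJet.cons {k : ℕ} {w : ℕ → ℝ → ℝ} (h : IsSobolevJet k w) (c : ℝ) :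
    IsSobolevJet (k + 1) (consJet c w) := by
  refine ⟨h.memLp, fun l hl s t => ?_⟩
  cases l with
  | zero =>
    simp only [consJet, add_sub_add_left_eq_sub]
    exact intervalIntegral.integral_interval_sub_left (h.intervalIntegrable (Nat.zero_le _) _ _)
      (h.intervalIntegrable (Nat.zero_le _) _ _)
  | succ l => exact h.sub_eq l (by omega) s t

/-- Functions `g 0, …, g k` that are successive weak derivatives come from a jet. The jet is built by
successive primitives starting from `g k`, extended by zero outside `Ω`; the constants of
integration are given by the lemma of du Bois-Reymond. -/
theorem exists_isSobolevJet {Ω : Set ℝ} (hΩ : IsOpen Ω) (hΩ' : Ω.OrdConnected) (k : ℕ)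
    (g : ℕ → ℝ → ℝ) (hloc : ∀ l ≤ k, LocallyIntegrableOn (g l) Ω volume)
    (hg : ∀ l < k, ∀ φ, IsTestFun Ω φ → ∫ t, g l t * deriv φ t = -∫ t, g (l + 1) t * φ t)
    (htop : ∀ K, IsCompact K → MemLp (Ω.indicator (g k)) 2 (volume.restrict K)) :
    ∃ w, IsSobolevJet k w ∧ w 0 =ᵐ[volume.restrict Ω] g 0 ∧ w k =ᵐ[volume.restrict Ω] g k := by
  induction k generalizing g with
  | zero =>
    have : Ω.indicator (g 0) =ᵐ[volume.restrict Ω] g 0 :=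
      indicator_ae_eq_restrict hΩ.measurableSet
    exact ⟨fun _ => Ω.indicator (g 0), ⟨htop, fun l hl => by omega⟩, this, this⟩
  | succ k ih =>
    obtain ⟨w, hw, hw0, hwk⟩ := ih (fun l => g (l + 1)) (fun l hl => hloc (l + 1) (by omega))
      (fun l hl => hg (l + 1) (by omega)) htop
    have hv := hw.cons 0
    set v : ℕ → ℝ → ℝ := consJet 0 w with hvdef
    have hvloc : LocallyIntegrableOn (v 0) Ω volume :=
      (hv.locallyIntegrable (Nat.zero_le _)).locallyIntegrableOn Ω
    have hg0 : LocallyIntegrableOn (g 0) Ω volume := hloc 0 (Nat.zero_le _)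
    obtain ⟨c, hc⟩ := exists_ae_eq_const_of_integral_mul_deriv_eq_zero hΩ hΩ'
      (hg0.sub hvloc) fun φ hφ => by
        have e1 : ∀ t, (g 0 - v 0) t * deriv φ t = g 0 t * deriv φ t - v 0 t * deriv φ t :=
          fun t => by simp only [Pi.sub_apply]; ring
        simp only [e1]
        rw [integral_sub (hφ.deriv.integrable_mul hg0) (hφ.deriv.integrable_mul hvloc),
          hg 0 (by omega) φ hφ, hv.integral_mul_deriv (by omega) (hφ.mono (subset_univ _)),
          ← hφ.setIntegral_mul, ← hφ.setIntegral_mul, sub_neg_eq_add, neg_add_eq_zero]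
        refine integral_congr_ae ?_
        filter_upwards [hw0] with t ht
        show g 1 t * φ t = w 0 t * φ t
        rw [ht]
    refine ⟨_, hw.cons c, ?_, hwk⟩
    filter_upwards [hc] with t ht
    simp only [Pi.sub_apply, hvdef, consJet] at ht
    show c + ∫ x in (0 : ℝ)..t, w 0 x = g 0 t
    linarith

theorem IsWeakDeriv.integral_mul_deriv {Ω : Set ℝ} {l : ℕ} {u g g' : ℝ → ℝ}
    (h : IsWeakDeriv Ω l u g) (h' : IsWeakDeriv Ω (l + 1) u g') {φ : ℝ → ℝ}
    (hφ : IsTestFun Ω φ) : ∫ t, g t * deriv φ t = -∫ t, g' t * φ t := by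
  have e1 := h.3 _ hφ.deriv.1 hφ.deriv.2 hφ.deriv.3
  have e2 := h'.3 _ hφ.1 hφ.2 hφ.3
  rw [← iteratedDeriv_succ', e2, hφ.setIntegral_mul, hφ.deriv.setIntegral_mul, pow_succ] at e1
  have h1 : ((-1 : ℝ) ^ l) ≠ 0 := by simp
  apply mul_left_cancel₀ h1
  rw [← e1]; ring

theorem isWeakDeriv_zero {Ω : Set ℝ} {u : ℝ → ℝ} (hu : LocallyIntegrableOn u Ω volume) :
    IsWeakDeriv Ω 0 u u :=
  ⟨hu, hu, fun φ _ _ _ => by simp⟩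

theorem exists_isSobolevJet_of_isWeakDeriv {Ω : Set ℝ} (hΩ : IsOpen Ω) (hΩ' : Ω.OrdConnected)
    {k : ℕ} {u : ℝ → ℝ} {g : ℕ → ℝ → ℝ} (hg : ∀ l ≤ k, IsWeakDeriv Ω l u (g l))
    (htop : ∀ K, IsCompact K → MemLp (Ω.indicator (g k)) 2 (volume.restrict K)) :
    ∃ w, IsSobolevJet k w ∧ w 0 =ᵐ[volume.restrict Ω] u ∧
      w k =ᵐ[volume.restrict Ω] weakDeriv Ω k u := by
  obtain ⟨w, h1, h2, h3⟩ := exists_isSobolevJet hΩ hΩ' k g (fun l hl => (hg l hl).2)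
    (fun l hl φ hφ => (hg l hl.le).integral_mul_deriv (hg (l + 1) hl) hφ) htop
  exact ⟨w, h1, h2.trans ((hg 0 (Nat.zero_le _)).ae_eq hΩ (isWeakDeriv_zero (hg 0 (by simp)).1)),
    h3.trans ((hg k le_rfl).weakDeriv_ae_eq hΩ).symm⟩

theorem MemHk.exists_isSobolevJet {a b : ℝ} {k : ℕ} {u : ℝ → ℝ} (h : MemHk (Ioo a b) k u) :
    ∃ w, IsSobolevJet k w ∧ w 0 =ᵐ[volume.restrict (Ioo a b)] u ∧
      w k =ᵐ[volume.restrict (Ioo a b)] weakDeriv (Ioo a b) k u := by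
  have hex : ∀ l, ∃ g, l ≤ k → IsWeakDeriv (Ioo a b) l u g ∧
      MemLp g 2 (volume.restrict (Ioo a b)) := fun l => by
    by_cases hl : l ≤ k
    · obtain ⟨g, hg⟩ := h.2 l hl
      exact ⟨g, fun _ => hg⟩
    · exact ⟨0, fun h => absurd h hl⟩
  choose g hg using hex
  refine exists_isSobolevJet_of_isWeakDeriv isOpen_Ioo ordConnected_Ioo
    (fun l hl => (hg l hl).1) fun K _ => ?_
  exact ((memLp_indicator_iff_restrict measurableSet_Ioo).2 (hg k le_rfl).2).restrict K

theorem MemHkLoc.exists_isSobolevJet {k : ℕ} {u : ℝ → ℝ} (h : MemHkLoc k u) :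
    ∃ w, IsSobolevJet k w ∧ w 0 =ᵐ[volume] u ∧ w k =ᵐ[volume] weakDeriv univ k u := by
  have hex : ∀ l, ∃ g, l ≤ k → IsWeakDeriv univ l u g ∧
      ∀ K : Set ℝ, IsCompact K → MemLp g 2 (volume.restrict K) := fun l => by
    by_cases hl : l ≤ k
    · obtain ⟨g, hg⟩ := h.2 l hl
      exact ⟨g, fun _ => hg⟩
    · exact ⟨0, fun h => absurd h hl⟩
  choose g hg using hex
  have := exists_isSobolevJet_of_isWeakDeriv isOpen_univ ordConnected_univ
    (fun l hl => (hg l hl).1) fun K hK => by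
      rw [indicator_univ]
      exact (hg k le_rfl).2 K hK
  simpa only [Measure.restrict_univ] using this

theorem IsSobolevJet.memHk {k : ℕ} {w : ℕ → ℝ → ℝ} (h : IsSobolevJet k w) (a b : ℝ) :
    MemHk (Ioo a b) k (w 0) := by
  have hm : ∀ l ≤ k, MemLp (w l) 2 (volume.restrict (Ioo a b)) := fun l hl =>
    (h.memLp_of_le hl isCompact_Icc).mono_measure (Measure.restrict_mono_set _ Ioo_subset_Icc_self)
  exact ⟨hm 0 (Nat.zero_le _), fun l hl => ⟨w l, h.isWeakDeriv hl _, hm l hl⟩⟩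

theorem IsSobolevJet.memHkLoc {k : ℕ} {w : ℕ → ℝ → ℝ} (h : IsSobolevJet k w) :
    MemHkLoc k (w 0) :=
  ⟨fun _ hK => h.memLp_of_le (Nat.zero_le _) hK,
    fun l hl => ⟨w l, h.isWeakDeriv hl _, fun _ hK => h.memLp_of_le hl hK⟩⟩

theorem MemHk.phaseEnergy_eq {a b ε : ℝ} {k : ℕ} {W u : ℝ → ℝ} (hu : MemHk (Ioo a b) k u)
    {w : ℕ → ℝ → ℝ} (h0 : w 0 =ᵐ[volume.restrict (Ioo a b)] u)
    (hk : w k =ᵐ[volume.restrict (Ioo a b)] weakDeriv (Ioo a b) k u) :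
    phaseEnergy a b k W ε u = ∫⁻ t in Ioo a b,
      ENNReal.ofReal (1 / ε * W (w 0 t) + ε ^ (2 * k - 1) * w k t ^ 2) := by
  rw [phaseEnergy, if_pos hu]
  refine lintegral_congr_ae ?_
  filter_upwards [h0, hk] with t h1 h2
  rw [h1, h2]

theorem IsSobolevJet.phaseEnergy_eq {a b ε : ℝ} {k : ℕ} {W : ℝ → ℝ} {w : ℕ → ℝ → ℝ}
    (h : IsSobolevJet k w) : phaseEnergy a b k W ε (w 0) = ∫⁻ t in Ioo a b,
      ENNReal.ofReal (1 / ε * W (w 0 t) + ε ^ (2 * k - 1) * w k t ^ 2) :=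
  (h.memHk a b).phaseEnergy_eq EventuallyEq.rfl
    ((h.isWeakDeriv le_rfl _).weakDeriv_ae_eq isOpen_Ioo).symm

/-- The unscaled energy `∫_S (W(w) + (w^{(k)})²) dt` of a jet `w`. -/
noncomputable def jetEnergy (W : ℝ → ℝ) (k : ℕ) (w : ℕ → ℝ → ℝ) (S : Set ℝ) : ℝ≥0∞ :=
  ∫⁻ t in S, ENNReal.ofReal (W (w 0 t) + w k t ^ 2)

theorem jetEnergy_mono {W : ℝ → ℝ} {k : ℕ} {w : ℕ → ℝ → ℝ} {S T : Set ℝ} (h : S ⊆ T) :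
    jetEnergy W k w S ≤ jetEnergy W k w T :=
  lintegral_mono_set h

theorem jetEnergy_affineJet {W : ℝ → ℝ} {k : ℕ} {w : ℕ → ℝ → ℝ} {c : ℝ} (hc : c ≠ 0) (d : ℝ)
    {S : Set ℝ} (hS : MeasurableSet S) :
    jetEnergy W k (affineJet c d w) ((fun t => c * t + d) ⁻¹' S) =
      ∫⁻ t in S, ENNReal.ofReal (|c|⁻¹ * (W (w 0 t) + (c ^ k * w k t) ^ 2)) := by
  have hsurj : Function.Surjective fun t : ℝ => c * t + d := fun y =>
    ⟨(y - d) / c, by field_simp; ring⟩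
  have hm : MeasurableSet ((fun t : ℝ => c * t + d) ⁻¹' S) := hS.preimage (by fun_prop)
  have h := lintegral_image_eq_lintegral_abs_deriv_mul hm (f := fun t : ℝ => c * t + d)
    (f' := fun _ => c)
    (fun x _ => by simpa using (((hasDerivAt_id x).const_mul c).add_const d).hasDerivWithinAt)
    (measurableEmbedding_affine hc d).injective.injOn
    (fun t => ENNReal.ofReal (|c|⁻¹ * (W (w 0 t) + (c ^ k * w k t) ^ 2)))
  rw [image_preimage_eq _ hsurj] at h
  rw [h, jetEnergy]
  refine lintegral_congr fun t => ?_
  rw [← ENNReal.ofReal_mul (abs_nonneg _), mul_inv_cancel_left₀ (abs_ne_zero.2 hc)]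
  simp [affineJet]

/-- The powers of `ε` in `F_ε` are those for which the change of variables `t ↦ ε t + s` reduces it
to the unscaled energy. -/
theorem jetEnergy_rescale {W : ℝ → ℝ} {k : ℕ} (hk : 1 ≤ k) {w : ℕ → ℝ → ℝ} {ε : ℝ} (hε : 0 < ε)
    (s : ℝ) {S : Set ℝ} (hS : MeasurableSet S) :
    jetEnergy W k (affineJet ε s w) ((fun t => ε * t + s) ⁻¹' S) =
      ∫⁻ t in S, ENNReal.ofReal (1 / ε * W (w 0 t) + ε ^ (2 * k - 1) * w k t ^ 2) := by
  rw [jetEnergy_affineJet hε.ne' s hS]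
  refine lintegral_congr fun t => ?_
  congr 1
  obtain ⟨n, rfl⟩ : ∃ n, k = n + 1 := ⟨k - 1, by omega⟩
  have : 2 * (n + 1) - 1 = 2 * n + 1 := by omega
  rw [this, abs_of_pos hε]
  field_simp
  ring

theorem jetEnergy_reflect {W : ℝ → ℝ} {k : ℕ} {w : ℕ → ℝ → ℝ} {S : Set ℝ} (hS : MeasurableSet S) :
    jetEnergy W k (affineJet (-1) 0 w) ((fun t => -1 * t + 0) ⁻¹' S) = jetEnergy W k w S := by
  rw [jetEnergy_affineJet (by norm_num) 0 hS, jetEnergy]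
  refine lintegral_congr fun t => ?_
  congr 1
  rw [mul_pow, ← pow_mul, mul_comm k 2, pow_mul]
  simp

theorem profileConst_le_jetEnergy {W : ℝ → ℝ} {k : ℕ} (hk : 1 ≤ k) {w : ℕ → ℝ → ℝ}
    (h : IsSobolevJet k w) (h1 : Tendsto (w 0) atTop (𝓝 1)) (h2 : Tendsto (w 0) atBot (𝓝 (-1))) :
    profileConst k W ≤ jetEnergy W k w univ := by
  refine (iInf₂_le (w 0) ⟨h.continuous hk, h.memHkLoc, h1, h2⟩).trans_eq ?_
  rw [jetEnergy, Measure.restrict_univ]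
  refine lintegral_congr_ae ?_
  have := (h.isWeakDeriv le_rfl univ).weakDeriv_ae_eq isOpen_univ
  rw [Measure.restrict_univ] at this
  filter_upwards [this] with t ht
  rw [ht]

theorem exists_jetEnergy_lt {W : ℝ → ℝ} {k : ℕ} (hk : 1 ≤ k) {M : ℝ≥0∞}
    (hM : profileConst k W < M) :
    ∃ w, IsSobolevJet k w ∧ Tendsto (w 0) atTop (𝓝 1) ∧ Tendsto (w 0) atBot (𝓝 (-1)) ∧
      jetEnergy W k w univ < M := by
  simp only [profileConst, iInf_lt_iff] at hM
  obtain ⟨u, ⟨hc, hu, h1, h2⟩, hlt⟩ := hM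
  obtain ⟨w, hw, e0, ek⟩ := hu.exists_isSobolevJet
  have e : w 0 = u := (hw.continuous hk).ae_eq_iff_eq volume hc |>.1 e0
  refine ⟨w, hw, e ▸ h1, e ▸ h2, ?_⟩
  refine lt_of_eq_of_lt ?_ hlt
  rw [jetEnergy, Measure.restrict_univ]
  refine lintegral_congr_ae ?_
  filter_upwards [ek] with t ht
  rw [ht, e]

/-! ### Interpolation on a unit interval -/

/-- Interpolation on a unit interval: if `w` is bounded by `ρ` at `2 ^ k` points at distance at
least `d` from each other, and its derivative of order `k` has oscillation at most `ρ`, then all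
derivatives up to order `k` are bounded by a multiple of `ρ`. -/
theorem exists_jet_bound (k : ℕ) {d : ℝ} (hd : 0 < d) : ∃ C : ℝ, 0 < C ∧
    ∀ w, IsSobolevJet (k + 1) w → ∀ (p ρ : ℝ) (x : ℕ → ℝ),
      (∀ i < 2 ^ k, x i ∈ Icc p (p + 1)) → (∀ i, i + 1 < 2 ^ k → x i + d ≤ x (i + 1)) →
      (∀ i < 2 ^ k, |w 0 (x i)| ≤ ρ) →
      (∀ s ∈ Icc p (p + 1), ∀ t ∈ Icc p (p + 1), |∫ y in s..t, w (k + 1) y| ≤ ρ) →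
      ∀ l ≤ k, ∀ t ∈ Icc p (p + 1), |w l t| ≤ C * ρ := by
  induction k with
  | zero =>
    refine ⟨2, by norm_num, fun w hw p ρ x hx _ hρ hint l hl t ht => ?_⟩
    obtain rfl : l = 0 := by omega
    have h1 := hw.sub_eq 0 (by omega) (x 0) t
    have h2 := hint (x 0) (hx 0 (by simp)) t ht
    have h3 := hρ 0 (by simp)
    rw [← h1] at h2
    have := abs_add_le (w 0 (x 0)) (w 0 t - w 0 (x 0))
    rw [add_sub_cancel] at this
    linarith
  | succ k ih =>
    obtain ⟨C, hC, hCw⟩ := ih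
    refine ⟨1 + C * (2 / d + 1), by positivity, fun w hw p ρ x hx hxd hρ hint => ?_⟩
    have hpow : 2 ^ (k + 1) = 2 * 2 ^ k := by ring
    have hρ0 : 0 ≤ ρ := (abs_nonneg _).trans (hρ 0 (by positivity))
    -- mean value points of disjoint pairs of nodes serve as nodes for the derivative
    have hy : ∀ i, ∃ y, i < 2 ^ k → y ∈ Ioo (x (2 * i)) (x (2 * i + 1)) ∧
        |w 1 y| ≤ (2 / d + 1) * ρ := fun i => by
      by_cases hi : i < 2 ^ k
      · have hlt := hxd (2 * i) (by omega)
        obtain ⟨y, hy, hy'⟩ := exists_hasDerivAt_eq_slope (w 0) (w 1)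
          (show x (2 * i) < x (2 * i + 1) by linarith) (hw.continuous (by omega)).continuousOn
          fun y _ => hw.hasDerivAt (by omega) y
        refine ⟨y, fun _ => ⟨hy, ?_⟩⟩
        have h1 := hρ (2 * i) (by omega)
        have h2 := hρ (2 * i + 1) (by omega)
        have h3 : |w 0 (x (2 * i + 1)) - w 0 (x (2 * i))| ≤ 2 * ρ :=
          (abs_sub _ _).trans (by linarith)
        rw [hy', abs_div, abs_of_pos (show 0 < x (2 * i + 1) - x (2 * i) by linarith)]
        calc _ ≤ 2 * ρ / d := by gcongr; linarith
          _ ≤ (2 / d + 1) * ρ := by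
            have : 2 * ρ / d = 2 / d * ρ := by ring
            linarith
      · exact ⟨0, fun h => absurd h hi⟩
    choose y hy using hy
    have key := hCw _ hw.tail p ((2 / d + 1) * ρ) y
      (fun i hi => ⟨(hx (2 * i) (by omega)).1.trans (hy i hi).1.1.le,
        (hy i hi).1.2.le.trans (hx (2 * i + 1) (by omega)).2⟩)
      (fun i hi => by
        have h1 := (hy i (by omega)).1.2
        have h2 := (hy (i + 1) hi).1.1
        have h3 := hxd (2 * i + 1) (by omega)
        rw [show 2 * (i + 1) = 2 * i + 1 + 1 by ring] at h2
        linarith)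
      (fun i hi => (hy i hi).2)
      (fun s hs t ht => (hint s hs t ht).trans (by
        have : 0 ≤ 2 / d * ρ := by positivity
        linarith))
    have hle : C * ((2 / d + 1) * ρ) ≤ (1 + C * (2 / d + 1)) * ρ := by linarith
    intro l hl t ht
    cases l with
    | succ l => exact (key l (by omega) t ht).trans hle
    | zero =>
      have h0 := hx 0 (by positivity)
      have h1 := hw.sub_eq 0 (by omega) (x 0) t
      have h3 := hρ 0 (by positivity)
      have h4 : ‖∫ y in (x 0)..t, w 1 y‖ ≤ C * ((2 / d + 1) * ρ) * |t - x 0| := by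
        refine intervalIntegral.norm_integral_le_of_norm_le_const fun y hy => ?_
        have hy' := uIcc_subset_Icc h0 ht (uIoc_subset_uIcc hy)
        exact key 0 (Nat.zero_le _) y hy'
      rw [zero_add] at h1
      rw [← h1, Real.norm_eq_abs] at h4
      have h5 : |t - x 0| ≤ 1 := by
        rw [abs_le]; constructor <;> linarith [h0.1, h0.2, ht.1, ht.2]
      have h6 : C * ((2 / d + 1) * ρ) * |t - x 0| ≤ C * ((2 / d + 1) * ρ) :=
        mul_le_of_le_one_right (by positivity) h5
      have := abs_add_le (w 0 (x 0)) (w 0 t - w 0 (x 0))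
      rw [add_sub_cancel] at this
      linarith

/-- Young's inequality `|y| ≤ ρ / 2 + y ^ 2 / (2 ρ)` bounds `∫ |w^{(k)}|` on a unit interval. -/
theorem abs_integral_le_of_jetEnergy {W : ℝ → ℝ} (hW0 : ∀ z, 0 ≤ W z) {k : ℕ} {w : ℕ → ℝ → ℝ}
    {p ρ : ℝ} (hρ : 0 < ρ)
    (hE : jetEnergy W k w (Ioo p (p + 1)) ≤ ENNReal.ofReal (ρ ^ 2)) {s t : ℝ}
    (hs : s ∈ Icc p (p + 1)) (ht : t ∈ Icc p (p + 1)) : |∫ y in s..t, w k y| ≤ ρ := by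
  have h1 : ‖∫ y in s..t, w k y‖ₑ ≤ ∫⁻ y in uIoc s t, ‖w k y‖ₑ := by
    rw [← ofReal_norm, intervalIntegral.norm_intervalIntegral_eq, ofReal_norm]
    exact enorm_integral_le_lintegral_enorm _
  have hsub : uIoc s t ⊆ Ioc p (p + 1) := by
    rw [uIoc]
    exact Ioc_subset_Ioc (le_min hs.1 ht.1) (max_le hs.2 ht.2)
  have h2 : ∫⁻ y in uIoc s t, ‖w k y‖ₑ ≤ ∫⁻ y in Ioo p (p + 1), ‖w k y‖ₑ := by
    rw [setLIntegral_congr (Ioo_ae_eq_Ioc (a := p) (b := p + 1))]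
    exact lintegral_mono_set hsub
  have h3 : ∫⁻ y in Ioo p (p + 1), ‖w k y‖ₑ ≤ ∫⁻ y in Ioo p (p + 1), (ENNReal.ofReal (ρ / 2) +
      ENNReal.ofReal (1 / (2 * ρ)) * ENNReal.ofReal (W (w 0 y) + w k y ^ 2)) := by
    refine lintegral_mono fun y => ?_
    rw [← ENNReal.ofReal_mul (by positivity), ← ENNReal.ofReal_add (by positivity)
      (by have := hW0 (w 0 y); positivity), Real.enorm_eq_ofReal_abs]
    refine ENNReal.ofReal_le_ofReal ?_
    have h4 : |w k y| ≤ ρ / 2 + 1 / (2 * ρ) * w k y ^ 2 := by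
      have : 0 ≤ (|w k y| - ρ) ^ 2 / (2 * ρ) := by positivity
      rw [sub_sq, sq_abs] at this
      have e : (w k y ^ 2 - 2 * |w k y| * ρ + ρ ^ 2) / (2 * ρ) =
          ρ / 2 + 1 / (2 * ρ) * w k y ^ 2 - |w k y| := by field_simp; ring
      linarith
    have h5 : 0 ≤ 1 / (2 * ρ) * W (w 0 y) := by have := hW0 (w 0 y); positivity
    rw [mul_add]
    linarith
  rw [lintegral_add_left measurable_const, lintegral_const_mul' _ _ ENNReal.ofReal_ne_top,
    lintegral_const] at h3
  have h6 : ENNReal.ofReal |∫ y in s..t, w k y| ≤ ENNReal.ofReal ρ := by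
    rw [← Real.enorm_eq_ofReal_abs]
    refine ((h1.trans h2).trans h3).trans ?_
    have h7 : ENNReal.ofReal (1 / (2 * ρ)) * jetEnergy W k w (Ioo p (p + 1)) ≤
        ENNReal.ofReal (1 / (2 * ρ)) * ENNReal.ofReal (ρ ^ 2) := by gcongr
    rw [jetEnergy] at h7
    refine (add_le_add le_rfl h7).trans_eq ?_
    simp only [Measure.restrict_apply_univ, Real.volume_Ioo, add_sub_cancel_left,
      ENNReal.ofReal_one, mul_one]
    rw [← ENNReal.ofReal_mul (by positivity), ← ENNReal.ofReal_add (by positivity) (by positivity)]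
    congr 1
    field_simp
    norm_num
  exact (ENNReal.ofReal_le_ofReal_iff hρ.le).1 h6

/-! ### Cells of small energy -/

/-- The derivatives of order `< k` of `w` at `x` are within `ρ` of those of the constant `σ`. -/
def IsJetNear (k : ℕ) (w : ℕ → ℝ → ℝ) (σ ρ x : ℝ) : Prop :=
  ∀ l < k, |w l x - constJet σ l x| ≤ ρ

theorem exists_near_well {W : ℝ → ℝ} {α β : ℝ} (hα : 0 < α)
    (hWαβ : ∀ z, α * min (min ((z + 1) ^ 2) ((z - 1) ^ 2)) β ≤ W z) {k : ℕ} {w : ℕ → ℝ → ℝ}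
    {ρ s t : ℝ} (hρ : 0 < ρ) (hst : s ≤ t)
    (hE : jetEnergy W k w (Icc s t) < ENNReal.ofReal (α * min (ρ ^ 2) β * (t - s))) :
    ∃ z ∈ Icc s t, |w 0 z - 1| ≤ ρ ∨ |w 0 z - (-1)| ≤ ρ := by
  by_contra! h
  refine absurd hE (not_lt.2 ?_)
  have hle : ∀ y ∈ Icc s t, ENNReal.ofReal (α * min (ρ ^ 2) β) ≤
      ENNReal.ofReal (W (w 0 y) + w k y ^ 2) := by
    intro y hy
    refine ENNReal.ofReal_le_ofReal ?_
    obtain ⟨h1, h2⟩ := h y hy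
    have h3 : min (ρ ^ 2) β ≤ min (min ((w 0 y + 1) ^ 2) ((w 0 y - 1) ^ 2)) β := by
      refine min_le_min_right _ (le_min ?_ ?_)
      · rw [← sq_abs (w 0 y + 1), ← sub_neg_eq_add]
        gcongr
      · rw [← sq_abs (w 0 y - 1)]
        gcongr
    have h4 := hWαβ (w 0 y)
    have h5 := mul_le_mul_of_nonneg_left h3 hα.le
    have h6 := sq_nonneg (w k y)
    linarith
  have := setLIntegral_mono' (μ := volume) measurableSet_Icc hle
  rw [lintegral_const, Measure.restrict_apply_univ, Real.volume_Icc,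
    ← ENNReal.ofReal_mul' (by linarith)] at this
  exact this

/-- A unit interval of small energy is a region of one of the two phases: the jet of `w` up to order
`k - 1` is uniformly close to that of one of the wells. -/
theorem exists_energy_threshold {W : ℝ → ℝ} (hW0 : ∀ z, 0 ≤ W z) {α β : ℝ} (hα : 0 < α)
    (hβ : 0 < β) (hWαβ : ∀ z, α * min (min ((z + 1) ^ 2) ((z - 1) ^ 2)) β ≤ W z) {k : ℕ}
    (hk : 1 ≤ k) {ρ : ℝ} (hρ : 0 < ρ) : ∃ η : ℝ, 0 < η ∧ ∀ w, IsSobolevJet k w → ∀ p,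
      jetEnergy W k w (Ioo p (p + 1)) < ENNReal.ofReal η →
      ∃ σ, (σ = 1 ∨ σ = -1) ∧ ∀ t ∈ Icc p (p + 1), IsJetNear k w σ ρ t := by
  obtain ⟨n, rfl⟩ : ∃ n, k = n + 1 := ⟨k - 1, by omega⟩
  set N : ℕ := 2 ^ n with hN
  have hN0 : (0 : ℝ) < N := by positivity
  set d : ℝ := 1 / (4 * N) with hd
  have hd0 : 0 < d := by positivity
  have hNd : 2 * N * (2 * d) = 1 := by rw [hd]; field_simp; norm_num
  obtain ⟨C, hC, hCw⟩ := exists_jet_bound n hd0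
  set r : ℝ := ρ / C with hr
  have hr0 : 0 < r := by positivity
  refine ⟨min (α * min (r ^ 2) β * d) (r ^ 2), by positivity, fun w hw p hE => ?_⟩
  have hE1 : jetEnergy W (n + 1) w (Ioo p (p + 1)) < ENNReal.ofReal (α * min (r ^ 2) β * d) :=
    hE.trans_le (ENNReal.ofReal_le_ofReal (min_le_left _ _))
  have hE2 : jetEnergy W (n + 1) w (Ioo p (p + 1)) ≤ ENNReal.ofReal (r ^ 2) :=
    hE.le.trans (ENNReal.ofReal_le_ofReal (min_le_right _ _))
  have hIcc : jetEnergy W (n + 1) w (Icc p (p + 1)) = jetEnergy W (n + 1) w (Ioo p (p + 1)) :=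
    (setLIntegral_congr Ioo_ae_eq_Icc).symm
  -- a point near one of the wells in the left half of each of `2 N` cells
  have hz : ∀ i : ℕ, ∃ z, i < 2 * N → z ∈ Icc (p + i * (2 * d)) (p + i * (2 * d) + d) ∧
      (|w 0 z - 1| ≤ r ∨ |w 0 z - (-1)| ≤ r) := by
    intro i
    by_cases hi : i < 2 * N
    · have hi' : (i : ℝ) + 1 ≤ 2 * N := by exact_mod_cast hi
      have hi'' : ((i : ℝ) + 1) * (2 * d) ≤ 1 :=
        (mul_le_mul_of_nonneg_right hi' (by positivity)).trans_eq hNd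
      obtain ⟨z, h1, h2⟩ := exists_near_well (k := n + 1) (w := w) (s := p + i * (2 * d))
        (t := p + i * (2 * d) + d) hα hWαβ hr0 (by linarith) (by
          rw [add_sub_cancel_left]
          refine lt_of_le_of_lt ?_ hE1
          rw [← hIcc]
          refine jetEnergy_mono (Icc_subset_Icc ?_ ?_)
          · have : (0 : ℝ) ≤ i * (2 * d) := by positivity
            linarith
          · linarith)
      exact ⟨z, fun _ => ⟨h1, h2⟩⟩
    · exact ⟨0, fun h => absurd h hi⟩
  choose z hz using hz
  -- half of these points are near the same well
  have hpig : ∃ σ : ℝ, (σ = 1 ∨ σ = -1) ∧ ∃ A : Finset ℕ, N ≤ A.card ∧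
      ∀ i ∈ A, i < 2 * N ∧ |w 0 (z i) - σ| ≤ r := by
    classical
    have hcard := Finset.card_filter_add_card_filter_not (s := Finset.range (2 * N))
      (fun i => |w 0 (z i) - 1| ≤ r)
    rw [Finset.card_range] at hcard
    rcases le_or_gt N ((Finset.range (2 * N)).filter fun i => |w 0 (z i) - 1| ≤ r).card with h | h
    · refine ⟨1, Or.inl rfl, _, h, fun i hi => ?_⟩
      simpa using hi
    · refine ⟨-1, Or.inr rfl, (Finset.range (2 * N)).filter fun i => ¬ |w 0 (z i) - 1| ≤ r,
        by omega, fun i hi => ?_⟩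
      rw [Finset.mem_filter, Finset.mem_range] at hi
      exact ⟨hi.1, ((hz i hi.1).2).resolve_left hi.2⟩
  obtain ⟨σ, hσ, A, hA, hAz⟩ := hpig
  refine ⟨σ, hσ, ?_⟩
  set e := A.orderEmbOfCardLe hA with he
  have heA : ∀ i, e i ∈ A := fun i => Finset.orderEmbOfCardLe_mem A hA i
  set x : ℕ → ℝ := fun i => if hi : i < N then z (e ⟨i, hi⟩) else 0 with hx
  have hxi : ∀ i (hi : i < N), x i = z (e ⟨i, hi⟩) := fun i hi => by simp [hx, hi]
  have hv : IsSobolevJet (n + 1) fun l t => w l t + constJet (-σ) l t :=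
    hw.add (isSobolevJet_constJet _ _)
  have key := hCw _ hv p r x
    (fun i hi => by
      rw [hxi i hi]
      have h1 := (hAz _ (heA ⟨i, hi⟩)).1
      have h2 := (hz _ h1).1
      have h1' : ((e ⟨i, hi⟩ : ℕ) : ℝ) + 1 ≤ 2 * N := by exact_mod_cast h1
      have h3 : (((e ⟨i, hi⟩ : ℕ) : ℝ) + 1) * (2 * d) ≤ 1 :=
        (mul_le_mul_of_nonneg_right h1' (by positivity)).trans_eq hNd
      have h4 : (0 : ℝ) ≤ (e ⟨i, hi⟩ : ℕ) * (2 * d) := by positivity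
      exact ⟨by linarith [h2.1], by linarith [h2.2]⟩)
    (fun i hi => by
      rw [hxi i (by omega), hxi (i + 1) hi]
      have h1 := (hz _ (hAz _ (heA ⟨i, by omega⟩)).1).1.2
      have h2 := (hz _ (hAz _ (heA ⟨i + 1, hi⟩)).1).1.1
      have h3 : e ⟨i, by omega⟩ < e ⟨i + 1, hi⟩ := e.strictMono (by simp)
      have h4 : ((e ⟨i, by omega⟩ : ℕ) : ℝ) + 1 ≤ (e ⟨i + 1, hi⟩ : ℕ) := by exact_mod_cast h3
      have h5 : (((e ⟨i, by omega⟩ : ℕ) : ℝ) + 1) * (2 * d) ≤ (e ⟨i + 1, hi⟩ : ℕ) * (2 * d) := by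
        gcongr
      linarith)
    (fun i hi => by
      rw [hxi i hi]
      simpa [← sub_eq_add_neg] using (hAz _ (heA ⟨i, hi⟩)).2)
    (fun s hs t ht => by
      simp only [constJet_succ, add_zero]
      exact abs_integral_le_of_jetEnergy hW0 hr0 hE2 hs ht)
  intro t ht l hl
  have h1 := key l (by omega) t ht
  have h2 : C * r = ρ := by rw [hr]; field_simp
  rw [h2] at h1
  convert h1 using 2
  rcases eq_or_ne l 0 with rfl | hl0
  · simp [sub_eq_add_neg]
  · simp [hl0]

/-! ### Gluing to a constant -/

/-- Compactly supported functions with prescribed unit jets at `0`: truncations of `t ^ j / j!`. -/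
theorem exists_unit_jets (k : ℕ) : ∃ (e : ℕ → ℕ → ℝ → ℝ) (B : ℝ), 0 ≤ B ∧
    (∀ j, IsSobolevJet k (e j)) ∧ (∀ j l, e j l 0 = if l = j then 1 else 0) ∧
    (∀ j l t, 1 ≤ t → e j l t = 0) ∧ ∀ j < k, ∀ l ≤ k, ∀ t, |e j l t| ≤ B := by
  let χ : ContDiffBump (0 : ℝ) := ⟨1 / 4, 1 / 2, by norm_num, by norm_num⟩
  set f : ℕ → ℝ → ℝ := fun j t => χ t * t ^ j with hf
  have htest : ∀ j, IsTestFun (Ioo (-1) 1) (f j) := fun j => by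
    refine ⟨χ.contDiff.mul (contDiff_id.pow j), χ.hasCompactSupport.mul_right, ?_⟩
    refine (tsupport_mul_subset_left (f := χ)).trans ?_
    rw [χ.tsupport_eq, Real.closedBall_eq_Icc]
    refine Icc_subset_Ioo ?_ ?_ <;> norm_num [χ]
  have hbd : ∀ j l, ∃ C, ∀ t, ‖iteratedDeriv l (f j) t‖ ≤ C := fun j l =>
    ((htest j).iteratedDeriv l).2.exists_bound_of_continuous ((htest j).iteratedDeriv l).1.continuous
  choose C hC using hbd
  have hC0 : ∀ j l, 0 ≤ C j l := fun j l => (norm_nonneg _).trans (hC j l 0)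
  refine ⟨fun j l t => (j.factorial : ℝ)⁻¹ * iteratedDeriv l (f j) t,
    ∑ j ∈ Finset.range k, ∑ l ∈ Finset.range (k + 1), (j.factorial : ℝ)⁻¹ * C j l, ?_, ?_, ?_, ?_, ?_⟩
  · exact Finset.sum_nonneg fun j _ => Finset.sum_nonneg fun l _ =>
      mul_nonneg (by positivity) (hC0 j l)
  · exact fun j => (IsSobolevJet.of_contDiff k (htest j).1).const_mul _
  · intro j l
    have : f j =ᶠ[𝓝 0] fun t => t ^ j := by
      filter_upwards [χ.eventuallyEq_one] with t ht
      simp [hf, ht]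
    dsimp only
    rw [this.iteratedDeriv_eq, iteratedDeriv_fun_pow_zero]
    split_ifs with h
    · have : (j.factorial : ℝ) ≠ 0 := by positivity
      field_simp
    · simp
  · intro j l t ht
    dsimp only
    rw [((htest j).iteratedDeriv l).eq_zero_of_notMem (fun h => not_lt.2 ht h.2), mul_zero]
  · intro j hj l hl t
    rw [abs_mul, abs_of_nonneg (by positivity)]
    have h1 : (j.factorial : ℝ)⁻¹ * |iteratedDeriv l (f j) t| ≤ (j.factorial : ℝ)⁻¹ * C j l := by
      gcongr; exact hC j l t
    refine h1.trans ?_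
    have h2 := Finset.single_le_sum (f := fun l => (j.factorial : ℝ)⁻¹ * C j l)
      (fun l _ => mul_nonneg (by positivity) (hC0 j l)) (Finset.mem_range.2 (Nat.lt_succ_of_le hl))
    have h3 := Finset.single_le_sum
      (f := fun j => ∑ l ∈ Finset.range (k + 1), (j.factorial : ℝ)⁻¹ * C j l)
      (fun j _ => Finset.sum_nonneg fun l _ => mul_nonneg (by positivity) (hC0 j l))
      (Finset.mem_range.2 hj)
    exact h2.trans h3

/-- A jet whose value at `x` is close to that of a constant can be continued to that constant on
`[x, x + 1]`, staying close to it. -/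
theorem exists_glue_const (k : ℕ) : ∃ B : ℝ, 0 < B ∧ ∀ w, IsSobolevJet k w → ∀ σ x ρ : ℝ, 0 ≤ ρ →
    IsJetNear k w σ ρ x → ∃ w', IsSobolevJet k w' ∧ (∀ l, ∀ t ≤ x, w' l t = w l t) ∧
      (∀ l, ∀ t, x + 1 ≤ t → w' l t = constJet σ l t) ∧
      ∀ l ≤ k, ∀ t, x < t → |w' l t - constJet σ l t| ≤ B * ρ := by
  obtain ⟨e, B, hB, he, he0, he1, heB⟩ := exists_unit_jets k
  refine ⟨k * B + 1, by positivity, fun w hw σ x ρ hρ hx => ?_⟩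
  set c : ℕ → ℝ := fun j => w j x - constJet σ j x with hc
  set v : ℕ → ℝ → ℝ := fun l t =>
    constJet σ l t + ∑ j ∈ Finset.range k, c j * affineJet 1 (-x) (e j) l t with hv
  have hvjet : IsSobolevJet k v := (isSobolevJet_constJet k σ).add
    (IsSobolevJet.sum _ fun j _ => ((he j).affine one_ne_zero (-x)).const_mul (c j))
  have hvx : ∀ l < k, w l x = v l x := fun l hl => by
    simp only [hv, affineJet, one_mul, add_neg_cancel, he0, one_pow, mul_ite, mul_one, mul_zero]
    rw [Finset.sum_ite_eq, if_pos (Finset.mem_range.2 hl), hc]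
    ring
  refine ⟨_, hw.ite hvjet hvx, fun l t ht => if_pos ht, fun l t ht => ?_, fun l hl t ht => ?_⟩
  · rw [if_neg (by linarith)]
    simp only [hv]
    rw [Finset.sum_eq_zero, add_zero]
    intro j _
    simp [affineJet, he1 j l (t + -x) (by linarith)]
  · rw [if_neg (by linarith)]
    simp only [hv, add_sub_cancel_left]
    calc _ ≤ ∑ j ∈ Finset.range k, |c j * affineJet 1 (-x) (e j) l t| :=
          Finset.abs_sum_le_sum_abs _ _
      _ ≤ ∑ j ∈ Finset.range k, ρ * B := by
          refine Finset.sum_le_sum fun j hj => ?_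
          rw [abs_mul]
          refine mul_le_mul (hx j (Finset.mem_range.1 hj)) ?_ (abs_nonneg _) hρ
          simpa [affineJet] using heB j (Finset.mem_range.1 hj) l hl (t + -x)
      _ = k * B * ρ := by simp; ring
      _ ≤ (k * B + 1) * ρ := by nlinarith

theorem jetEnergy_congr {W : ℝ → ℝ} {k : ℕ} {w w' : ℕ → ℝ → ℝ} {S : Set ℝ} (hS : MeasurableSet S)
    (h : ∀ l, ∀ t ∈ S, w l t = w' l t) : jetEnergy W k w S = jetEnergy W k w' S :=
  setLIntegral_congr_fun hS fun t ht => by simp only [h 0 t ht, h k t ht]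

theorem jetEnergy_union_le {W : ℝ → ℝ} {k : ℕ} {w : ℕ → ℝ → ℝ} (S T : Set ℝ) :
    jetEnergy W k w (S ∪ T) ≤ jetEnergy W k w S + jetEnergy W k w T :=
  lintegral_union_le _ _ _

theorem jetEnergy_constJet {W : ℝ → ℝ} {k : ℕ} (hk : 1 ≤ k) {σ : ℝ} (hσ : W σ = 0) (S : Set ℝ) :
    jetEnergy W k (constJet σ) S = 0 := by
  simp [jetEnergy, hσ, constJet_of_ne (show k ≠ 0 by omega)]

theorem jetEnergy_Ioi_le {W : ℝ → ℝ} {k : ℕ} (hk : 1 ≤ k) {σ : ℝ} (hσ : W σ = 0)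
    {w : ℕ → ℝ → ℝ} {x δ : ℝ} (h1 : ∀ l, ∀ t, x + 1 ≤ t → w l t = constJet σ l t)
    (h2 : ∀ t, x < t → W (w 0 t) + w k t ^ 2 ≤ δ) :
    jetEnergy W k w (Ioi x) ≤ ENNReal.ofReal δ := by
  have hI : Ioi x = Ioo x (x + 1) ∪ Ici (x + 1) := (Ioo_union_Ici_eq_Ioi (by linarith)).symm
  rw [hI]
  refine (jetEnergy_union_le _ _).trans ?_
  rw [jetEnergy_congr (S := Ici (x + 1)) measurableSet_Ici fun l t ht => h1 l t ht,
    jetEnergy_constJet hk hσ, add_zero]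
  calc jetEnergy W k w (Ioo x (x + 1)) ≤ ∫⁻ _ in Ioo x (x + 1), ENNReal.ofReal δ :=
        setLIntegral_mono' measurableSet_Ioo fun t ht => ENNReal.ofReal_le_ofReal (h2 t ht.1)
    _ = ENNReal.ofReal δ := by simp

/-- Continuing to a well a jet that is close to it costs little energy. -/
theorem exists_glue {W : ℝ → ℝ} (hW : Continuous W) {σ : ℝ} (hσ : W σ = 0) {k : ℕ} (hk : 1 ≤ k)
    {δ : ℝ} (hδ : 0 < δ) : ∃ ρ : ℝ, 0 < ρ ∧ ∀ w, IsSobolevJet k w → ∀ x,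
      IsJetNear k w σ ρ x → ∃ w', IsSobolevJet k w' ∧ (∀ l, ∀ t ≤ x, w' l t = w l t) ∧
        (∀ l, ∀ t, x + 1 ≤ t → w' l t = constJet σ l t) ∧
        jetEnergy W k w' (Ioi x) ≤ ENNReal.ofReal δ := by
  obtain ⟨B, hB, hglue⟩ := exists_glue_const k
  obtain ⟨r, hr, hrW⟩ := Metric.continuousAt_iff.1 (hW.continuousAt (x := σ)) (δ / 2) (by positivity)
  set q : ℝ := min (r / 2) (min 1 (δ / 2)) with hq
  have hq0 : 0 < q := by positivity
  have hq1 : q < r := (min_le_left _ _).trans_lt (by linarith)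
  have hq2 : q ≤ 1 := (min_le_right _ _).trans (min_le_left _ _)
  have hq3 : q ≤ δ / 2 := (min_le_right _ _).trans (min_le_right _ _)
  have hBq : B * (q / B) = q := by field_simp
  refine ⟨q / B, by positivity, fun w hw x hx => ?_⟩
  obtain ⟨w', h1, h2, h3, h4⟩ := hglue w hw σ x (q / B) (by positivity) hx
  refine ⟨w', h1, h2, h3, jetEnergy_Ioi_le hk hσ h3 fun t ht => ?_⟩
  have e0 := h4 0 (Nat.zero_le _) t ht
  have ek := h4 k le_rfl t ht
  rw [hBq] at e0 ek
  rw [constJet_of_ne (by omega), sub_zero] at ek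
  rw [constJet_zero] at e0
  have hWt := hrW (show dist (w' 0 t) σ < r by rw [Real.dist_eq]; linarith)
  rw [Real.dist_eq, hσ, sub_zero] at hWt
  have h5 : w' k t ^ 2 ≤ q := by
    rw [← sq_abs]
    calc |w' k t| ^ 2 ≤ q ^ 2 := by gcongr
      _ ≤ q := by nlinarith
  linarith [le_abs_self (W (w' 0 t))]

theorem isJetNear_reflect {k : ℕ} {w : ℕ → ℝ → ℝ} {σ ρ x : ℝ} (h : IsJetNear k w σ ρ x) :
    IsJetNear k (affineJet (-1) 0 w) σ ρ (-x) := by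
  intro l hl
  have h1 := h l hl
  rcases eq_or_ne l 0 with rfl | hl0
  · simpa [affineJet] using h1
  · simpa [affineJet, hl0, abs_mul] using h1

/-- A transition between points where the jet is close to the two wells can be completed, at small
cost, to a profile that equals the wells outside a bounded interval. -/
theorem exists_profile_of_near {W : ℝ → ℝ} (hW : Continuous W) (hWneg : W (-1) = 0)
    (hWpos : W 1 = 0) {k : ℕ} (hk : 1 ≤ k) {δ : ℝ} (hδ : 0 < δ) : ∃ ρ : ℝ, 0 < ρ ∧
      ∀ w, IsSobolevJet k w → ∀ x y, x ≤ y → IsJetNear k w (-1) ρ x → IsJetNear k w 1 ρ y →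
        ∃ p, IsSobolevJet k p ∧ (∀ l, ∀ t ≤ x - 1, p l t = constJet (-1) l t) ∧
          (∀ l, ∀ t, y + 1 ≤ t → p l t = constJet 1 l t) ∧
          jetEnergy W k p univ ≤ jetEnergy W k w (Ioo x y) + ENNReal.ofReal δ := by
  obtain ⟨ρ₁, hρ₁, hg₁⟩ := exists_glue hW hWpos hk (half_pos hδ)
  obtain ⟨ρ₂, hρ₂, hg₂⟩ := exists_glue hW hWneg hk (half_pos hδ)
  refine ⟨min ρ₁ ρ₂, by positivity, fun w hw x y hxy hx hy => ?_⟩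
  obtain ⟨w₁, j₁, l₁, r₁, E₁⟩ := hg₁ w hw y fun l hl => (hy l hl).trans (min_le_left _ _)
  have hx₁ : IsJetNear k w₁ (-1) ρ₂ x := fun l hl => by
    rw [l₁ l x hxy]; exact (hx l hl).trans (min_le_right _ _)
  obtain ⟨w₂, j₂, l₂, r₂, E₂⟩ := hg₂ _ (j₁.affine (c := -1) (by norm_num) 0) (-x)
    (isJetNear_reflect hx₁)
  have hpow : ∀ l : ℕ, ((-1 : ℝ) ^ l) * (-1) ^ l = 1 := fun l => by
    rw [← mul_pow]; norm_num
  refine ⟨affineJet (-1) 0 w₂, j₂.affine (by norm_num) 0, fun l t ht => ?_, fun l t ht => ?_, ?_⟩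
  · simp only [affineJet]
    rw [r₂ l _ (by linarith)]
    rcases eq_or_ne l 0 with rfl | hl0
    · simp
    · simp [hl0]
  · simp only [affineJet]
    rw [l₂ l _ (by linarith), affineJet, ← mul_assoc, hpow, one_mul, ← r₁ l t ht]
    congr 1; ring
  · have e1 : jetEnergy W k (affineJet (-1) 0 w₂) univ = jetEnergy W k w₂ univ := by
      have := jetEnergy_reflect (W := W) (k := k) (w := w₂) MeasurableSet.univ
      rwa [preimage_univ] at this
    have e2 : jetEnergy W k (affineJet (-1) 0 w₁) (Iic (-x)) = jetEnergy W k w₁ (Ici x) := by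
      rw [← jetEnergy_reflect measurableSet_Ici]
      congr 1
      ext t; simp
    have e3 : Ici x = Icc x y ∪ Ioi y := (Icc_union_Ioi_eq_Ici hxy).symm
    have e4 : jetEnergy W k w (Icc x y) = jetEnergy W k w (Ioo x y) :=
      (setLIntegral_congr Ioo_ae_eq_Icc).symm
    rw [e1, ← Iic_union_Ioi (a := -x)]
    calc _ ≤ jetEnergy W k w₂ (Iic (-x)) + jetEnergy W k w₂ (Ioi (-x)) := jetEnergy_union_le _ _
      _ ≤ jetEnergy W k w₁ (Ici x) + ENNReal.ofReal (δ / 2) := by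
          refine add_le_add (le_of_eq ?_) E₂
          rw [← e2]
          exact jetEnergy_congr measurableSet_Iic fun l t ht => l₂ l t ht
      _ ≤ jetEnergy W k w (Ioo x y) + ENNReal.ofReal (δ / 2) + ENNReal.ofReal (δ / 2) := by
          refine add_le_add ?_ le_rfl
          rw [e3]
          refine (jetEnergy_union_le _ _).trans (add_le_add (le_of_eq ?_) E₁)
          rw [← e4]
          exact jetEnergy_congr measurableSet_Icc fun l t ht => l₁ l t ht.2
      _ = _ := by
          rw [add_assoc, ← ENNReal.ofReal_add (by positivity) (by positivity), add_halves]

theorem profileConst_le_of_profile {W : ℝ → ℝ} {k : ℕ} (hk : 1 ≤ k) {p : ℕ → ℝ → ℝ}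
    (hp : IsSobolevJet k p) {x y : ℝ} (h1 : ∀ l, ∀ t ≤ x, p l t = constJet (-1) l t)
    (h2 : ∀ l, ∀ t, y ≤ t → p l t = constJet 1 l t) :
    profileConst k W ≤ jetEnergy W k p univ := by
  refine profileConst_le_jetEnergy hk hp ?_ ?_
  · refine tendsto_const_nhds.congr' ?_
    filter_upwards [eventually_ge_atTop y] with t ht
    simp [h2 0 t ht]
  · refine tendsto_const_nhds.congr' ?_
    filter_upwards [eventually_le_atBot x] with t ht
    simp [h1 0 t ht]

/-- Up to `δ`, `m_k` bounds the energy of every transition between the wells, in either direction. -/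
theorem exists_profileConst_le {W : ℝ → ℝ} (hW : Continuous W) (hWneg : W (-1) = 0)
    (hWpos : W 1 = 0) {k : ℕ} (hk : 1 ≤ k) {δ : ℝ} (hδ : 0 < δ) : ∃ ρ : ℝ, 0 < ρ ∧
      ∀ w, IsSobolevJet k w → ∀ σ x y, (σ = 1 ∨ σ = -1) → x ≤ y → IsJetNear k w (-σ) ρ x →
        IsJetNear k w σ ρ y →
          profileConst k W ≤ jetEnergy W k w (Ioo x y) + ENNReal.ofReal δ := by
  obtain ⟨ρ, hρ, h⟩ := exists_profile_of_near hW hWneg hWpos hk hδ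
  refine ⟨ρ, hρ, fun w hw σ x y hσ hxy hx hy => ?_⟩
  rcases hσ with rfl | rfl
  · obtain ⟨p, h1, h2, h3, h4⟩ := h w hw x y hxy hx hy
    exact (profileConst_le_of_profile hk h1 h2 h3).trans h4
  · rw [neg_neg] at hx
    obtain ⟨p, h1, h2, h3, h4⟩ := h _ (hw.affine (c := -1) (by norm_num) 0) (-y) (-x) (by linarith)
      (isJetNear_reflect hy) (isJetNear_reflect hx)
    refine (profileConst_le_of_profile hk h1 h2 h3).trans (h4.trans_eq ?_)
    rw [← jetEnergy_reflect (measurableSet_Ioo (a := x) (b := y))]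
    congr 2
    ext t
    simp only [mem_Ioo, mem_preimage]
    constructor <;> rintro ⟨h1, h2⟩ <;> constructor <;> linarith

/-- A glued transition from `-1` to `1` has finite energy. -/
theorem profileConst_lt_top {W : ℝ → ℝ} (hW : Continuous W) (hWneg : W (-1) = 0)
    (hWpos : W 1 = 0) {k : ℕ} (hk : 1 ≤ k) : profileConst k W < ⊤ := by
  obtain ⟨B, hB, hglue⟩ := exists_glue_const k
  obtain ⟨p, h1, h2, h3, h4⟩ := hglue _ (isSobolevJet_constJet k (-1)) 1 0 2 (by norm_num)
    fun l _ => by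
      rcases eq_or_ne l 0 with rfl | hl0
      · norm_num
      · simp [hl0]
  obtain ⟨M, hM⟩ := (isCompact_Icc (a := 1 - B * 2) (b := 1 + B * 2)).exists_bound_of_continuousOn
    hW.continuousOn
  refine (profileConst_le_of_profile hk h1 (x := 0) h2 h3).trans_lt ?_
  rw [← Iic_union_Ioi (a := (0 : ℝ))]
  refine (jetEnergy_union_le _ _).trans_lt (ENNReal.add_lt_top.2 ⟨?_, ?_⟩)
  · rw [jetEnergy_congr measurableSet_Iic fun l t ht => h2 l t ht, jetEnergy_constJet hk hWneg]
    simp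
  · refine (jetEnergy_Ioi_le (δ := M + (B * 2) ^ 2) hk hWpos h3 fun t ht => ?_).trans_lt
      ENNReal.ofReal_lt_top
    have e0 := h4 0 (Nat.zero_le _) t ht
    have ek := h4 k le_rfl t ht
    rw [constJet_of_ne (by omega), sub_zero] at ek
    rw [constJet_zero, abs_le] at e0
    have := hM (p 0 t) ⟨by linarith [e0.1], by linarith [e0.2]⟩
    rw [Real.norm_eq_abs] at this
    have h5 : p k t ^ 2 ≤ (B * 2) ^ 2 := by
      rw [← sq_abs]; gcongr
    linarith [le_abs_self (W (p 0 t))]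

/-- Pigeonhole principle for the measures of `K` adjacent cells. -/
theorem exists_cell_measure_lt (ν : Measure ℝ) {K : ℕ} {x L : ℝ} (hL : 0 < L) {c : ℝ≥0∞}
    (h : ν (Ioo x (x + K * L)) < K * c) :
    ∃ i : ℕ, i < K ∧ ν (Ioo (x + i * L) (x + i * L + L)) < c := by
  by_contra! hc
  refine absurd h (not_lt.2 ?_)
  have hd : Set.PairwiseDisjoint (↑(Finset.range K) : Set ℕ)
      (fun i : ℕ => Ioo (x + i * L) (x + i * L + L)) := by
    have key : ∀ i j : ℕ, i < j →
        Disjoint (Ioo (x + i * L) (x + i * L + L)) (Ioo (x + j * L) (x + j * L + L)) := by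
      intro i j hij
      have : ((i : ℝ) + 1) * L ≤ j * L := by
        gcongr; exact_mod_cast hij
      rw [Set.disjoint_left]
      rintro t ⟨_, h1⟩ ⟨h2, _⟩
      linarith
    intro i _ j _ hij
    rcases lt_or_gt_of_ne hij with h | h
    · exact key i j h
    · exact (key j i h).symm
  have h1 : ∑ i ∈ Finset.range K, ν (Ioo (x + i * L) (x + i * L + L)) ≤ ν (Ioo x (x + K * L)) := by
    rw [← measure_biUnion_finset hd fun _ _ => measurableSet_Ioo]
    refine measure_mono (iUnion₂_subset fun i hi => Ioo_subset_Ioo ?_ ?_)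
    · have : 0 ≤ (i : ℝ) * L := by positivity
      linarith
    · have h2 : ((i : ℝ) + 1) * L ≤ K * L := by
        gcongr
        exact_mod_cast Finset.mem_range.1 hi
      linarith
  refine le_trans ?_ h1
  calc (K : ℝ≥0∞) * c = ∑ i ∈ Finset.range K, c := by simp
    _ ≤ _ := Finset.sum_le_sum fun i hi => hc i (Finset.mem_range.1 hi)

theorem exists_jetEnergy_cell_lt {W : ℝ → ℝ} {k : ℕ} {w : ℕ → ℝ → ℝ}
    (hE : jetEnergy W k w univ < ⊤) {η : ℝ} (hη : 0 < η) :
    ∃ K : ℕ, ∀ x, ∃ i : ℕ, i < K ∧ jetEnergy W k w (Ioo (x + i) (x + i + 1)) < ENNReal.ofReal η := by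
  have hη' : ENNReal.ofReal η ≠ 0 := by simpa using hη
  obtain ⟨K, hK⟩ := ENNReal.exists_nat_gt (r := jetEnergy W k w univ / ENNReal.ofReal η)
    (ENNReal.div_lt_top hE.ne hη').ne
  rw [ENNReal.div_lt_iff (Or.inl hη') (Or.inl ENNReal.ofReal_ne_top)] at hK
  refine ⟨K, fun x => ?_⟩
  have h := exists_cell_measure_lt (volume.withDensity fun t => ENNReal.ofReal (W (w 0 t) + w k t ^ 2))
    (K := K) (x := x) (L := 1) one_pos (c := ENNReal.ofReal η) (by
      rw [withDensity_apply _ measurableSet_Ioo]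
      exact (jetEnergy_mono (subset_univ _)).trans_lt hK)
  simpa only [jetEnergy, withDensity_apply _ measurableSet_Ioo, mul_one] using h

/-- Profiles which are equal to `±1` outside a bounded interval have energy as close to `m_k` as
desired. A nearly optimal profile has cells of small energy arbitrarily far out on either side,
where it can be cut off. -/
theorem exists_profile {W : ℝ → ℝ} (hW : Continuous W) (hW0 : ∀ z, 0 ≤ W z) (hWneg : W (-1) = 0)
    (hWpos : W 1 = 0) {α β : ℝ} (hα : 0 < α) (hβ : 0 < β)
    (hWαβ : ∀ z, α * min (min ((z + 1) ^ 2) ((z - 1) ^ 2)) β ≤ W z) {k : ℕ} (hk : 1 ≤ k)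
    {M : ℝ≥0∞} (hM : profileConst k W < M) :
    ∃ (p : ℕ → ℝ → ℝ) (T : ℝ), 0 < T ∧ IsSobolevJet k p ∧
      (∀ l, ∀ t ≤ -T, p l t = constJet (-1) l t) ∧ (∀ l, ∀ t, T ≤ t → p l t = constJet 1 l t) ∧
      jetEnergy W k p univ ≤ M := by
  obtain ⟨w, hw, h1, h2, hE⟩ := exists_jetEnergy_lt hk hM
  obtain ⟨δ, hδ, hδM⟩ : ∃ δ : ℝ, 0 < δ ∧ jetEnergy W k w univ + ENNReal.ofReal δ ≤ M := by
    obtain ⟨r, hr, hr'⟩ := ENNReal.lt_iff_exists_add_pos_lt.1 hE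
    exact ⟨r, by exact_mod_cast hr, by simpa using hr'.le⟩
  obtain ⟨ρ, hρ, hprof⟩ := exists_profile_of_near hW hWneg hWpos hk hδ
  obtain ⟨η, hη, hthr⟩ := exists_energy_threshold hW0 hα hβ hWαβ hk
    (lt_min hρ (show (0 : ℝ) < 1 / 2 by norm_num))
  obtain ⟨K, hK⟩ := exists_jetEnergy_cell_lt (hE.trans_le le_top) hη
  obtain ⟨R, hR⟩ := eventually_atTop.1 (h1.eventually (Metric.ball_mem_nhds 1 (by norm_num : (0 : ℝ) < 1 / 2)))
  obtain ⟨L, hL⟩ := eventually_atBot.1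
    (h2.eventually (Metric.ball_mem_nhds (-1) (by norm_num : (0 : ℝ) < 1 / 2)))
  simp only [Real.dist_eq, abs_lt] at hR hL
  obtain ⟨i, -, hi⟩ := hK (max R 0)
  obtain ⟨σ, hσ, hnear⟩ := hthr w hw _ hi
  obtain ⟨j, hj, hj'⟩ := hK (min L 0 - K - 1)
  obtain ⟨σ', hσ', hnear'⟩ := hthr w hw _ hj'
  have hjK : (j : ℝ) ≤ K := by exact_mod_cast hj.le
  have hi0 : (0 : ℝ) ≤ i := by positivity
  set y := max R 0 + i with hy
  set x := min L 0 - K - 1 + j with hx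
  have hyR : R ≤ y := (le_max_left R 0).trans (by linarith)
  have hy0 : 0 ≤ y := (le_max_right R 0).trans (by linarith)
  have hxL : x ≤ L := by linarith [min_le_left L 0]
  have hx0 : x ≤ 0 := by linarith [min_le_right L 0]
  have hny := hnear y ⟨le_rfl, by linarith⟩
  have hnx := hnear' x ⟨le_rfl, by linarith⟩
  have hσ1 : σ = 1 := by
    refine hσ.resolve_right fun h => ?_
    have := (hny 0 hk).trans (min_le_right _ _)
    rw [constJet_zero, h, abs_le] at this
    linarith [this.2, (hR y hyR).1]
  have hσ1' : σ' = -1 := by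
    refine hσ'.resolve_left fun h => ?_
    have := (hnx 0 hk).trans (min_le_right _ _)
    rw [constJet_zero, h, abs_le] at this
    linarith [this.1, (hL x hxL).2]
  obtain ⟨p, p1, p2, p3, p4⟩ := hprof w hw x y (by linarith)
    (fun l hl => hσ1' ▸ (hnx l hl).trans (min_le_left _ _))
    (fun l hl => hσ1 ▸ (hny l hl).trans (min_le_left _ _))
  refine ⟨p, y - x + 1, by linarith, p1, fun l t ht => p2 l t (by linarith),
    fun l t ht => p3 l t (by linarith), ?_⟩
  exact p4.trans ((add_le_add (jetEnergy_mono (subset_univ _)) le_rfl).trans hδM)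

/-! ### Functions of bounded variation with values in `{-1, 1}` -/

/-- `u` is almost everywhere equal to a constant on a neighbourhood of `t`. -/
def IsAEConstNear (u : ℝ → ℝ) (t : ℝ) : Prop :=
  ∃ c : ℝ, ∃ r > 0, ∀ᵐ x, x ∈ Ioo (t - r) (t + r) → u x = c

theorem exists_mem_Ioo_of_ae {P : ℝ → Prop} (h : ∀ᵐ x, P x) {p q : ℝ} (hpq : p < q) :
    ∃ x ∈ Ioo p q, P x := by
  by_contra! hc
  have h1 : volume (Ioo p q) = 0 := measure_mono_null (fun x hx => hc x hx) h
  rw [Real.volume_Ioo, ENNReal.ofReal_eq_zero] at h1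
  linarith

theorem exists_Ioo_diff_finite (S : Finset ℝ) {U : Set ℝ} (hU : IsOpen U) {t : ℝ} (ht : t ∈ U) :
    ∃ r > 0, Ioo (t - r) (t + r) ⊆ U ∧ ∀ s ∈ S, s ∈ Ioo (t - r) (t + r) → s = t := by
  have h1 : (↑(S.erase t) : Set ℝ)ᶜ ∈ 𝓝 t :=
    (S.erase t).finite_toSet.isClosed.isOpen_compl.mem_nhds (by simp)
  obtain ⟨r, hr, hrs⟩ := Metric.mem_nhds_iff.1 (inter_mem h1 (hU.mem_nhds ht))
  rw [Real.ball_eq_Ioo] at hrs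
  refine ⟨r, hr, fun x hx => (hrs hx).2, fun s hs hst => ?_⟩
  by_contra hne
  exact (hrs hst).1 (by simp [hs, hne])

theorem ae_eq_const_of_isAEConstNear {u : ℝ → ℝ} {p q : ℝ}
    (h : ∀ t ∈ Ioo p q, IsAEConstNear u t) : ∃ c : ℝ, ∀ᵐ x, x ∈ Ioo p q → u x = c := by
  rcases (Ioo p q).eq_empty_or_nonempty with he | ⟨y, hy⟩
  · exact ⟨0, by simp [he]⟩
  have h' : ∀ t, ∃ c, ∃ r > 0, t ∈ Ioo p q → ∀ᵐ x, x ∈ Ioo (t - r) (t + r) → u x = c := by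
    intro t
    by_cases ht : t ∈ Ioo p q
    · obtain ⟨c, r, hr, hc⟩ := h t ht
      exact ⟨c, r, hr, fun _ => hc⟩
    · exact ⟨0, 1, one_pos, fun h => absurd h ht⟩
  choose c r hr hc using h'
  have key : ∀ t ∈ Ioo p q, ∀ t' ∈ Ioo p q, c t = c t' := fun t ht t' ht' => by
    refine isPreconnected_Ioo.induction₂ (fun t t' => c t = c t') (fun t ht => ?_)
      (fun _ _ _ _ _ _ h1 h2 => h1.trans h2) (fun _ _ _ _ h => h.symm) ht ht'
    filter_upwards [self_mem_nhdsWithin, mem_nhdsWithin_of_mem_nhds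
      (Ioo_mem_nhds (show t - r t < t by linarith [hr t]) (show t < t + r t by linarith [hr t]))]
      with t' ht' hlt
    obtain ⟨x, hx, hx1, hx2⟩ := exists_mem_Ioo_of_ae ((hc t ht).and (hc t' ht'))
      (show max (t - r t) (t' - r t') < min (t + r t) (t' + r t') by
        have := hr t
        have := hr t'
        exact max_lt (lt_min (by linarith) (by linarith [hlt.1, hlt.2]))
          (lt_min (by linarith [hlt.1, hlt.2]) (by linarith)))
    rw [max_lt_iff.1 hx.1 |> fun h => hx1 ⟨h.1, (lt_min_iff.1 hx.2).1⟩] at hx2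
    exact hx2 ⟨(max_lt_iff.1 hx.1).2, (lt_min_iff.1 hx.2).2⟩
  refine ⟨c y, ?_⟩
  have hnull : volume {x | x ∈ Ioo p q ∧ u x ≠ c y} = 0 := by
    refine measure_null_of_locally_null _ fun t ht => ?_
    refine ⟨Ioo (t - r t) (t + r t) ∩ {x | u x ≠ c y}, ?_, ?_⟩
    · refine inter_mem (mem_nhdsWithin_of_mem_nhds
        (Ioo_mem_nhds (by linarith [hr t]) (by linarith [hr t]))) ?_
      filter_upwards [self_mem_nhdsWithin] with x hx using hx.2
    · refine measure_mono_null ?_ (hc t ht.1)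
      rintro x ⟨hx, hx'⟩ h
      exact hx' ((h hx).trans (key t ht.1 y hy))
  refine measure_mono_null (fun x hx => ?_) hnull
  exact Classical.not_imp.1 hx

theorem exists_one_sided_constants {u : ℝ → ℝ} {a b : ℝ} {B : Finset ℝ}
    (h : ∀ t ∈ Ioo a b, t ∉ B → IsAEConstNear u t) {s : ℝ} (hs : s ∈ Ioo a b) :
    ∃ cl cr : ℝ, ∃ r > 0, (∀ᵐ x, x ∈ Ioo (s - r) s → u x = cl) ∧
      ∀ᵐ x, x ∈ Ioo s (s + r) → u x = cr := by
  obtain ⟨r, hr, hrU, hrB⟩ := exists_Ioo_diff_finite B isOpen_Ioo hs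
  have h1 : ∀ t ∈ Ioo (s - r) (s + r), t ≠ s → IsAEConstNear u t := fun t ht hts =>
    h t (hrU ht) fun htB => hts (hrB t htB ht)
  obtain ⟨cl, hcl⟩ := ae_eq_const_of_isAEConstNear (u := u) (p := s - r) (q := s)
    fun t ht => h1 t ⟨ht.1, by linarith [ht.2]⟩ ht.2.ne
  obtain ⟨cr, hcr⟩ := ae_eq_const_of_isAEConstNear (u := u) (p := s) (q := s + r)
    fun t ht => h1 t ⟨by linarith [ht.1], ht.2⟩ ht.1.ne'
  exact ⟨cl, cr, r, hr, hcl, hcr⟩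

/-- A function that is locally constant outside a finite set is a step function. The second claim
identifies the value of the step function just to the left of each point of that set. -/
theorem exists_step_representation {u : ℝ → ℝ} {a b : ℝ} {B : Finset ℝ}
    (hB : ∀ s ∈ B, s ∈ Ioo a b) (h : ∀ t ∈ Ioo a b, t ∉ B → IsAEConstNear u t) {cl cr : ℝ → ℝ}
    (hlr : ∀ s ∈ B, ∃ r > 0, (∀ᵐ x, x ∈ Ioo (s - r) s → u x = cl s) ∧
      ∀ᵐ x, x ∈ Ioo s (s + r) → u x = cr s) :
    ∃ c₀ : ℝ, (∀ᵐ x, x ∈ Ioo a b → u x = c₀ + ∑ s ∈ B, if s < x then cr s - cl s else 0) ∧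
      ∀ s ∈ B, c₀ + (∑ s' ∈ B, if s' < s then cr s' - cl s' else 0) = cl s := by
  set H : ℝ → ℝ := fun x => ∑ s ∈ B, if s < x then cr s - cl s else 0 with hH
  have hleft : ∀ t r, (∀ s ∈ B, s ∈ Ioo (t - r) (t + r) → s = t) →
      ∀ x ∈ Ioo (t - r) t, H x = H t := by
    intro t r hr x hx
    refine Finset.sum_congr rfl fun s hs => if_congr ⟨fun h => h.trans hx.2, fun h => ?_⟩ rfl rfl
    by_contra hsx
    have := hr s hs ⟨by linarith [hx.1], by linarith [hx.1, hx.2]⟩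
    exact h.ne this
  have hright : ∀ t r, (∀ s ∈ B, s ∈ Ioo (t - r) (t + r) → s = t) →
      ∀ x ∈ Ioo t (t + r), H x = H t + if t ∈ B then cr t - cl t else 0 := by
    intro t r hr x hx
    have e : (if t ∈ B then cr t - cl t else 0) =
        ∑ s ∈ B, if s = t then cr s - cl s else 0 := by rw [Finset.sum_ite_eq']
    rw [e]
    simp only [hH, ← Finset.sum_add_distrib]
    refine Finset.sum_congr rfl fun s hs => ?_
    rcases lt_trichotomy s t with hst | rfl | hst
    · simp [hst, hst.trans hx.1, hst.ne]
    · simp [hx.1]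
    · have : ¬ s < x := fun hsx =>
        hst.ne' (hr s hs ⟨by linarith [hx.1, hx.2], by linarith [hx.2]⟩)
      simp [this, hst.not_gt, hst.ne']
  have hloc : ∀ t ∈ Ioo a b, IsAEConstNear (fun x => u x - H x) t := by
    intro t ht
    obtain ⟨r, hr, -, hrB⟩ := exists_Ioo_diff_finite B isOpen_Ioo ht
    by_cases htB : t ∈ B
    · obtain ⟨r', hr', hl, hr''⟩ := hlr t htB
      have hm : 0 < min r r' := lt_min hr hr'
      refine ⟨cl t - H t, min r r', hm, ?_⟩
      have hne : ∀ᵐ x : ℝ, x ≠ t := by simp [ae_iff]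
      filter_upwards [hl, hr'', hne] with x h1 h2 h3 hx
      have hx1 : t - r < x := by linarith [hx.1, min_le_left r r']
      have hx2 : x < t + r := by linarith [hx.2, min_le_left r r']
      have hx3 : t - r' < x := by linarith [hx.1, min_le_right r r']
      have hx4 : x < t + r' := by linarith [hx.2, min_le_right r r']
      rcases lt_or_gt_of_ne h3 with hlt | hlt
      · rw [h1 ⟨hx3, hlt⟩, hleft t r hrB x ⟨hx1, hlt⟩]
      · rw [h2 ⟨hlt, hx4⟩, hright t r hrB x ⟨hlt, hx2⟩, if_pos htB]
        ring
    · obtain ⟨c, r', hr', hc⟩ := h t ht htB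
      have hm : 0 < min r r' := lt_min hr hr'
      refine ⟨c - H t, min r r', hm, ?_⟩
      filter_upwards [hc] with x h1 hx
      have hx1 : t - r < x := by linarith [hx.1, min_le_left r r']
      have hx2 : x < t + r := by linarith [hx.2, min_le_left r r']
      have hx3 : t - r' < x := by linarith [hx.1, min_le_right r r']
      have hx4 : x < t + r' := by linarith [hx.2, min_le_right r r']
      rw [h1 ⟨hx3, hx4⟩]
      rcases lt_trichotomy x t with hlt | rfl | hlt
      · rw [hleft t r hrB x ⟨hx1, hlt⟩]
      · rfl
      · rw [hright t r hrB x ⟨hlt, hx2⟩, if_neg htB, add_zero]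
  obtain ⟨c₀, hc₀⟩ := ae_eq_const_of_isAEConstNear hloc
  refine ⟨c₀, ?_, fun s hs => ?_⟩
  · filter_upwards [hc₀] with x hx hxab
    linarith [hx hxab]
  · obtain ⟨r, hr, hrU, hrB⟩ := exists_Ioo_diff_finite B isOpen_Ioo (hB s hs)
    obtain ⟨r', hr', hl, -⟩ := hlr s hs
    have hm : 0 < min r r' := lt_min hr hr'
    obtain ⟨x, hx, hx1, hx2⟩ := exists_mem_Ioo_of_ae (hc₀.and hl)
      (show s - min r r' < s by linarith)
    have hx3 : s - r < x := by linarith [hx.1, min_le_left r r']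
    have hx4 : s - r' < x := by linarith [hx.1, min_le_right r r']
    have h1 := hx1 (hrU ⟨hx3, by linarith [hx.2]⟩)
    rw [hx2 ⟨hx4, hx.2⟩, hleft s r hrB x ⟨hx3, hx.2⟩] at h1
    show c₀ + H s = cl s
    linarith

theorem exists_separation {S : Finset ℝ} {a b : ℝ} (hS : ∀ s ∈ S, s ∈ Ioo a b) :
    ∃ r > 0, ∀ s ∈ S, a < s - r ∧ s + r < b ∧ ∀ s' ∈ S, s ≠ s' → 2 * r < |s - s'| := by
  have hsmall : ∀ x : ℝ, 0 < x → ∀ᶠ r in 𝓝[>] (0 : ℝ), 2 * r < x := fun x hx => by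
    filter_upwards [Ioo_mem_nhdsGT (show (0 : ℝ) < x / 2 by linarith)] with r hr
    linarith [hr.2]
  have h : ∀ᶠ r in 𝓝[>] (0 : ℝ), ∀ s ∈ S, a < s - r ∧ s + r < b ∧
      ∀ s' ∈ S, s ≠ s' → 2 * r < |s - s'| := by
    rw [Filter.eventually_all_finset]
    intro s hs
    have h3 : ∀ᶠ r in 𝓝[>] (0 : ℝ), ∀ s' ∈ S, s ≠ s' → 2 * r < |s - s'| := by
      rw [Filter.eventually_all_finset]
      intro s' _
      by_cases hne : s = s'
      · simp [hne]
      · filter_upwards [hsmall _ (abs_pos.2 (sub_ne_zero.2 hne))] with r hr _ using hr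
    filter_upwards [hsmall _ (sub_pos.2 (hS s hs).1), hsmall _ (sub_pos.2 (hS s hs).2), h3,
      self_mem_nhdsWithin] with r h1 h2 h3 h4
    have h4' : 0 < r := h4
    exact ⟨by linarith, by linarith, h3⟩
  obtain ⟨r, h1, h2⟩ := (h.and self_mem_nhdsWithin).exists
  exact ⟨r, h2, h1⟩

/-- A function with values `±1` that is not locally constant has total variation at least one. It takes
the values `1` and `-1` at approximate continuity points `x` and `y`; the test function is the
primitive of the difference of mollifiers at `x` and at `y`. -/
theorem exists_isTestFun_one_le {u : ℝ → ℝ} {p q : ℝ} (hu : IntegrableOn u (Ioo p q))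
    (hu1 : ∀ᵐ x, x ∈ Ioo p q → u x = -1 ∨ u x = 1) {t : ℝ} (ht : t ∈ Ioo p q)
    (hnc : ¬ IsAEConstNear u t) :
    ∃ φ, IsTestFun (Ioo p q) φ ∧ (∀ x, |φ x| ≤ 1) ∧ 1 ≤ ∫ x, u x * deriv φ x := by
  set g : ℝ → ℝ := (Ioo p q).indicator u with hg
  have hgi : Integrable g := (integrable_indicator_iff measurableSet_Ioo).2 hu
  let χ : ℕ → ContDiffBump (0 : ℝ) := fun n =>
    ⟨1 / (2 * ((n : ℝ) + 1)), 1 / ((n : ℝ) + 1), by positivity, by gcongr; linarith⟩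
  have hχ : Tendsto (fun n => (χ n).rOut) atTop (𝓝 0) := tendsto_one_div_add_atTop_nhds_zero_nat
  have hconv := ContDiffBump.ae_convolution_tendsto_right_of_locallyIntegrable (μ := volume)
    (φ := χ) (K := 2) hχ (Eventually.of_forall fun n => by
      show 1 / ((n : ℝ) + 1) ≤ 2 * (1 / (2 * ((n : ℝ) + 1)))
      apply le_of_eq; field_simp) hgi.locallyIntegrable
  obtain ⟨r, hr, hrU, -⟩ := exists_Ioo_diff_finite ∅ isOpen_Ioo ht
  have hex : ∀ σ : ℝ, ∃ x ∈ Ioo p q, u x ≠ σ ∧ (u x = -1 ∨ u x = 1) ∧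
      Tendsto (fun i => convolution ((χ i).normed volume) g (ContinuousLinearMap.lsmul ℝ ℝ) volume x) atTop
        (𝓝 (g x)) := by
    intro σ
    by_contra! hc
    refine hnc ⟨σ, r, hr, ?_⟩
    filter_upwards [hconv, hu1] with x h1 h2 h3
    by_contra hne
    exact hc x (hrU h3) hne (h2 (hrU h3)) h1
  obtain ⟨x, hx, hx1, hx2, hx3⟩ := hex (-1)
  obtain ⟨y, hy, hy1, hy2, hy3⟩ := hex 1
  have hgx : g x = 1 := by rw [hg, indicator_of_mem hx]; exact hx2.resolve_left hx1
  have hgy : g y = -1 := by rw [hg, indicator_of_mem hy]; exact hy2.resolve_right hy1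
  rw [hgx] at hx3
  rw [hgy] at hy3
  have hlim := hx3.sub hy3
  have hm : 0 < min (min (x - p) (q - x)) (min (y - p) (q - y)) :=
    lt_min (lt_min (by linarith [hx.1]) (by linarith [hx.2]))
      (lt_min (by linarith [hy.1]) (by linarith [hy.2]))
  obtain ⟨n, hn1, hn2⟩ := ((hlim.eventually_const_lt (show (1 : ℝ) < 1 - -1 by norm_num)).and
    (hχ.eventually_lt_const hm)).exists
  rw [lt_min_iff, lt_min_iff, lt_min_iff] at hn2
  obtain ⟨⟨hn3, hn4⟩, hn5, hn6⟩ := hn2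
  set f := (χ n).normed volume with hf
  have hfi : Integrable f := (χ n).integrable_normed
  have hfx : ∀ z, (χ n).rOut < z - p → (χ n).rOut < q - z → IsTestFun (Ioo p q) fun s => f (z - s) := by
    intro z hz1 hz2
    have hs : tsupport (fun s => f (z - s)) ⊆ Icc (z - (χ n).rOut) (z + (χ n).rOut) := by
      refine closure_minimal (fun s hs => ?_) isClosed_Icc
      have : z - s ∈ Function.support f := hs
      rw [hf, (χ n).support_normed_eq, Real.ball_eq_Ioo] at this
      exact ⟨by linarith [this.2], by linarith [this.1]⟩
    exact ⟨(χ n).contDiff_normed.comp (contDiff_const.sub contDiff_id),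
      isCompact_Icc.of_isClosed_subset (isClosed_tsupport _) hs,
      hs.trans (Icc_subset_Ioo (by linarith) (by linarith))⟩
  have hint : ∀ z, ∫ s, f (z - s) = 1 := fun z => by
    rw [integral_sub_left_eq_self f volume z, hf, (χ n).integral_normed]
  have hψ := (hfx x hn3 hn4).sub (hfx y hn5 hn6)
  have hix : ∀ z, Integrable fun s => f (z - s) := fun z => hfi.comp_sub_left z
  obtain ⟨hΦ, hΦ'⟩ := exists_isTestFun_deriv_eq ordConnected_Ioo hψ (by
    rw [integral_sub (hix x) (hix y), hint, hint, sub_self])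
  refine ⟨_, hΦ, fun t => ?_, ?_⟩
  · rw [integral_sub (hix x).integrableOn (hix y).integrableOn]
    have hb : ∀ z, 0 ≤ ∫ s in Iic t, f (z - s) ∧ ∫ s in Iic t, f (z - s) ≤ 1 := fun z =>
      ⟨integral_nonneg fun s => (χ n).nonneg_normed _,
        (setIntegral_le_integral (hix z)
          (Eventually.of_forall fun s => (χ n).nonneg_normed _)).trans_eq (hint z)⟩
    rw [abs_le]
    constructor <;> linarith [hb x, hb y]
  · simp only [hΦ']
    have hL : LocallyIntegrableOn u (Ioo p q) volume := hu.locallyIntegrableOn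
    have e : ∀ z, (χ n).rOut < z - p → (χ n).rOut < q - z →
        convolution f g (ContinuousLinearMap.lsmul ℝ ℝ) volume z = ∫ s, u s * f (z - s) := by
      intro z hz1 hz2
      rw [convolution_eq_swap, ← (hfx z hz1 hz2).setIntegral_mul u,
        ← integral_indicator measurableSet_Ioo]
      refine integral_congr_ae (Eventually.of_forall fun s => ?_)
      simp only [ContinuousLinearMap.lsmul_apply, smul_eq_mul, hg, indicator]
      split_ifs <;> ring
    rw [e x hn3 hn4, e y hn5 hn6, ← integral_sub ((hfx x hn3 hn4).integrable_mul hL)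
      ((hfx y hn5 hn6).integrable_mul hL)] at hn1
    refine hn1.le.trans_eq ?_
    congr 1
    ext s
    ring

/-- Disjoint neighbourhoods of the points where `u` is not locally constant each contribute at least
one to the total variation, so there are finitely many. -/
theorem MemBVPhase.finite_not_isAEConstNear {a b : ℝ} {u : ℝ → ℝ} (h : MemBVPhase (Ioo a b) u) :
    {t | t ∈ Ioo a b ∧ ¬ IsAEConstNear u t}.Finite := by
  obtain ⟨⟨hi, C, hC⟩, h1⟩ := h
  rw [ae_restrict_iff' measurableSet_Ioo] at h1
  by_contra hinf
  obtain ⟨n, hn⟩ := exists_nat_gt C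
  obtain ⟨S, hS, hcard⟩ := (Set.Infinite.exists_subset_card_eq hinf n)
  have hSI : ∀ s ∈ S, s ∈ Ioo a b := fun s hs => (hS hs).1
  obtain ⟨r, hr, hsep⟩ := exists_separation hSI
  have hsub : ∀ s ∈ S, Ioo (s - r) (s + r) ⊆ Ioo a b := fun s hs =>
    Ioo_subset_Ioo (hsep s hs).1.le (hsep s hs).2.1.le
  have hex : ∀ s, ∃ φ, s ∈ S → IsTestFun (Ioo (s - r) (s + r)) φ ∧ (∀ x, |φ x| ≤ 1) ∧
      1 ≤ ∫ x, u x * deriv φ x := by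
    intro s
    by_cases hs : s ∈ S
    · obtain ⟨φ, hφ⟩ := exists_isTestFun_one_le (hi.mono_set (hsub s hs))
        (by filter_upwards [h1] with x hx hx' using hx (hsub s hs hx'))
        (show s ∈ Ioo (s - r) (s + r) from ⟨by linarith, by linarith⟩) (hS hs).2
      exact ⟨φ, fun _ => hφ⟩
    · exact ⟨0, fun h => absurd h hs⟩
  choose φ hφ using hex
  have hΦ : IsTestFun (Ioo a b) fun t => ∑ s ∈ S, φ s t :=
    IsTestFun.sum S fun s hs => (hφ s hs).1.mono (hsub s hs)
  have hle : ∀ t, |∑ s ∈ S, φ s t| ≤ 1 := by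
    intro t
    by_cases hex : ∃ s ∈ S, φ s t ≠ 0
    · obtain ⟨s, hs, hst⟩ := hex
      rw [Finset.sum_eq_single s]
      · exact (hφ s hs).2.1 t
      · intro s' hs' hne
        by_contra h0
        have h1 : s ∈ S → t ∈ Ioo (s - r) (s + r) := fun hs => by
          by_contra h; exact hst ((hφ s hs).1.eq_zero_of_notMem h)
        have h2 : t ∈ Ioo (s' - r) (s' + r) := by
          by_contra h; exact h0 ((hφ s' hs').1.eq_zero_of_notMem h)
        have h3 := (hsep s hs).2.2 s' hs' hne.symm
        have h4 : |s - s'| < 2 * r := by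
          rw [abs_lt]; constructor <;> linarith [(h1 hs).1, (h1 hs).2, h2.1, h2.2]
        linarith
      · exact fun h => absurd hs h
    · push Not at hex
      rw [Finset.sum_eq_zero hex]; simp
  have key := hC _ hΦ.1 hΦ.2 hΦ.3 hle
  rw [hΦ.deriv.setIntegral_mul] at key
  have hd : ∀ t, deriv (fun t => ∑ s ∈ S, φ s t) t = ∑ s ∈ S, deriv (φ s) t := fun t =>
    deriv_fun_sum fun s hs => ((contDiff_infty_iff_deriv.1 (hφ s hs).1.1).1 t)
  simp only [hd, Finset.mul_sum] at key
  rw [integral_finsetSum _ fun s hs => ((hφ s hs).1.mono (hsub s hs)).deriv.integrable_mul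
    hi.locallyIntegrableOn] at key
  have : (n : ℝ) ≤ ∑ s ∈ S, ∫ t, u t * deriv (φ s) t := by
    rw [← hcard, Finset.cast_card]
    exact Finset.sum_le_sum fun s hs => (hφ s hs).2.2
  linarith

theorem eventually_nhdsLT_inf_ae {P : ℝ → Prop} {t : ℝ} :
    (∀ᶠ x in 𝓝[<] t ⊓ ae volume, P x) ↔ ∃ r > 0, ∀ᵐ x, x ∈ Ioo (t - r) t → P x := by
  rw [Filter.Eventually, Filter.mem_inf_iff_superset]
  constructor
  · rintro ⟨s, hs, s', hs', hss⟩
    obtain ⟨l, hl, hls⟩ := (mem_nhdsLT_iff_exists_Ioo_subset).1 hs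
    refine ⟨t - l, sub_pos.2 hl, ?_⟩
    filter_upwards [hs'] with x hx hx'
    exact hss ⟨hls ⟨by linarith [hx'.1], hx'.2⟩, hx⟩
  · rintro ⟨r, hr, h⟩
    exact ⟨Ioo (t - r) t, Ioo_mem_nhdsLT (by linarith), _, h, fun x hx => hx.2 hx.1⟩

theorem eventually_nhdsGT_inf_ae {P : ℝ → Prop} {t : ℝ} :
    (∀ᶠ x in 𝓝[>] t ⊓ ae volume, P x) ↔ ∃ r > 0, ∀ᵐ x, x ∈ Ioo t (t + r) → P x := by
  rw [Filter.Eventually, Filter.mem_inf_iff_superset]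
  constructor
  · rintro ⟨s, hs, s', hs', hss⟩
    obtain ⟨l, hl, hls⟩ := (mem_nhdsGT_iff_exists_Ioo_subset).1 hs
    refine ⟨l - t, sub_pos.2 hl, ?_⟩
    filter_upwards [hs'] with x hx hx'
    exact hss ⟨hls ⟨hx'.1, by linarith [hx'.2]⟩, hx⟩
  · rintro ⟨r, hr, h⟩
    exact ⟨Ioo t (t + r), Ioo_mem_nhdsGT (by linarith), _, h, fun x hx => hx.2 hx.1⟩

theorem mem_jumpSet_of_one_sided {a b cl cr : ℝ} {u : ℝ → ℝ} {t : ℝ} (ht : t ∈ Ioo a b) {r : ℝ}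
    (hr : 0 < r) (hl : ∀ᵐ x, x ∈ Ioo (t - r) t → u x = cl)
    (hr' : ∀ᵐ x, x ∈ Ioo t (t + r) → u x = cr) (hne : cl ≠ cr) : t ∈ jumpSet a b u :=
  ⟨ht, cl, cr, hne,
    tendsto_const_nhds.congr' (EventuallyEq.symm (eventually_nhdsLT_inf_ae.2 ⟨r, hr, hl⟩)),
    tendsto_const_nhds.congr' (EventuallyEq.symm (eventually_nhdsGT_inf_ae.2 ⟨r, hr, hr'⟩))⟩

theorem not_isAEConstNear_of_mem_jumpSet {a b : ℝ} {u : ℝ → ℝ} {t : ℝ} (ht : t ∈ jumpSet a b u) :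
    ¬ IsAEConstNear u t := by
  rintro ⟨c, r, hr, hc⟩
  obtain ⟨-, cl, cr, hne, hl, hr'⟩ := ht
  have nb : ∀ {l : Filter ℝ}, (∀ s ∈ l, volume s ≠ 0) → (l ⊓ ae volume).NeBot := by
    intro l hl
    rw [Filter.inf_neBot_iff]
    intro s hs s' hs'
    by_contra hemp
    rw [not_nonempty_iff_eq_empty] at hemp
    refine hl s hs (measure_mono_null (show s ⊆ s'ᶜ from fun x hx hx' => ?_) hs')
    have : x ∈ s ∩ s' := ⟨hx, hx'⟩
    simp [hemp] at this
  have n1 : (𝓝[<] t ⊓ ae volume).NeBot := nb fun s hs h0 => by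
    obtain ⟨l, hl, hls⟩ := (mem_nhdsLT_iff_exists_Ioo_subset).1 hs
    have := measure_mono_null hls h0
    rw [Real.volume_Ioo, ENNReal.ofReal_eq_zero] at this
    have hl' : l < t := hl
    linarith
  have n2 : (𝓝[>] t ⊓ ae volume).NeBot := nb fun s hs h0 => by
    obtain ⟨l, hl, hls⟩ := (mem_nhdsGT_iff_exists_Ioo_subset).1 hs
    have := measure_mono_null hls h0
    rw [Real.volume_Ioo, ENNReal.ofReal_eq_zero] at this
    have hl' : t < l := hl
    linarith
  have e1 : cl = c := tendsto_nhds_unique hl (tendsto_const_nhds.congr' (EventuallyEq.symm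
    (eventually_nhdsLT_inf_ae.2 ⟨r, hr, by
      filter_upwards [hc] with x hx hx' using hx ⟨hx'.1, by linarith [hx'.2]⟩⟩)))
  have e2 : cr = c := tendsto_nhds_unique hr' (tendsto_const_nhds.congr' (EventuallyEq.symm
    (eventually_nhdsGT_inf_ae.2 ⟨r, hr, by
      filter_upwards [hc] with x hx hx' using hx ⟨by linarith [hx'.1], hx'.2⟩⟩)))
  exact hne (e1.trans e2.symm)

/-- Structure of `BV((a,b); {-1,1})`: the jump set is a finite set `S`, and `u` is a step function
which jumps from `-σ s` to `σ s` at each `s ∈ S`. -/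
theorem MemBVPhase.exists_jumps {a b : ℝ} {u : ℝ → ℝ} (h : MemBVPhase (Ioo a b) u) :
    ∃ (S : Finset ℝ) (σ : ℝ → ℝ) (c₀ : ℝ), (S : Set ℝ) = jumpSet a b u ∧
      (∀ s ∈ S, s ∈ Ioo a b) ∧ (∀ s ∈ S, σ s = 1 ∨ σ s = -1) ∧
      (∀ s ∈ S, ∃ r > 0, (∀ᵐ x, x ∈ Ioo (s - r) s → u x = -σ s) ∧
        ∀ᵐ x, x ∈ Ioo s (s + r) → u x = σ s) ∧
      (∀ᵐ x, x ∈ Ioo a b → u x = c₀ + ∑ s ∈ S, if s < x then 2 * σ s else 0) ∧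
      ∀ s ∈ S, c₀ + (∑ s' ∈ S, if s' < s then 2 * σ s' else 0) = -σ s := by
  have hfin := h.finite_not_isAEConstNear
  have h1 := h.2
  rw [ae_restrict_iff' measurableSet_Ioo] at h1
  set S := hfin.toFinset with hS
  have hSmem : ∀ s, s ∈ S ↔ s ∈ Ioo a b ∧ ¬ IsAEConstNear u s := fun s => by simp [hS]
  have hoff : ∀ t ∈ Ioo a b, t ∉ S → IsAEConstNear u t := fun t ht htS => by
    by_contra hc
    exact htS ((hSmem t).2 ⟨ht, hc⟩)
  have hex : ∀ s, ∃ σ : ℝ, s ∈ S → (σ = 1 ∨ σ = -1) ∧ ∃ r > 0,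
      (∀ᵐ x, x ∈ Ioo (s - r) s → u x = -σ) ∧ ∀ᵐ x, x ∈ Ioo s (s + r) → u x = σ := by
    intro s
    by_cases hs : s ∈ S
    · have hsab := ((hSmem s).1 hs).1
      obtain ⟨cl, cr, r, hr, hl, hr'⟩ := exists_one_sided_constants hoff hsab
      obtain ⟨r₀, hr₀, hrU, -⟩ := exists_Ioo_diff_finite ∅ isOpen_Ioo hsab
      have hm : 0 < min r r₀ := lt_min hr hr₀
      have m1 := min_le_left r r₀
      have m2 := min_le_right r r₀
      obtain ⟨x, hx, hx1, hx2⟩ := exists_mem_Ioo_of_ae (hl.and h1)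
        (show s - min r r₀ < s by linarith)
      obtain ⟨y, hy, hy1, hy2⟩ := exists_mem_Ioo_of_ae (hr'.and h1)
        (show s < s + min r r₀ by linarith)
      have hcl := hx2 (hrU ⟨by linarith [hx.1], by linarith [hx.2]⟩)
      have hcr := hy2 (hrU ⟨by linarith [hy.1], by linarith [hy.2]⟩)
      rw [hx1 ⟨by linarith [hx.1], hx.2⟩] at hcl
      rw [hy1 ⟨hy.1, by linarith [hy.2]⟩] at hcr
      have hne : cl ≠ cr := by
        rintro rfl
        refine ((hSmem s).1 hs).2 ⟨cl, r, hr, ?_⟩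
        have hne : ∀ᵐ x : ℝ, x ≠ s := by simp [ae_iff]
        filter_upwards [hl, hr', hne] with x g1 g2 g3 hx
        rcases lt_or_gt_of_ne g3 with hlt | hlt
        · exact g1 ⟨hx.1, hlt⟩
        · exact g2 ⟨hlt, hx.2⟩
      have hcl' : cl = -cr := by
        rcases hcl with rfl | rfl <;> rcases hcr with rfl | rfl <;> simp_all
      exact ⟨cr, fun _ => ⟨hcr.symm, r, hr, hcl' ▸ hl, hr'⟩⟩
    · exact ⟨0, fun h => absurd h hs⟩
  choose σ hσ using hex
  obtain ⟨c₀, hc₀, hc₀'⟩ := exists_step_representation (B := S) (cl := fun s => -σ s) (cr := σ)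
    (fun s hs => ((hSmem s).1 hs).1) hoff (fun s hs => (hσ s hs).2)
  have e : ∀ s, σ s - -σ s = 2 * σ s := fun s => by ring
  simp only [e] at hc₀ hc₀'
  refine ⟨S, σ, c₀, ?_, fun s hs => ((hSmem s).1 hs).1, fun s hs => (hσ s hs).1,
    fun s hs => (hσ s hs).2, hc₀, hc₀'⟩
  ext t
  rw [Finset.mem_coe]
  constructor
  · intro ht
    obtain ⟨h2, r, hr, hl, hr'⟩ := hσ t ht
    refine mem_jumpSet_of_one_sided ((hSmem t).1 ht).1 hr hl hr' ?_
    rcases h2 with h2 | h2 <;> rw [h2] <;> norm_num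
  · exact fun ht => (hSmem t).2 ⟨ht.1, not_isAEConstNear_of_mem_jumpSet ht⟩

theorem memBV_of_step {a b c₀ : ℝ} {u d : ℝ → ℝ} {B : Finset ℝ}
    (hu : ∀ᵐ x, x ∈ Ioo a b → u x = c₀ + ∑ s ∈ B, if s < x then d s else 0) :
    MemBV (Ioo a b) u := by
  have hu' : u =ᵐ[volume.restrict (Ioo a b)] fun x => c₀ + ∑ s ∈ B, (Ioi s).indicator (fun _ => d s) x := by
    rw [EventuallyEq, ae_restrict_iff' measurableSet_Ioo]
    filter_upwards [hu] with x hx hx'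
    rw [hx hx']
    simp [indicator]
  have hii : ∀ s ∈ B, IntegrableOn ((Ioi s).indicator fun _ => d s) (Ioo a b) volume := fun s _ =>
    Integrable.indicator (by simp) measurableSet_Ioi
  have hint : IntegrableOn u (Ioo a b) := by
    refine Integrable.congr ?_ hu'.symm
    exact (integrable_const _).add (integrable_finsetSum _ hii)
  refine ⟨hint, ∑ s ∈ B, |d s|, fun φ h1 h2 h3 h4 => ?_⟩
  have hφ : IsTestFun (Ioo a b) φ := ⟨h1, h2, h3⟩
  have hφi : Integrable (deriv φ) := hφ.deriv.1.continuous.integrable_of_hasCompactSupport hφ.deriv.2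
  have e1 : ∫ t in Ioo a b, u t * deriv φ t =
      ∫ t in Ioo a b, (c₀ + ∑ s ∈ B, (Ioi s).indicator (fun _ => d s) t) * deriv φ t := by
    refine integral_congr_ae ?_
    filter_upwards [hu'] with t ht
    rw [ht]
  rw [e1, hφ.deriv.setIntegral_mul (fun t => c₀ + ∑ s ∈ B, (Ioi s).indicator (fun _ => d s) t)]
  simp only [add_mul, Finset.sum_mul]
  have e2 : ∀ s t, (Ioi s).indicator (fun _ => d s) t * deriv φ t =
      d s * (Ioi s).indicator (deriv φ) t := fun s t => by
    simp only [indicator]; split_ifs <;> simp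
  simp only [e2]
  have hi2 : ∀ s, Integrable (fun t => d s * (Ioi s).indicator (deriv φ) t) := fun s =>
    (hφi.indicator measurableSet_Ioi).const_mul _
  rw [integral_add (hφi.const_mul _) (integrable_finsetSum _ fun s _ => hi2 s),
    integral_finsetSum _ fun s _ => hi2 s, integral_const_mul]
  have e3 : ∫ t, deriv φ t = 0 := by
    have := (isSobolevJet_constJet 1 1).integral_mul_deriv (l := 0) one_pos
      (hφ.mono (subset_univ _))
    simpa [constJet] using this
  rw [e3, mul_zero, zero_add]
  refine Finset.sum_le_sum fun s _ => ?_
  rw [integral_const_mul, integral_indicator measurableSet_Ioi,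
    HasCompactSupport.integral_Ioi_deriv_eq (h1.of_le (by exact_mod_cast le_top)) h2 s]
  refine (le_abs_self _).trans ?_
  rw [abs_mul, abs_neg]
  exact mul_le_of_le_one_right (abs_nonneg _) (h4 s)

theorem memBVPhase_of_isAEConstNear {a b : ℝ} {u : ℝ → ℝ} {B : Finset ℝ}
    (h : ∀ t ∈ Ioo a b, t ∉ B → IsAEConstNear u t) (h1 : ∀ x, u x = -1 ∨ u x = 1) :
    MemBVPhase (Ioo a b) u := by
  classical
  set B' := B.filter (· ∈ Ioo a b) with hB'
  have hoff : ∀ t ∈ Ioo a b, t ∉ B' → IsAEConstNear u t := fun t ht htB =>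
    h t ht fun h' => htB (by simp only [hB', Finset.mem_filter]; exact ⟨h', ht⟩)
  have hex : ∀ s, ∃ cl cr : ℝ, s ∈ B' → ∃ r > 0, (∀ᵐ x, x ∈ Ioo (s - r) s → u x = cl) ∧
      ∀ᵐ x, x ∈ Ioo s (s + r) → u x = cr := by
    intro s
    by_cases hs : s ∈ B'
    · obtain ⟨cl, cr, h⟩ := exists_one_sided_constants hoff (Finset.mem_filter.1 hs).2
      exact ⟨cl, cr, fun _ => h⟩
    · exact ⟨0, 0, fun h => absurd h hs⟩
  choose cl cr hlr using hex
  obtain ⟨c₀, hc₀, -⟩ := exists_step_representation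
    (fun s hs => (Finset.mem_filter.1 hs).2) hoff hlr
  exact ⟨memBV_of_step hc₀, Eventually.of_forall h1⟩

theorem MemBVPhase.congr {Ω : Set ℝ} {u v : ℝ → ℝ} (h : MemBVPhase Ω u)
    (huv : u =ᵐ[volume.restrict Ω] v) : MemBVPhase Ω v := by
  obtain ⟨⟨hi, C, hC⟩, h1⟩ := h
  refine ⟨⟨Integrable.congr hi huv, C, fun φ g1 g2 g3 g4 => ?_⟩, ?_⟩
  · refine le_trans (le_of_eq ?_) (hC φ g1 g2 g3 g4)
    refine integral_congr_ae ?_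
    filter_upwards [huv] with t ht
    rw [ht]
  · filter_upwards [h1, huv] with t h2 h3
    rwa [← h3]

/-! ### Compactness -/

/-- The energy `∫_S (W(w)/ε + ε^{2k-1} (w^{(k)})²) dt` of a jet `w`. -/
noncomputable def scaledEnergy (W : ℝ → ℝ) (k : ℕ) (ε : ℝ) (w : ℕ → ℝ → ℝ) (S : Set ℝ) : ℝ≥0∞ :=
  ∫⁻ t in S, ENNReal.ofReal (1 / ε * W (w 0 t) + ε ^ (2 * k - 1) * w k t ^ 2)

theorem scaledEnergy_mono {W : ℝ → ℝ} {k : ℕ} {ε : ℝ} {w : ℕ → ℝ → ℝ} {S T : Set ℝ} (h : S ⊆ T) :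
    scaledEnergy W k ε w S ≤ scaledEnergy W k ε w T :=
  lintegral_mono_set h

theorem scaledEnergy_Ioo_eq {W : ℝ → ℝ} {k : ℕ} (hk : 1 ≤ k) {ε : ℝ} (hε : 0 < ε)
    (w : ℕ → ℝ → ℝ) (x y : ℝ) :
    scaledEnergy W k ε w (Ioo x y) = jetEnergy W k (affineJet ε 0 w) (Ioo (x / ε) (y / ε)) := by
  rw [scaledEnergy, ← jetEnergy_rescale hk hε 0 measurableSet_Ioo]
  congr 1
  ext t
  simp only [mem_preimage, mem_Ioo, add_zero, div_lt_iff₀ hε, lt_div_iff₀ hε, mul_comm]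

theorem sum_scaledEnergy_le {W : ℝ → ℝ} {k : ℕ} {ε : ℝ} {w : ℕ → ℝ → ℝ} {S : Finset ℝ}
    {I : ℝ → Set ℝ} {T : Set ℝ} (hI : ∀ s ∈ S, MeasurableSet (I s)) (hT : ∀ s ∈ S, I s ⊆ T)
    (hd : (S : Set ℝ).PairwiseDisjoint I) :
    ∑ s ∈ S, scaledEnergy W k ε w (I s) ≤ scaledEnergy W k ε w T := by
  have h := lintegral_biUnion_finset (μ := volume) hd hI
    (fun t => ENNReal.ofReal (1 / ε * W (w 0 t) + ε ^ (2 * k - 1) * w k t ^ 2))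
  simp only [scaledEnergy]
  rw [← h]
  exact lintegral_mono_set (iUnion₂_subset hT)

theorem exists_scaled_threshold {W : ℝ → ℝ} (hW0 : ∀ z, 0 ≤ W z) {α β : ℝ} (hα : 0 < α)
    (hβ : 0 < β) (hWαβ : ∀ z, α * min (min ((z + 1) ^ 2) ((z - 1) ^ 2)) β ≤ W z) {k : ℕ}
    (hk : 1 ≤ k) {ρ : ℝ} (hρ : 0 < ρ) : ∃ η : ℝ, 0 < η ∧ ∀ w, IsSobolevJet k w → ∀ ε > 0, ∀ x,
      scaledEnergy W k ε w (Ioo x (x + ε)) < ENNReal.ofReal η →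
      ∃ σ, (σ = 1 ∨ σ = -1) ∧ ∀ t ∈ Icc x (x + ε), IsJetNear k (affineJet ε 0 w) σ ρ (t / ε) := by
  obtain ⟨η, hη, h⟩ := exists_energy_threshold hW0 hα hβ hWαβ hk hρ
  refine ⟨η, hη, fun w hw ε hε x hE => ?_⟩
  have e : (x + ε) / ε = x / ε + 1 := by field_simp
  rw [scaledEnergy_Ioo_eq hk hε, e] at hE
  obtain ⟨σ, hσ, hn⟩ := h _ (hw.affine hε.ne' 0) _ hE
  refine ⟨σ, hσ, fun t ht => hn _ ⟨?_, ?_⟩⟩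
  · gcongr; exact ht.1
  · rw [← e]; gcongr; exact ht.2

theorem IsJetNear.abs_sub_le {k : ℕ} (hk : 1 ≤ k) {w : ℕ → ℝ → ℝ} {ε σ ρ t : ℝ} (hε : 0 < ε)
    (h : IsJetNear k (affineJet ε 0 w) σ ρ (t / ε)) : |w 0 t - σ| ≤ ρ := by
  have := h 0 hk
  have e : ε * (t / ε) = t := by field_simp
  simpa [affineJet, e] using this

/-- On an interval longer than `ε` with small energy, `w` stays close to a single well: by the
threshold it is close to one of them at each point, and it is continuous. -/
theorem exists_sign_threshold {W : ℝ → ℝ} (hW0 : ∀ z, 0 ≤ W z) {α β : ℝ} (hα : 0 < α)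
    (hβ : 0 < β) (hWαβ : ∀ z, α * min (min ((z + 1) ^ 2) ((z - 1) ^ 2)) β ≤ W z) {k : ℕ}
    (hk : 1 ≤ k) : ∃ η : ℝ, 0 < η ∧ ∀ w, IsSobolevJet k w → ∀ ε > 0, ∀ p q, ε < q - p →
      scaledEnergy W k ε w (Ioo p q) < ENNReal.ofReal η →
      (∀ x ∈ Ioo p q, |w 0 x - 1| ≤ 1 / 2) ∨ ∀ x ∈ Ioo p q, |w 0 x - -1| ≤ 1 / 2 := by
  obtain ⟨η, hη, h⟩ := exists_scaled_threshold hW0 hα hβ hWαβ hk (show (0 : ℝ) < 1 / 2 by norm_num)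
  refine ⟨η, hη, fun w hw ε hε p q hpq hE => ?_⟩
  have hx : ∀ x ∈ Ioo p q, |w 0 x - 1| ≤ 1 / 2 ∨ |w 0 x - -1| ≤ 1 / 2 := by
    intro x hx
    have h1 : max p (x - ε) + ε ≤ q := by
      rw [← le_sub_iff_add_le]; exact max_le (by linarith) (by linarith [hx.2])
    obtain ⟨σ, hσ, hn⟩ := h w hw ε hε (max p (x - ε))
      ((scaledEnergy_mono (Ioo_subset_Ioo (le_max_left _ _) h1)).trans_lt hE)
    have := (hn x ⟨max_le hx.1.le (by linarith), by linarith [le_max_right p (x - ε)]⟩).abs_sub_le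
      hk hε
    rcases hσ with rfl | rfl
    · exact Or.inl this
    · exact Or.inr this
  by_contra! hc
  obtain ⟨⟨x, hx1, hx2⟩, y, hy1, hy2⟩ := hc
  have hx3 := (hx x hx1).resolve_left (not_le.2 hx2)
  have hy3 := (hx y hy1).resolve_right (not_le.2 hy2)
  rw [abs_le] at hx3 hy3
  obtain ⟨z, hz, hz0⟩ := isPreconnected_Ioo.intermediate_value hx1 hy1
    (hw.continuous hk).continuousOn (show (0 : ℝ) ∈ Icc (w 0 x) (w 0 y) from
      ⟨by linarith [hx3.2], by linarith [hy3.1]⟩)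
  have := hx z hz
  rw [hz0] at this
  norm_num at this

/-- The energy controls the measure of the set where `w` is far from both wells. -/
theorem measure_far_from_wells_le {W : ℝ → ℝ} {α β : ℝ} (hα : 0 < α)
    (hWαβ : ∀ z, α * min (min ((z + 1) ^ 2) ((z - 1) ^ 2)) β ≤ W z) {k : ℕ} (hk : 1 ≤ k)
    {w : ℕ → ℝ → ℝ} (hw : IsSobolevJet k w) {ε : ℝ} (hε : 0 < ε) {a b δ : ℝ} (hδ : 0 < δ) :
    ENNReal.ofReal (α * min (δ ^ 2) β / ε) *
      volume.restrict (Ioo a b) {t | δ ≤ |w 0 t - 1| ∧ δ ≤ |w 0 t - -1|} ≤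
        scaledEnergy W k ε w (Ioo a b) := by
  have hc : Continuous (w 0) := hw.continuous hk
  set A := {t | δ ≤ |w 0 t - 1| ∧ δ ≤ |w 0 t - -1|} with hA
  have hAm : MeasurableSet A :=
    (measurableSet_le measurable_const (hc.sub continuous_const).abs.measurable).inter
      (measurableSet_le measurable_const (hc.sub continuous_const).abs.measurable)
  rw [← setLIntegral_const, scaledEnergy]
  refine (setLIntegral_mono' hAm fun t ht => ENNReal.ofReal_le_ofReal ?_).trans
    (setLIntegral_le_lintegral A _)
  obtain ⟨h1, h2⟩ := ht
  have h3 : min (δ ^ 2) β ≤ min (min ((w 0 t + 1) ^ 2) ((w 0 t - 1) ^ 2)) β := by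
    refine min_le_min_right _ (le_min ?_ ?_)
    · rw [← sq_abs (w 0 t + 1), ← sub_neg_eq_add]
      gcongr
    · rw [← sq_abs (w 0 t - 1)]
      gcongr
  have h4 := (mul_le_mul_of_nonneg_left h3 hα.le).trans (hWαβ (w 0 t))
  have h5 : 0 ≤ ε ^ (2 * k - 1) * w k t ^ 2 := by positivity
  have h6 : α * min (δ ^ 2) β / ε ≤ 1 / ε * W (w 0 t) := by
    rw [div_eq_inv_mul, one_div]
    gcongr
  linarith

/-- Equicoercivity: a sequence of jets of bounded energy has a subsequence that converges in measure
to a function in `BV((a,b); {-1,1})`. -/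
theorem exists_subseq_tendstoInMeasure {W : ℝ → ℝ} (hW0 : ∀ z, 0 ≤ W z) {α β : ℝ} (hα : 0 < α)
    (hβ : 0 < β) (hWαβ : ∀ z, α * min (min ((z + 1) ^ 2) ((z - 1) ^ 2)) β ≤ W z) {k : ℕ}
    (hk : 1 ≤ k) {a b : ℝ} {ε : ℕ → ℝ} (hε : ∀ j, 0 < ε j) (hε0 : Tendsto ε atTop (𝓝 0))
    {w : ℕ → ℕ → ℝ → ℝ} (hw : ∀ j, IsSobolevJet k (w j)) {C : ℝ≥0∞} (hC : C < ⊤)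
    (hE : ∀ j, scaledEnergy W k (ε j) (w j) (Ioo a b) ≤ C) :
    ∃ v, MemBVPhase (Ioo a b) v ∧ ∃ φ : ℕ → ℕ, StrictMono φ ∧
      TendstoInMeasure (volume.restrict (Ioo a b)) (fun j => w (φ j) 0) atTop v := by
  classical
  obtain ⟨η, hη, hsign⟩ := exists_sign_threshold hW0 hα hβ hWαβ hk
  -- a subsequence along which the energies of all rational intervals converge in `[0, ∞]`, and
  -- the values at all rational points in `[-∞, ∞]`
  set F : ℕ → (ℚ × ℚ → ℝ≥0∞) × (ℚ → EReal) := fun j =>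
    (fun q => scaledEnergy W k (ε j) (w j) (Ioo (q.1 : ℝ) q.2), fun q => (w j 0 q : EReal)) with hF
  obtain ⟨L, φ, hφ, hL⟩ := CompactSpace.tendsto_subseq F
  have hLE : ∀ q : ℚ × ℚ, Tendsto (fun j => scaledEnergy W k (ε (φ j)) (w (φ j))
      (Ioo (q.1 : ℝ) q.2)) atTop (𝓝 (L.1 q)) := fun q =>
    (tendsto_pi_nhds.1 ((continuous_fst.tendsto L).comp hL)) q
  have hLv : ∀ q : ℚ, Tendsto (fun j => (w (φ j) 0 q : EReal)) atTop (𝓝 (L.2 q)) := fun q =>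
    (tendsto_pi_nhds.1 ((continuous_snd.tendsto L).comp hL)) q
  have hεφ : Tendsto (fun j => ε (φ j)) atTop (𝓝 0) := hε0.comp hφ.tendsto_atTop
  -- the points where energy at least `η` concentrates
  set B : Set ℝ := {t | t ∈ Ioo a b ∧ ∀ q₁ q₂ : ℚ, a < q₁ → (q₁ : ℝ) < t → t < q₂ → (q₂ : ℝ) < b →
    ENNReal.ofReal η ≤ L.1 (q₁, q₂)} with hB
  have hη' : ENNReal.ofReal η ≠ 0 := by simpa using hη
  have hBfin : B.Finite := by
    by_contra hinf
    obtain ⟨n, hn⟩ := ENNReal.exists_nat_gt (r := C / ENNReal.ofReal η)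
      (ENNReal.div_lt_top hC.ne hη').ne
    rw [ENNReal.div_lt_iff (Or.inl hη') (Or.inl ENNReal.ofReal_ne_top)] at hn
    obtain ⟨S, hS, hcard⟩ := Set.Infinite.exists_subset_card_eq hinf n
    obtain ⟨r, hr, hsep⟩ := exists_separation (fun s hs => (hS hs).1)
    have hq₁ : ∀ s : ℝ, ∃ q : ℚ, s - r < q ∧ (q : ℝ) < s := fun s => exists_rat_btwn (by linarith)
    have hq₂ : ∀ s : ℝ, ∃ q : ℚ, s < q ∧ (q : ℝ) < s + r := fun s => exists_rat_btwn (by linarith)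
    choose q₁ hq₁ hq₁' using hq₁
    choose q₂ hq₂ hq₂' using hq₂
    have hsum : ∑ s ∈ S, L.1 (q₁ s, q₂ s) ≤ C := by
      refine le_of_tendsto (tendsto_finsetSum S fun s _ => hLE (q₁ s, q₂ s))
        (Eventually.of_forall fun j => ?_)
      refine (sum_scaledEnergy_le (I := fun s => Ioo (q₁ s : ℝ) (q₂ s)) (T := Ioo a b)
        (fun s _ => measurableSet_Ioo) (fun s hs => ?_) fun s hs s' hs' hne => ?_).trans (hE (φ j))
      · exact Ioo_subset_Ioo (by linarith [(hsep s hs).1, hq₁ s])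
          (by linarith [(hsep s hs).2.1, hq₂' s])
      · rw [Function.onFun, Set.disjoint_left]
        rintro t ⟨h1, h2⟩ ⟨h3, h4⟩
        have h5 := (hsep s hs).2.2 s' hs' hne
        have h6 : |s - s'| < 2 * r := by
          rw [abs_lt]
          constructor <;> linarith [hq₁ s, hq₂' s, hq₁ s', hq₂' s']
        linarith
    have hge : (n : ℝ≥0∞) * ENNReal.ofReal η ≤ ∑ s ∈ S, L.1 (q₁ s, q₂ s) := by
      rw [← hcard, ← nsmul_eq_mul]
      refine Finset.card_nsmul_le_sum _ _ _ fun s hs => ?_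
      exact (hS hs).2 _ _ ((hsep s hs).1.trans (hq₁ s)) (hq₁' s) (hq₂ s)
        ((hq₂' s).trans (hsep s hs).2.1)
    exact absurd hn (not_lt.2 (hge.trans hsum))
  -- off `B` the sequence settles near one of the wells; `v` is `1` where this well is `1`
  set v : ℝ → ℝ := fun t => if ∃ p q : ℝ, p < t ∧ t < q ∧
    ∀ᶠ j in atTop, ∀ x ∈ Ioo p q, |w (φ j) 0 x - 1| ≤ 1 / 2 then 1 else -1 with hv
  have hv1 : ∀ t, v t = -1 ∨ v t = 1 := fun t => by
    simp only [hv]; split_ifs <;> simp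
  have hloc : ∀ t ∈ Ioo a b, t ∉ B → ∃ p q : ℝ, p < t ∧ t < q ∧ ∃ σ : ℝ,
      (∀ x ∈ Ioo p q, v x = σ) ∧ ∀ᶠ j in atTop, ∀ x ∈ Ioo p q, |w (φ j) 0 x - σ| ≤ 1 / 2 := by
    intro t ht htB
    have h1 : ∃ q₁ q₂ : ℚ, a < q₁ ∧ (q₁ : ℝ) < t ∧ t < q₂ ∧ (q₂ : ℝ) < b ∧
        L.1 (q₁, q₂) < ENNReal.ofReal η := by
      by_contra! hc
      exact htB ⟨ht, hc⟩
    obtain ⟨q₁, q₂, -, hq₁, hq₂, -, hlt⟩ := h1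
    refine ⟨q₁, q₂, hq₁, hq₂, ?_⟩
    have hdich : ∀ᶠ j in atTop, (∀ x ∈ Ioo (q₁ : ℝ) q₂, |w (φ j) 0 x - 1| ≤ 1 / 2) ∨
        ∀ x ∈ Ioo (q₁ : ℝ) q₂, |w (φ j) 0 x - -1| ≤ 1 / 2 := by
      filter_upwards [(hLE (q₁, q₂)).eventually_lt_const hlt, hεφ.eventually_lt_const
        (show (0 : ℝ) < q₂ - q₁ by linarith)] with j h1 h2
      exact hsign _ (hw _) _ (hε _) _ _ h2 h1
    obtain ⟨q, hq1, hq2⟩ := exists_rat_btwn (hq₁.trans hq₂)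
    -- the limit of the values at the rational point `q` tells which well is approached
    rcases lt_or_ge (0 : EReal) (L.2 q) with hpos | hneg
    · have hplus : ∀ᶠ j in atTop, ∀ x ∈ Ioo (q₁ : ℝ) q₂, |w (φ j) 0 x - 1| ≤ 1 / 2 := by
        filter_upwards [hdich, (hLv q).eventually_const_lt hpos] with j h1 h2
        refine h1.resolve_right fun h3 => ?_
        have h4 := h3 q ⟨hq1, hq2⟩
        rw [abs_le] at h4
        have h5 : (0 : ℝ) < w (φ j) 0 q := by exact_mod_cast h2
        linarith [h4.2]
      exact ⟨1, fun x hx => if_pos ⟨q₁, q₂, hx.1, hx.2, hplus⟩, hplus⟩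
    · have hminus : ∀ᶠ j in atTop, ∀ x ∈ Ioo (q₁ : ℝ) q₂, |w (φ j) 0 x - -1| ≤ 1 / 2 := by
        have hhalf : L.2 q < ((1 / 2 : ℝ) : EReal) := hneg.trans_lt (by exact_mod_cast one_half_pos)
        filter_upwards [hdich, (hLv q).eventually_lt_const hhalf] with j h1 h2
        refine h1.resolve_left fun h3 => ?_
        have h4 := h3 q ⟨hq1, hq2⟩
        rw [abs_le] at h4
        have h5 : w (φ j) 0 q < 1 / 2 := by exact_mod_cast h2
        linarith [h4.1]
      refine ⟨-1, fun x hx => if_neg ?_, hminus⟩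
      rintro ⟨p, p', hp, hp', hplus⟩
      obtain ⟨j, h1, h2⟩ := (hminus.and hplus).exists
      have h3 := h1 x hx
      have h4 := h2 x ⟨hp, hp'⟩
      rw [abs_le] at h3 h4
      linarith [h3.2, h4.1]
  have hvBV : MemBVPhase (Ioo a b) v := by
    refine memBVPhase_of_isAEConstNear (B := hBfin.toFinset) (fun t ht htB => ?_) hv1
    obtain ⟨p, q, hp, hq, σ, hσ, -⟩ := hloc t ht (by simpa using htB)
    refine ⟨σ, min (t - p) (q - t), lt_min (by linarith) (by linarith),
      Eventually.of_forall fun x hx => hσ x ⟨?_, ?_⟩⟩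
    · linarith [hx.1, min_le_left (t - p) (q - t)]
    · linarith [hx.2, min_le_right (t - p) (q - t)]
  refine ⟨v, hvBV, φ, hφ, ?_⟩
  -- the signs converge almost everywhere
  set s : ℕ → ℝ → ℝ := fun j t => if 0 < w (φ j) 0 t then 1 else -1 with hs
  have hsm : TendstoInMeasure (volume.restrict (Ioo a b)) s atTop v := by
    refine tendstoInMeasure_of_tendsto_ae (fun j => ?_) ?_
    · exact (Measurable.ite (measurableSet_lt measurable_const
        ((hw (φ j)).continuous hk).measurable) measurable_const
        measurable_const).aestronglyMeasurable
    · rw [ae_restrict_iff' measurableSet_Ioo]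
      have hnull : ∀ᵐ t : ℝ, t ∉ B := hBfin.countable.ae_notMem volume
      filter_upwards [hnull] with t htB ht
      obtain ⟨p, q, hp, hq, σ, hσ, hev⟩ := hloc t ht htB
      refine tendsto_const_nhds.congr' ?_
      filter_upwards [hev] with j hj
      have h1 := hj t ⟨hp, hq⟩
      rw [← hσ t ⟨hp, hq⟩, abs_le] at h1
      simp only [hs]
      rcases hv1 t with h2 | h2 <;> rw [h2] at h1 ⊢
      · rw [if_neg (by linarith [h1.2])]
      · rw [if_pos (by linarith [h1.1])]
  rw [tendstoInMeasure_iff_norm] at hsm ⊢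
  intro δ hδ
  have hm0 : 0 < α * min (δ ^ 2) β := by positivity
  have hfar : Tendsto (fun j => volume.restrict (Ioo a b)
      {t | δ ≤ |w (φ j) 0 t - 1| ∧ δ ≤ |w (φ j) 0 t - -1|}) atTop (𝓝 0) := by
    have hlim : Tendsto (fun j => C * ENNReal.ofReal (ε (φ j) / (α * min (δ ^ 2) β))) atTop
        (𝓝 0) := by
      have h1 : Tendsto (fun j => ε (φ j) / (α * min (δ ^ 2) β)) atTop (𝓝 0) := by
        simpa using hεφ.div_const (α * min (δ ^ 2) β)
      have h2 := ENNReal.Tendsto.const_mul (a := C) (ENNReal.tendsto_ofReal h1) (Or.inr hC.ne)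
      simpa using h2
    refine tendsto_of_tendsto_of_tendsto_of_le_of_le tendsto_const_nhds hlim (fun _ => zero_le)
      fun j => ?_
    have h1 := (measure_far_from_wells_le hα hWαβ hk (hw (φ j)) (hε (φ j)) (a := a) (b := b)
      hδ).trans (hE (φ j))
    have hpos : 0 < α * min (δ ^ 2) β / ε (φ j) := div_pos hm0 (hε _)
    have h2 : ENNReal.ofReal (ε (φ j) / (α * min (δ ^ 2) β)) =
        (ENNReal.ofReal (α * min (δ ^ 2) β / ε (φ j)))⁻¹ := by
      rw [← ENNReal.ofReal_inv_of_pos hpos, inv_div]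
    dsimp only
    rw [h2, ← div_eq_mul_inv, ENNReal.le_div_iff_mul_le (Or.inl (by simpa using hpos))
      (Or.inl ENNReal.ofReal_ne_top), mul_comm]
    exact h1
  have hsum := hfar.add (hsm 1 one_pos)
  rw [add_zero] at hsum
  refine tendsto_of_tendsto_of_tendsto_of_le_of_le tendsto_const_nhds hsum (fun _ => zero_le)
    fun j => ?_
  refine le_trans (measure_mono fun t ht => ?_) (measure_union_le _ _)
  by_cases hst : s j t = v t
  · left
    have ht' : δ ≤ |w (φ j) 0 t - v t| := ht
    rw [← hst] at ht'
    simp only [hs] at ht'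
    split_ifs at ht' with h0
    · refine ⟨ht', ht'.trans ?_⟩
      rw [← sq_le_sq]; nlinarith
    · refine ⟨ht'.trans ?_, ht'⟩
      rw [← sq_le_sq]; nlinarith
  · right
    show (1 : ℝ) ≤ ‖s j t - v t‖
    have hs1 : s j t = -1 ∨ s j t = 1 := by
      simp only [hs]; split_ifs <;> simp
    rcases hs1 with h1 | h1 <;> rcases hv1 t with h2 | h2 <;> rw [h1, h2] at hst ⊢ <;>
      first | exact absurd rfl hst | norm_num

/-! ### The lower bound -/

/-- If `w i` has bounded energy on `(p,q)` and becomes close in measure to the well `σ`, there are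
points of `(p,q)` at which the whole rescaled jet is close to that of `σ`. -/
theorem eventually_exists_isJetNear {W : ℝ → ℝ} (hW0 : ∀ z, 0 ≤ W z) {α β : ℝ} (hα : 0 < α)
    (hβ : 0 < β) (hWαβ : ∀ z, α * min (min ((z + 1) ^ 2) ((z - 1) ^ 2)) β ≤ W z) {k : ℕ}
    (hk : 1 ≤ k) {ι : Type*} {l : Filter ι} {ε : ι → ℝ} (hε : ∀ᶠ i in l, 0 < ε i)
    (hε0 : Tendsto ε l (𝓝 0)) {w : ι → ℕ → ℝ → ℝ} (hw : ∀ i, IsSobolevJet k (w i)) {p q : ℝ}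
    (hpq : p < q) {C : ℝ≥0∞} (hC : C < ⊤)
    (hE : ∀ᶠ i in l, scaledEnergy W k (ε i) (w i) (Ioo p q) ≤ C) {σ : ℝ} (hσ : σ = 1 ∨ σ = -1)
    (hσw : Tendsto (fun i => volume {x | x ∈ Ioo p q ∧ 1 ≤ |w i 0 x - σ|}) l (𝓝 0)) {ρ : ℝ}
    (hρ : 0 < ρ) :
    ∀ᶠ i in l, ∃ x ∈ Ioo p q, IsJetNear k (affineJet (ε i) 0 (w i)) σ ρ (x / ε i) := by
  obtain ⟨η, hη, hthr⟩ := exists_scaled_threshold hW0 hα hβ hWαβ hk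
    (lt_min hρ (show (0 : ℝ) < 1 / 2 by norm_num))
  have hη' : ENNReal.ofReal η ≠ 0 := by simpa using hη
  have hηt : ENNReal.ofReal η ≠ ⊤ := ENNReal.ofReal_ne_top
  set D : ℝ := ((ENNReal.ofReal η)⁻¹ * C).toReal with hD
  have hDfin : (ENNReal.ofReal η)⁻¹ * C ≠ ⊤ := ENNReal.mul_ne_top (by simpa using hη) hC.ne
  have hD0 : 0 ≤ D := ENNReal.toReal_nonneg
  have h4 : (0 : ℝ≥0∞) < ENNReal.ofReal ((q - p) / 4) := by
    rw [ENNReal.ofReal_pos]; linarith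
  have hsmall : (0 : ℝ) < (q - p) / (2 * (D + 1)) := by
    have : 0 < q - p := by linarith
    positivity
  filter_upwards [hε, hE, hσw.eventually_lt_const h4, hε0.eventually_lt_const hsmall]
    with i hεi hEi hmi hεs
  set e := ε i with he
  set A : Set ℝ := {x | x ∈ Ioo p q ∧ 1 ≤ |w i 0 x - σ|} with hA
  -- the number of cells of length `e` that fit into `(p,q)`
  set K : ℕ := ⌊(q - p) / e⌋₊ with hK
  have hK1 : (K : ℝ) * e ≤ q - p := by
    have := Nat.floor_le (show 0 ≤ (q - p) / e from div_nonneg (by linarith) hεi.le)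
    rwa [le_div_iff₀ hεi] at this
  have hK2 : (q - p) / e < K + 1 := Nat.lt_floor_add_one _
  have hDe : D + 1 < (q - p) / (2 * e) := by
    rw [lt_div_iff₀ (by positivity)] at hεs ⊢
    linarith
  have e0 : ENNReal.ofReal e ≠ 0 := by simpa using hεi
  set f : ℝ → ℝ≥0∞ := fun t =>
    ENNReal.ofReal (1 / e * W (w i 0 t) + e ^ (2 * k - 1) * w i k t ^ 2) with hf
  -- a cell of measure less than one for `ν` has small energy and is not filled by bad points
  set ν : Measure ℝ := (ENNReal.ofReal η)⁻¹ • volume.withDensity f +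
    (ENNReal.ofReal e)⁻¹ • volume.restrict A with hν
  have hνI : ∀ x y, ν (Ioo x y) = (ENNReal.ofReal η)⁻¹ * scaledEnergy W k e (w i) (Ioo x y) +
      (ENNReal.ofReal e)⁻¹ * volume (Ioo x y ∩ A) := fun x y => by
    rw [hν, Measure.add_apply, Measure.smul_apply, Measure.smul_apply,
      withDensity_apply _ measurableSet_Ioo, Measure.restrict_apply measurableSet_Ioo]
    rfl
  have hν1 : ν (Ioo p (p + K * e)) < K * 1 := by
    rw [hνI]
    have g1 : (ENNReal.ofReal η)⁻¹ * scaledEnergy W k e (w i) (Ioo p (p + K * e)) ≤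
        ENNReal.ofReal D := by
      rw [hD, ENNReal.ofReal_toReal hDfin]
      gcongr
      exact (scaledEnergy_mono (Ioo_subset_Ioo le_rfl (by linarith))).trans hEi
    have g2 : (ENNReal.ofReal e)⁻¹ * volume (Ioo p (p + K * e) ∩ A) ≤
        ENNReal.ofReal ((q - p) / (4 * e)) := by
      have g3 : (q - p) / (4 * e) = e⁻¹ * ((q - p) / 4) := by field_simp
      rw [g3, ENNReal.ofReal_mul (by positivity), ENNReal.ofReal_inv_of_pos hεi]
      gcongr
      exact (measure_mono inter_subset_right).trans hmi.le
    refine (add_le_add g1 g2).trans_lt ?_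
    have hqp : 0 < q - p := by linarith
    rw [← ENNReal.ofReal_add hD0 (by positivity), mul_one, ← ENNReal.ofReal_natCast]
    have g4 : (q - p) / (4 * e) + (q - p) / (2 * e) ≤ (q - p) / e := by
      have : (q - p) / (4 * e) + (q - p) / (2 * e) = 3 / 4 * ((q - p) / e) := by field_simp; norm_num
      rw [this]
      have : 0 ≤ (q - p) / e := by positivity
      linarith
    have g5 : D + (q - p) / (4 * e) < K := by linarith
    exact (ENNReal.ofReal_lt_ofReal_iff (lt_of_le_of_lt (by positivity) g5)).2 g5
  obtain ⟨j, hj, hνj⟩ := exists_cell_measure_lt ν hεi hν1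
  set x := p + j * e with hx
  have hxp : p ≤ x := by
    have : (0 : ℝ) ≤ j * e := by positivity
    linarith
  have hxq : x + e ≤ q := by
    have : ((j : ℝ) + 1) * e ≤ K * e := by
      gcongr
      exact_mod_cast hj
    linarith
  rw [hνI] at hνj
  have hEx : scaledEnergy W k e (w i) (Ioo x (x + e)) < ENNReal.ofReal η := by
    have := lt_of_le_of_lt le_self_add hνj
    rwa [mul_comm, ← div_eq_mul_inv, ENNReal.div_lt_iff (Or.inl hη') (Or.inl hηt), one_mul] at this
  obtain ⟨σ', hσ', hn⟩ := hthr _ (hw i) e hεi x hEx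
  have hσσ : σ' = σ := by
    by_contra hne
    have hsub : Ioo x (x + e) ⊆ A := by
      intro t ht
      refine ⟨⟨by linarith [ht.1], by linarith [ht.2]⟩, ?_⟩
      have h1 := ((hn t (Ioo_subset_Icc_self ht)).abs_sub_le hk hεi).trans (min_le_right _ _)
      rw [abs_le] at h1
      rcases hσ with rfl | rfl <;> rcases hσ' with rfl | rfl
      · exact absurd rfl hne
      · rw [le_abs]; right; linarith [h1.2]
      · rw [le_abs]; left; linarith [h1.1]
      · exact absurd rfl hne
    have h1 := lt_of_le_of_lt le_add_self hνj
    rw [inter_eq_left.2 hsub, Real.volume_Ioo, add_sub_cancel_left,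
      ENNReal.inv_mul_cancel e0 ENNReal.ofReal_ne_top] at h1
    exact lt_irrefl _ h1
  refine ⟨x + e / 2, ⟨by linarith, by linarith⟩, fun m hm => ?_⟩
  have := hn (x + e / 2) ⟨by linarith, by linarith⟩ m hm
  rw [hσσ] at this
  exact this.trans (min_le_left _ _)

/-- The lower bound under a uniform bound `C` on the energies: each jump costs at least `m_k`. -/
theorem profileConst_mul_encard_le {W : ℝ → ℝ} (hW : Continuous W) (hW0 : ∀ z, 0 ≤ W z)
    (hWneg : W (-1) = 0) (hWpos : W 1 = 0) {α β : ℝ} (hα : 0 < α) (hβ : 0 < β)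
    (hWαβ : ∀ z, α * min (min ((z + 1) ^ 2) ((z - 1) ^ 2)) β ≤ W z) {k : ℕ}
    (hk : 1 ≤ k) {a b : ℝ} {ι : Type*} {l : Filter ι} [l.NeBot] {ε : ι → ℝ}
    (hε : ∀ᶠ i in l, 0 < ε i) (hε0 : Tendsto ε l (𝓝 0)) {w : ι → ℕ → ℝ → ℝ}
    (hw : ∀ i, IsSobolevJet k (w i)) {C : ℝ≥0∞}
    (hE : ∀ᶠ i in l, scaledEnergy W k (ε i) (w i) (Ioo a b) ≤ C) {u : ℝ → ℝ}
    (hu : MemBVPhase (Ioo a b) u)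
    (hwu : TendstoInMeasure (volume.restrict (Ioo a b)) (fun i => w i 0) l u) :
    profileConst k W * ((jumpSet a b u).encard : ℝ≥0∞) ≤ C := by
  rcases eq_or_ne C ⊤ with rfl | hCtop
  · exact le_top
  obtain ⟨S, σ, c₀, hS, hSab, hσ, hside, -, -⟩ := hu.exists_jumps
  rw [← hS, Set.encard_coe_eq_coe_finsetCard]
  obtain ⟨r, hr, hsep⟩ := exists_separation hSab
  have hbad : ∀ p q σ', Ioo p q ⊆ Ioo a b → (∀ᵐ x, x ∈ Ioo p q → u x = σ') →
      Tendsto (fun i => volume {x | x ∈ Ioo p q ∧ 1 ≤ |w i 0 x - σ'|}) l (𝓝 0) := by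
    intro p q σ' hsub hae
    refine tendsto_of_tendsto_of_tendsto_of_le_of_le tendsto_const_nhds
      ((tendstoInMeasure_iff_norm.1 hwu) 1 one_pos) (fun _ => zero_le) fun i => ?_
    refine le_trans ?_ (Measure.le_restrict_apply _ _)
    refine measure_mono_ae ?_
    filter_upwards [hae] with x hx hx'
    refine ⟨?_, hsub hx'.1⟩
    show 1 ≤ ‖w i 0 x - u x‖
    rw [hx hx'.1]
    exact hx'.2
  refine ENNReal.le_of_forall_pos_le_add fun ζ hζ _ => ?_
  set δ : ℝ := ζ / (S.card + 1) with hδ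
  have hζ' : (0 : ℝ) < ζ := by exact_mod_cast hζ
  have hδ0 : 0 < δ := by positivity
  obtain ⟨ρ, hρ, hprof⟩ := exists_profileConst_le hW hWneg hWpos hk hδ0
  have hev : ∀ᶠ i in l, ∀ s ∈ S, profileConst k W ≤
      scaledEnergy W k (ε i) (w i) (Ioo (s - r) (s + r)) + ENNReal.ofReal δ := by
    rw [Filter.eventually_all_finset]
    intro s hs
    obtain ⟨r', hr', hl, hr''⟩ := hside s hs
    have hm : 0 < min r r' := lt_min hr hr'
    have m1 := min_le_left r r'
    have m2 := min_le_right r r'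
    have hab := hsep s hs
    have hsub1 : Ioo (s - min r r') s ⊆ Ioo a b :=
      Ioo_subset_Ioo (by linarith [hab.1]) (by linarith [hab.2.1])
    have hsub2 : Ioo s (s + min r r') ⊆ Ioo a b :=
      Ioo_subset_Ioo (by linarith [hab.1]) (by linarith [hab.2.1])
    have hneg : -σ s = 1 ∨ -σ s = -1 := by
      rcases hσ s hs with h | h <;> rw [h] <;> simp
    have hleft := eventually_exists_isJetNear hW0 hα hβ hWαβ hk hε hε0 hw
      (show s - min r r' < s by linarith) (lt_top_iff_ne_top.2 hCtop)
      (hE.mono fun i hi => (scaledEnergy_mono hsub1).trans hi) hneg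
      (hbad _ _ _ hsub1 (by
        filter_upwards [hl] with x hx hx' using hx ⟨by linarith [hx'.1], hx'.2⟩)) hρ
    have hright := eventually_exists_isJetNear hW0 hα hβ hWαβ hk hε hε0 hw
      (show s < s + min r r' by linarith) (lt_top_iff_ne_top.2 hCtop)
      (hE.mono fun i hi => (scaledEnergy_mono hsub2).trans hi) (hσ s hs)
      (hbad _ _ _ hsub2 (by
        filter_upwards [hr''] with x hx hx' using hx ⟨hx'.1, by linarith [hx'.2]⟩)) hρ
    filter_upwards [hε, hleft, hright] with i hεi h1 h2
    obtain ⟨x, hx, hxn⟩ := h1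
    obtain ⟨y, hy, hyn⟩ := h2
    have hxy : x / ε i ≤ y / ε i := by
      gcongr; linarith [hx.2, hy.1]
    refine (hprof _ ((hw i).affine hεi.ne' 0) (σ s) _ _ (hσ s hs) hxy hxn hyn).trans ?_
    gcongr
    rw [← scaledEnergy_Ioo_eq hk hεi]
    exact scaledEnergy_mono (Ioo_subset_Ioo (by linarith [hx.1]) (by linarith [hy.2]))
  obtain ⟨i, hi1, hi2⟩ := (hev.and hE).exists
  have hsum : ∑ s ∈ S, scaledEnergy W k (ε i) (w i) (Ioo (s - r) (s + r)) ≤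
      scaledEnergy W k (ε i) (w i) (Ioo a b) := by
    refine sum_scaledEnergy_le (fun _ _ => measurableSet_Ioo)
      (fun s hs => Ioo_subset_Ioo (hsep s hs).1.le (hsep s hs).2.1.le) fun s hs s' hs' hne => ?_
    rw [Function.onFun, Set.disjoint_left]
    rintro t ⟨h1, h2⟩ ⟨h3, h4⟩
    have h5 := (hsep s hs).2.2 s' hs' hne
    have h6 : |s - s'| < 2 * r := by
      rw [abs_lt]; constructor <;> linarith
    linarith
  calc profileConst k W * (((S.card : ℕ∞)) : ℝ≥0∞) = ∑ s ∈ S, profileConst k W := by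
        simp [mul_comm]
    _ ≤ ∑ s ∈ S, (scaledEnergy W k (ε i) (w i) (Ioo (s - r) (s + r)) + ENNReal.ofReal δ) :=
        Finset.sum_le_sum hi1
    _ = ∑ s ∈ S, scaledEnergy W k (ε i) (w i) (Ioo (s - r) (s + r)) +
          S.card * ENNReal.ofReal δ := by
        rw [Finset.sum_add_distrib]; simp
    _ ≤ C + ζ := by
        refine add_le_add (hsum.trans hi2) ?_
        rw [← ENNReal.ofReal_natCast, ← ENNReal.ofReal_mul (by positivity),
          ← ENNReal.ofReal_coe_nnreal]
        refine ENNReal.ofReal_le_ofReal ?_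
        rw [hδ, mul_div_assoc', div_le_iff₀ (by positivity)]
        nlinarith

theorem exists_jet_of_phaseEnergy_lt_top {a b : ℝ} {k : ℕ} {W : ℝ → ℝ} {ε : ℝ} {u : ℝ → ℝ}
    (h : phaseEnergy a b k W ε u < ⊤) : ∃ w, IsSobolevJet k w ∧
      w 0 =ᵐ[volume.restrict (Ioo a b)] u ∧
      phaseEnergy a b k W ε u = scaledEnergy W k ε w (Ioo a b) := by
  have hu : MemHk (Ioo a b) k u := by
    by_contra hn
    rw [phaseEnergy, if_neg hn] at h
    exact lt_irrefl _ h
  obtain ⟨w, hw, h0, hk⟩ := hu.exists_isSobolevJet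
  exact ⟨w, hw, h0, hu.phaseEnergy_eq h0 hk⟩

/-- The liminf inequality, along an arbitrary filter. -/
theorem le_liminf_phaseEnergy {W : ℝ → ℝ} (hW : Continuous W) (hW0 : ∀ z, 0 ≤ W z)
    (hWneg : W (-1) = 0) (hWpos : W 1 = 0) {α β : ℝ} (hα : 0 < α) (hβ : 0 < β)
    (hWαβ : ∀ z, α * min (min ((z + 1) ^ 2) ((z - 1) ^ 2)) β ≤ W z) {k : ℕ}
    (hk : 1 ≤ k) {a b : ℝ} {ι : Type*} {l : Filter ι} {ε : ι → ℝ}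
    (hε : ∀ᶠ i in l, 0 < ε i) (hε0 : Tendsto ε l (𝓝 0)) {v : ι → ℝ → ℝ} {u : ℝ → ℝ}
    (hu : MemBVPhase (Ioo a b) u)
    (hvu : TendstoInMeasure (volume.restrict (Ioo a b)) v l u) :
    profileConst k W * ((jumpSet a b u).encard : ℝ≥0∞) ≤
      liminf (fun i => phaseEnergy a b k W (ε i) (v i)) l := by
  by_contra! hlt
  obtain ⟨c, hc1, hc2⟩ := exists_between hlt
  have hfreq := Filter.frequently_lt_of_liminf_lt (h := hc1)
  have hne : (l ⊓ 𝓟 {i | phaseEnergy a b k W (ε i) (v i) < c}).NeBot :=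
    Filter.frequently_iff_neBot.1 hfreq
  -- restricting to the indices of energy below `c` gives a uniform energy bound
  set l' := l ⊓ 𝓟 {i | phaseEnergy a b k W (ε i) (v i) < c} with hl'
  have hll : l' ≤ l := inf_le_left
  have hmem : ∀ᶠ i in l', phaseEnergy a b k W (ε i) (v i) < c :=
    (eventually_principal.2 fun _ h => h).filter_mono inf_le_right
  have hex : ∀ i, ∃ w, IsSobolevJet k w ∧ (phaseEnergy a b k W (ε i) (v i) < c →
      w 0 =ᵐ[volume.restrict (Ioo a b)] v i ∧
      phaseEnergy a b k W (ε i) (v i) = scaledEnergy W k (ε i) w (Ioo a b)) := by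
    intro i
    by_cases hi : phaseEnergy a b k W (ε i) (v i) < c
    · obtain ⟨w, h1, h2, h3⟩ := exists_jet_of_phaseEnergy_lt_top (hi.trans_le le_top)
      exact ⟨w, h1, fun _ => ⟨h2, h3⟩⟩
    · exact ⟨_, IsSobolevJet.zero k, fun h => absurd h hi⟩
  choose w hw hwv using hex
  have key := profileConst_mul_encard_le hW hW0 hWneg hWpos hα hβ hWαβ hk (l := l') (C := c)
    (hε.filter_mono hll) (hε0.mono_left hll) hw
    (hmem.mono fun i hi => by rw [← (hwv i hi).2]; exact hi.le) hu
    ((hvu.mono hll).congr' (hmem.mono fun i hi => (hwv i hi).1.symm) EventuallyEq.rfl)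
  exact absurd key (not_le.2 hc2)

/-! ### Recovery families -/

theorem exists_bound_of_eq_const {p : ℕ → ℝ → ℝ} {k : ℕ} (hk : 1 ≤ k) (hp : IsSobolevJet k p) {T : ℝ}
    (h1 : ∀ l, ∀ t ≤ -T, p l t = constJet (-1) l t) (h2 : ∀ l, ∀ t, T ≤ t → p l t = constJet 1 l t) :
    ∃ R, ∀ t, |p 0 t| ≤ R := by
  obtain ⟨R, hR⟩ := (isCompact_Icc (a := -T) (b := T)).exists_bound_of_continuousOn
    (hp.continuous hk).continuousOn
  refine ⟨max R 1, fun t => ?_⟩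
  rcases le_total t (-T) with h | h
  · rw [h1 0 t h]; simp
  rcases le_total T t with h' | h'
  · rw [h2 0 t h']; simp
  · exact (hR t ⟨h, h'⟩).trans (le_max_left _ _)

theorem affineJet_affineJet_inv {ε : ℝ} (hε : 0 < ε) (s : ℝ) (q : ℕ → ℝ → ℝ) :
    affineJet ε s (affineJet ε⁻¹ (-s / ε) q) = q := by
  ext l t
  have : ε⁻¹ * (ε * t + s) + -s / ε = t := by field_simp; ring
  simp only [affineJet]
  rw [this, ← mul_assoc, ← mul_pow, mul_inv_cancel₀ hε.ne', one_pow, one_mul]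

/-- Placing rescaled copies of a profile of energy at most `M` at the jumps of `u` gives a family
that converges to `u`, with energy at most `M` for each jump. -/
theorem exists_approx_recovery {W : ℝ → ℝ} (hWneg : W (-1) = 0) (hWpos : W 1 = 0)
    {k : ℕ} (hk : 1 ≤ k) {a b : ℝ} {u : ℝ → ℝ} (hu : MemBVPhase (Ioo a b) u)
    {M : ℝ≥0∞} {p : ℕ → ℝ → ℝ} {T : ℝ} (hT : 0 < T) (hp : IsSobolevJet k p)
    (hp1 : ∀ l, ∀ t ≤ -T, p l t = constJet (-1) l t) (hp2 : ∀ l, ∀ t, T ≤ t → p l t = constJet 1 l t)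
    (hpE : jetEnergy W k p univ ≤ M) {ζ : ℝ} (hζ : 0 < ζ) :
    ∃ V : ℝ → ℕ → ℝ → ℝ, (∀ ε, 0 < ε → IsSobolevJet k (V ε)) ∧ ∀ᶠ ε in 𝓝[>] (0 : ℝ),
      scaledEnergy W k ε (V ε) (Ioo a b) ≤ M * ((jumpSet a b u).encard : ℝ≥0∞) ∧
      eLpNorm (V ε 0 - u) 1 (volume.restrict (Ioo a b)) ≤ ENNReal.ofReal ζ := by
  classical
  obtain ⟨S, σ, c₀, hS, hSab, hσ, -, hrep, hc₀⟩ := hu.exists_jumps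
  rw [← hS, Set.encard_coe_eq_coe_finsetCard]
  obtain ⟨r, hr, hsep⟩ := exists_separation hSab
  obtain ⟨R, hR⟩ := exists_bound_of_eq_const hk hp hp1 hp2
  have hu1 := hu.2
  rw [ae_restrict_iff' measurableSet_Ioo] at hu1
  -- the transition from `-σ s` to `σ s`
  set q : ℝ → ℕ → ℝ → ℝ := fun s => if σ s = 1 then p else affineJet (-1) 0 p
  have hqp : ∀ s, σ s = 1 → q s = p := fun s h => if_pos h
  have hqm : ∀ s, σ s ≠ 1 → q s = affineJet (-1) 0 p := fun s h => if_neg h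
  have hqj : ∀ s, IsSobolevJet k (q s) := fun s => by
    rcases eq_or_ne (σ s) 1 with h | h
    · rw [hqp s h]; exact hp
    · rw [hqm s h]; exact hp.affine (by norm_num) 0
  have hqR : ∀ s t, |q s 0 t| ≤ R := fun s t => by
    rcases eq_or_ne (σ s) 1 with h | h
    · rw [hqp s h]; exact hR t
    · rw [hqm s h]; simpa [affineJet] using hR (-t)
  have hqE : ∀ s, jetEnergy W k (q s) univ ≤ M := fun s => by
    rcases eq_or_ne (σ s) 1 with h | h
    · rw [hqp s h]; exact hpE
    · have := jetEnergy_reflect (W := W) (k := k) (w := p) MeasurableSet.univ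
      rw [preimage_univ] at this
      rw [hqm s h, this]; exact hpE
  have hrefl : ∀ (l : ℕ) (c t : ℝ), (-1 : ℝ) ^ l * constJet c l t = constJet c l t := fun l c t => by
    rcases eq_or_ne l 0 with rfl | hl
    · simp
    · simp [hl]
  have hq1 : ∀ s ∈ S, ∀ l, ∀ t ≤ -T, q s l t = constJet (-σ s) l t := fun s hs l t ht => by
    rcases eq_or_ne (σ s) 1 with h | h
    · rw [hqp s h, hp1 l t ht, h]
    · rw [hqm s h, (hσ s hs).resolve_left h, affineJet, hp2 l _ (by linarith), hrefl]
      simp [constJet]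
  have hq2 : ∀ s ∈ S, ∀ l, ∀ t, T ≤ t → q s l t = constJet (σ s) l t := fun s hs l t ht => by
    rcases eq_or_ne (σ s) 1 with h | h
    · rw [hqp s h, hp2 l t ht, h]
    · rw [hqm s h, (hσ s hs).resolve_left h, affineJet, hp1 l _ (by linarith), hrefl]
      simp [constJet]
  -- adding `σ s` makes the transition start from `0`, so that the contributions of the jumps add up
  set h : ℝ → ℕ → ℝ → ℝ := fun s l t => q s l t + constJet (σ s) l t with hh
  have hhj : ∀ s, IsSobolevJet k (h s) := fun s => (hqj s).add (isSobolevJet_constJet k _)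
  set V : ℝ → ℕ → ℝ → ℝ := fun ε l t =>
    constJet c₀ l t + ∑ s ∈ S, affineJet ε⁻¹ (-s / ε) (h s) l t with hV
  refine ⟨V, fun ε hε => (isSobolevJet_constJet k c₀).add
    (IsSobolevJet.sum S fun s _ => (hhj s).affine (inv_ne_zero hε.ne') _), ?_⟩
  obtain ⟨N, hN⟩ : ∃ N : ℝ, N = S.card := ⟨_, rfl⟩
  have hN0 : 0 ≤ N := hN ▸ Nat.cast_nonneg _
  have hR0 : 0 ≤ R := (abs_nonneg _).trans (hR 0)
  have hT1 : ∀ᶠ ε in 𝓝[>] (0 : ℝ), ε < r / T := by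
    filter_upwards [Ioo_mem_nhdsGT (show 0 < r / T by positivity)] with ε hε using hε.2
  have hT2 : ∀ᶠ ε in 𝓝[>] (0 : ℝ), ε < ζ / ((N + 1) * ((R + 1) * (2 * T))) := by
    filter_upwards [Ioo_mem_nhdsGT
      (show 0 < ζ / ((N + 1) * ((R + 1) * (2 * T))) by positivity)] with ε hε using hε.2
  filter_upwards [hT1, hT2, self_mem_nhdsWithin] with ε hε1 hε2 hε
  have hε : 0 < ε := hε
  have hεT : ε * T < r := by rwa [lt_div_iff₀ hT] at hε1
  set I : ℝ → Set ℝ := fun s => Ioo (s - ε * T) (s + ε * T) with hI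
  have hparam : ∀ s x : ℝ, ε⁻¹ * x + -s / ε = (x - s) / ε := fun s x => by field_simp; ring
  have hout0 : ∀ s ∈ S, ∀ x, x ∉ I s →
      affineJet ε⁻¹ (-s / ε) (h s) 0 x = if s < x then 2 * σ s else 0 := by
    intro s hs x hx
    simp only [affineJet, hparam, pow_zero, one_mul, hh]
    rw [hI, mem_Ioo, not_and_or, not_lt, not_lt] at hx
    have hpos : 0 < ε * T := by positivity
    rcases hx with hx | hx
    · rw [hq1 s hs 0 _ (by rw [div_le_iff₀ hε]; linarith), if_neg (by linarith)]
      simp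
    · rw [hq2 s hs 0 _ (by rw [le_div_iff₀ hε]; linarith), if_pos (by linarith)]
      simp only [constJet_zero]; ring
  have houtk : ∀ s ∈ S, ∀ x, x ∉ I s → affineJet ε⁻¹ (-s / ε) (h s) k x = 0 := by
    intro s hs x hx
    have hk0 : k ≠ 0 := by omega
    simp only [affineJet, hparam, hh]
    rw [hI, mem_Ioo, not_and_or, not_lt, not_lt] at hx
    rcases hx with hx | hx
    · rw [hq1 s hs k _ (by rw [div_le_iff₀ hε]; linarith)]
      simp [hk0]
    · rw [hq2 s hs k _ (by rw [le_div_iff₀ hε]; linarith)]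
      simp [hk0]
  have hdisj : ∀ s ∈ S, ∀ s' ∈ S, s' ≠ s → ∀ x ∈ I s, x ∉ I s' ∧ (s' < x ↔ s' < s) := by
    intro s hs s' hs' hne x hx
    have h1 := (hsep s hs).2.2 s' hs' hne.symm
    have hx1 : s - ε * T < x := hx.1
    have hx2 : x < s + ε * T := hx.2
    rw [lt_abs] at h1
    constructor
    · rintro ⟨h2, h3⟩
      rcases h1 with h1 | h1 <;> linarith
    · rcases h1 with h1 | h1
      · exact ⟨fun _ => by linarith, fun _ => by linarith⟩
      · exact ⟨fun _ => by linarith, fun _ => by linarith⟩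
  have hin0 : ∀ s ∈ S, ∀ x ∈ I s, V ε 0 x = affineJet ε⁻¹ (-s / ε) (q s) 0 x := by
    intro s hs x hx
    have e1 := hc₀ s hs
    rw [← Finset.add_sum_erase _ _ hs, if_neg (lt_irrefl s), zero_add] at e1
    simp only [hV, constJet_zero]
    rw [← Finset.add_sum_erase _ _ hs]
    have e2 : ∑ s' ∈ S.erase s, affineJet ε⁻¹ (-s' / ε) (h s') 0 x =
        ∑ s' ∈ S.erase s, if s' < s then 2 * σ s' else 0 := by
      refine Finset.sum_congr rfl fun s' hs' => ?_
      obtain ⟨hne, hs'⟩ := Finset.mem_erase.1 hs'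
      obtain ⟨g1, g2⟩ := hdisj s hs s' hs' hne x hx
      rw [hout0 s' hs' x g1]
      simp only [g2]
    rw [e2]
    have e3 : affineJet ε⁻¹ (-s / ε) (h s) 0 x = affineJet ε⁻¹ (-s / ε) (q s) 0 x + σ s := by
      simp [affineJet, hh]
    rw [e3]
    linarith
  have hink : ∀ s ∈ S, ∀ x ∈ I s, V ε k x = affineJet ε⁻¹ (-s / ε) (q s) k x := by
    intro s hs x hx
    have hk0 : k ≠ 0 := by omega
    simp only [hV, constJet_of_ne hk0, zero_add]
    rw [← Finset.add_sum_erase _ _ hs, Finset.sum_eq_zero, add_zero]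
    · simp [affineJet, hh, hk0]
    · intro s' hs'
      obtain ⟨hne, hs'⟩ := Finset.mem_erase.1 hs'
      exact houtk s' hs' x (hdisj s hs s' hs' hne x hx).1
  have hrest : ∀ᵐ x, x ∈ Ioo a b → x ∉ ⋃ s ∈ S, I s → V ε 0 x = u x ∧ V ε k x = 0 := by
    filter_upwards [hrep] with x hx hxab hxI
    have hxI' : ∀ s ∈ S, x ∉ I s := fun s hs hxs => hxI (mem_iUnion₂.2 ⟨s, hs, hxs⟩)
    constructor
    · rw [hx hxab]
      simp only [hV, constJet_zero]
      congr 1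
      exact Finset.sum_congr rfl fun s hs => hout0 s hs x (hxI' s hs)
    · simp only [hV, constJet_of_ne (show k ≠ 0 by omega), zero_add]
      exact Finset.sum_eq_zero fun s hs => houtk s hs x (hxI' s hs)
  have hpd : (S : Set ℝ).PairwiseDisjoint I := fun s hs s' hs' hne => by
    rw [Function.onFun, Set.disjoint_left]
    exact fun x hx => (hdisj s hs s' hs' hne.symm x hx).1
  have hIm : ∀ s ∈ S, MeasurableSet (I s) := fun s _ => measurableSet_Ioo
  have hUm : MeasurableSet (⋃ s ∈ S, I s) := Finset.measurableSet_biUnion S hIm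
  constructor
  · have hIE : ∀ s ∈ S, scaledEnergy W k ε (V ε) (I s) ≤ M := by
      intro s hs
      have e1 : scaledEnergy W k ε (V ε) (I s) =
          scaledEnergy W k ε (affineJet ε⁻¹ (-s / ε) (q s)) (I s) :=
        setLIntegral_congr_fun measurableSet_Ioo fun x hx => by
          simp only [hin0 s hs x hx, hink s hs x hx]
      rw [e1, scaledEnergy, ← jetEnergy_rescale hk hε s measurableSet_Ioo,
        affineJet_affineJet_inv hε]
      exact (jetEnergy_mono (subset_univ _)).trans (hqE s)
    have hEU : scaledEnergy W k ε (V ε) (⋃ s ∈ S, I s) ≤ M * (((S.card : ℕ∞)) : ℝ≥0∞) := by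
      rw [scaledEnergy, lintegral_biUnion_finset hpd hIm]
      calc _ ≤ ∑ s ∈ S, M := Finset.sum_le_sum hIE
        _ = _ := by simp [mul_comm]
    have hE0 : scaledEnergy W k ε (V ε) (Ioo a b \ ⋃ s ∈ S, I s) = 0 := by
      rw [scaledEnergy, lintegral_eq_zero_iff' (by
        refine AEMeasurable.congr (f := fun _ => (0 : ℝ≥0∞)) aemeasurable_const ?_
        rw [EventuallyEq, ae_restrict_iff' (measurableSet_Ioo.diff hUm)]
        filter_upwards [hrest, hu1] with x h1 h2 hx
        obtain ⟨g1, g2⟩ := h1 hx.1 hx.2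
        rw [g1, g2]
        rcases h2 hx.1 with h3 | h3 <;> rw [h3] <;> simp [hWneg, hWpos]), EventuallyEq,
        ae_restrict_iff' (measurableSet_Ioo.diff hUm)]
      filter_upwards [hrest, hu1] with x h1 h2 hx
      obtain ⟨g1, g2⟩ := h1 hx.1 hx.2
      rw [g1, g2]
      rcases h2 hx.1 with h3 | h3 <;> rw [h3] <;> simp [hWneg, hWpos]
    have hsub : Ioo a b ⊆ (⋃ s ∈ S, I s) ∪ (Ioo a b \ ⋃ s ∈ S, I s) := by
      rw [union_sdiff_self]; exact subset_union_right
    calc scaledEnergy W k ε (V ε) (Ioo a b)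
        ≤ scaledEnergy W k ε (V ε) ((⋃ s ∈ S, I s) ∪ (Ioo a b \ ⋃ s ∈ S, I s)) :=
          scaledEnergy_mono hsub
      _ ≤ scaledEnergy W k ε (V ε) (⋃ s ∈ S, I s) +
            scaledEnergy W k ε (V ε) (Ioo a b \ ⋃ s ∈ S, I s) := lintegral_union_le _ _ _
      _ ≤ _ := by rw [hE0, add_zero]; exact hEU
  · rw [eLpNorm_one_eq_lintegral_enorm]
    have hle : ∀ᵐ x ∂(volume.restrict (Ioo a b)), ‖(V ε 0 - u) x‖ₑ ≤
        (⋃ s ∈ S, I s).indicator (fun _ => ENNReal.ofReal (R + 1)) x := by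
      rw [ae_restrict_iff' measurableSet_Ioo]
      filter_upwards [hrest, hu1] with x h1 h2 hx
      by_cases hxU : x ∈ ⋃ s ∈ S, I s
      · rw [indicator_of_mem hxU, Real.enorm_eq_ofReal_abs]
        refine ENNReal.ofReal_le_ofReal ?_
        obtain ⟨s, hs, hxs⟩ := mem_iUnion₂.1 hxU
        rw [Pi.sub_apply, hin0 s hs x hxs]
        refine (abs_sub _ _).trans (add_le_add ?_ ?_)
        · simpa [affineJet] using hqR s _
        · rcases h2 hx with h3 | h3 <;> rw [h3] <;> simp
      · rw [Pi.sub_apply, (h1 hx hxU).1, sub_self]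
        simp
    refine (lintegral_mono_ae hle).trans ?_
    refine (setLIntegral_le_lintegral _ _).trans ?_
    rw [lintegral_indicator hUm, setLIntegral_const]
    have hvol : volume (⋃ s ∈ S, I s) ≤ ENNReal.ofReal (N * (2 * (ε * T))) := by
      refine (measure_biUnion_finset_le S I).trans ?_
      have e1 : ∀ s ∈ S, volume (I s) = ENNReal.ofReal (2 * (ε * T)) := fun s _ => by
        simp only [hI, Real.volume_Ioo]
        congr 1; ring
      rw [Finset.sum_congr rfl e1, Finset.sum_const, nsmul_eq_mul,
        ENNReal.ofReal_mul hN0, hN, ENNReal.ofReal_natCast]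
    calc ENNReal.ofReal (R + 1) * volume (⋃ s ∈ S, I s)
        ≤ ENNReal.ofReal (R + 1) * ENNReal.ofReal (N * (2 * (ε * T))) := by gcongr
      _ = ENNReal.ofReal ((R + 1) * (N * (2 * (ε * T)))) := by
          rw [← ENNReal.ofReal_mul (by positivity)]
      _ ≤ ENNReal.ofReal ζ := by
          refine ENNReal.ofReal_le_ofReal ?_
          rw [lt_div_iff₀ (by positivity)] at hε2
          have : 0 ≤ ε * ((R + 1) * (2 * T)) := by positivity
          nlinarith

/-- Diagonal argument: properties that hold eventually for each `n` hold along some `N ε → ∞`. -/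
theorem exists_diagonal {P : ℕ → ℝ → Prop} (h : ∀ n, ∀ᶠ ε in 𝓝[>] (0 : ℝ), P n ε) :
    ∃ N : ℝ → ℕ, Tendsto N (𝓝[>] 0) atTop ∧ ∀ᶠ ε in 𝓝[>] (0 : ℝ), P (N ε) ε := by
  classical
  have hall : ∀ n, ∀ᶠ ε in 𝓝[>] (0 : ℝ), ∀ m ≤ n, P m ε := fun n => by
    have := (Filter.eventually_all_finset (Finset.range (n + 1)) (p := fun m ε => P m ε)
      (l := 𝓝[>] (0 : ℝ))).2 fun m _ => h m
    filter_upwards [this] with ε hε m hm using hε m (Finset.mem_range.2 (by omega))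
  -- the bound on the search tends to infinity, so it does not keep `N` from doing so
  refine ⟨fun ε => Nat.findGreatest (fun n => ∀ m ≤ n, P m ε) ⌈ε⁻¹⌉₊, ?_, ?_⟩
  · rw [tendsto_atTop]
    intro m
    have hinv := tendsto_inv_nhdsGT_zero.eventually_ge_atTop (m : ℝ)
    filter_upwards [hall m, hinv] with ε h1 h2
    refine Nat.le_findGreatest ?_ h1
    exact_mod_cast h2.trans (Nat.le_ceil _)
  · filter_upwards [hall 0] with ε h1
    exact Nat.findGreatest_spec (P := fun n => ∀ m ≤ n, P m ε) (Nat.zero_le _) h1 _ le_rfl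

theorem exists_recovery {W : ℝ → ℝ} (hW : Continuous W) (hW0 : ∀ z, 0 ≤ W z)
    (hWneg : W (-1) = 0) (hWpos : W 1 = 0) {α β : ℝ} (hα : 0 < α) (hβ : 0 < β)
    (hWαβ : ∀ z, α * min (min ((z + 1) ^ 2) ((z - 1) ^ 2)) β ≤ W z) {k : ℕ}
    (hk : 1 ≤ k) {a b : ℝ} {u : ℝ → ℝ} (hu : MemBVPhase (Ioo a b) u) :
    ∃ v : ℝ → ℝ → ℝ, (∀ ε, 0 < ε → MemHk (Ioo a b) k (v ε)) ∧
      Tendsto (fun ε => eLpNorm (v ε - u) 1 (volume.restrict (Ioo a b))) (𝓝[>] 0) (𝓝 0) ∧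
      limsup (fun ε => phaseEnergy a b k W ε (v ε)) (𝓝[>] 0) ≤
        profileConst k W * ((jumpSet a b u).encard : ℝ≥0∞) := by
  have htop := profileConst_lt_top hW hWneg hWpos hk
  have hpos : ∀ n : ℕ, (0 : ℝ) < 1 / (n + 1) := fun n => by positivity
  have happ : ∀ n : ℕ, ∃ V : ℝ → ℕ → ℝ → ℝ, (∀ ε, 0 < ε → IsSobolevJet k (V ε)) ∧
      ∀ᶠ ε in 𝓝[>] (0 : ℝ), scaledEnergy W k ε (V ε) (Ioo a b) ≤
        (profileConst k W + ENNReal.ofReal (1 / (n + 1))) * ((jumpSet a b u).encard : ℝ≥0∞) ∧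
      eLpNorm (V ε 0 - u) 1 (volume.restrict (Ioo a b)) ≤ ENNReal.ofReal (1 / (n + 1)) := by
    intro n
    obtain ⟨p, T, hT, hp, hp1, hp2, hpE⟩ := exists_profile hW hW0 hWneg hWpos hα hβ hWαβ hk
      (M := profileConst k W + ENNReal.ofReal (1 / (n + 1)))
      (ENNReal.lt_add_right htop.ne (by simpa using hpos n))
    exact exists_approx_recovery hWneg hWpos hk hu hT hp hp1 hp2 hpE (hpos n)
  choose V hV hVe using happ
  obtain ⟨N, hN, hNe⟩ := exists_diagonal hVe
  have hlim : Tendsto (fun ε => ENNReal.ofReal (1 / ((N ε : ℝ) + 1))) (𝓝[>] 0) (𝓝 0) := by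
    have := ENNReal.tendsto_ofReal
      ((tendsto_one_div_add_atTop_nhds_zero_nat (𝕜 := ℝ)).comp hN)
    simpa using this
  have hcard : ((jumpSet a b u).encard : ℝ≥0∞) ≠ ⊤ := by
    obtain ⟨S, -, -, hS, -⟩ := hu.exists_jumps
    rw [← hS, Set.encard_coe_eq_coe_finsetCard]
    simp
  refine ⟨fun ε => V (N ε) ε 0, fun ε hε => (hV _ ε hε).memHk a b, ?_, ?_⟩
  · exact tendsto_of_tendsto_of_tendsto_of_le_of_le' tendsto_const_nhds hlim
      (Eventually.of_forall fun _ => zero_le) (hNe.mono fun ε h => h.2)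
  · have hlim2 : Tendsto (fun ε => (profileConst k W + ENNReal.ofReal (1 / ((N ε : ℝ) + 1))) *
        ((jumpSet a b u).encard : ℝ≥0∞)) (𝓝[>] 0)
        (𝓝 (profileConst k W * ((jumpSet a b u).encard : ℝ≥0∞))) := by
      have h1 := (tendsto_const_nhds (x := profileConst k W)).add hlim
      rw [add_zero] at h1
      exact ENNReal.Tendsto.mul_const h1 (Or.inr hcard)
    rw [← hlim2.limsup_eq]
    refine limsup_le_limsup ?_
    filter_upwards [hNe, self_mem_nhdsWithin] with ε h1 h2
    rw [(hV (N ε) ε h2).phaseEnergy_eq]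
    exact h1.1

/-! ### `Γ`-convergence -/

theorem exists_subseq_of_phaseEnergy_le {W : ℝ → ℝ} (hW0 : ∀ z, 0 ≤ W z) {α β : ℝ} (hα : 0 < α)
    (hβ : 0 < β) (hWαβ : ∀ z, α * min (min ((z + 1) ^ 2) ((z - 1) ^ 2)) β ≤ W z) {k : ℕ}
    (hk : 1 ≤ k) {a b : ℝ} {ε : ℕ → ℝ} (hε : ∀ j, 0 < ε j) (hε0 : Tendsto ε atTop (𝓝 0))
    {u : ℕ → ℝ → ℝ} {C : ℝ≥0∞} (hC : C < ⊤) (hE : ∀ j, phaseEnergy a b k W (ε j) (u j) ≤ C) :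
    ∃ v, MemBVPhase (Ioo a b) v ∧ ∃ φ : ℕ → ℕ, StrictMono φ ∧
      TendstoInMeasure (volume.restrict (Ioo a b)) (fun j => u (φ j)) atTop v := by
  choose w hw hwu hwE using fun j => exists_jet_of_phaseEnergy_lt_top ((hE j).trans_lt hC)
  obtain ⟨v, hv, φ, hφ, hlim⟩ := exists_subseq_tendstoInMeasure hW0 hα hβ hWαβ hk hε hε0 hw hC
    fun j => (hwE j).symm.trans_le (hE j)
  exact ⟨v, hv, φ, hφ, hlim.congr_left fun j => hwu (φ j)⟩

/-- The liminf inequality for the extended limit functional; if `u` is not in `BV((a,b); {-1,1})`,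
the energies are unbounded along each subsequence, by compactness. -/
theorem limitEnergy_le_liminf {W : ℝ → ℝ} (hW : Continuous W) (hW0 : ∀ z, 0 ≤ W z)
    (hWneg : W (-1) = 0) (hWpos : W 1 = 0) {α β : ℝ} (hα : 0 < α) (hβ : 0 < β)
    (hWαβ : ∀ z, α * min (min ((z + 1) ^ 2) ((z - 1) ^ 2)) β ≤ W z) {k : ℕ}
    (hk : 1 ≤ k) {a b : ℝ} {ε : ℕ → ℝ} (hε : ∀ j, 0 < ε j) (hε0 : Tendsto ε atTop (𝓝 0))
    {v : ℕ → ℝ → ℝ} {u : ℝ → ℝ} (hvu : TendstoInMeasure (volume.restrict (Ioo a b)) v atTop u) :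
    limitEnergy a b k W u ≤ liminf (fun j => phaseEnergy a b k W (ε j) (v j)) atTop := by
  by_cases hu : MemBVPhase (Ioo a b) u
  · rw [limitEnergy, if_pos hu]
    exact le_liminf_phaseEnergy hW hW0 hWneg hWpos hα hβ hWαβ hk (Eventually.of_forall hε) hε0 hu hvu
  · refine le_top.trans (le_of_eq (Eq.symm ?_))
    by_contra hne
    obtain ⟨c, hc1, hc2⟩ := exists_between (lt_top_iff_ne_top.2 hne)
    have hfreq := Filter.frequently_lt_of_liminf_lt (h := hc1)
    obtain ⟨ψ, hψ, hψc⟩ := extraction_of_frequently_atTop hfreq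
    obtain ⟨v', hv', φ, hφ, hlim⟩ := exists_subseq_of_phaseEnergy_le hW0 hα hβ hWαβ hk
      (fun j => hε (ψ j)) (hε0.comp hψ.tendsto_atTop) hc2 fun j => (hψc j).le
    have h2 := hvu.comp (hψ.tendsto_atTop.comp hφ.tendsto_atTop)
    exact hu (hv'.congr (tendstoInMeasure_ae_unique hlim h2))

theorem limitEnergy_lt_top_iff {W : ℝ → ℝ} (hW : Continuous W) (hWneg : W (-1) = 0)
    (hWpos : W 1 = 0) {k : ℕ} (hk : 1 ≤ k) {a b : ℝ} {u : ℝ → ℝ} :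
    limitEnergy a b k W u < ⊤ ↔ MemBVPhase (Ioo a b) u := by
  refine ⟨fun h => ?_, fun hu => ?_⟩
  · by_contra hn
    rw [limitEnergy, if_neg hn] at h
    exact lt_irrefl _ h
  · rw [limitEnergy, if_pos hu]
    obtain ⟨S, -, -, hS, -⟩ := hu.exists_jumps
    rw [← hS, Set.encard_coe_eq_coe_finsetCard]
    exact ENNReal.mul_lt_top (profileConst_lt_top hW hWneg hWpos hk) (by simp)

theorem exists_recovery_sequence {W : ℝ → ℝ} (hW : Continuous W) (hW0 : ∀ z, 0 ≤ W z)
    (hWneg : W (-1) = 0) (hWpos : W 1 = 0) {α β : ℝ} (hα : 0 < α) (hβ : 0 < β)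
    (hWαβ : ∀ z, α * min (min ((z + 1) ^ 2) ((z - 1) ^ 2)) β ≤ W z) {k : ℕ}
    (hk : 1 ≤ k) {a b : ℝ} {ε : ℕ → ℝ} (hε : ∀ j, 0 < ε j) (hε0 : Tendsto ε atTop (𝓝 0))
    {u : ℝ → ℝ} (hu : MemBVPhase (Ioo a b) u) :
    ∃ v : ℕ → ℝ → ℝ, (∀ j, MemHk (Ioo a b) k (v j)) ∧
      Tendsto (fun j => eLpNorm (v j - u) 1 (volume.restrict (Ioo a b))) atTop (𝓝 0) ∧
      limsup (fun j => phaseEnergy a b k W (ε j) (v j)) atTop ≤ limitEnergy a b k W u := by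
  obtain ⟨v, h1, h2, h3⟩ := exists_recovery hW hW0 hWneg hWpos hα hβ hWαβ hk hu
  have hε' : Tendsto ε atTop (𝓝[>] 0) :=
    tendsto_nhdsWithin_iff.2 ⟨hε0, Eventually.of_forall hε⟩
  refine ⟨fun j => v (ε j), fun j => h1 _ (hε j), h2.comp hε', ?_⟩
  rw [limitEnergy, if_pos hu]
  refine le_trans ?_ h3
  exact limsup_le_limsup_of_le (f := map ε atTop) (u := fun ε => phaseEnergy a b k W ε (v ε)) hε'

theorem theorem1 (W : ℝ → ℝ) (hW : Continuous W) (hW0 : ∀ z, 0 ≤ W z)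
    (hWneg : W (-1) = 0) (hWpos : W 1 = 0)
    (α β : ℝ) (hα : 0 < α) (hβ : 0 < β)
    (hWαβ : ∀ z, α * min (min ((z + 1) ^ 2) ((z - 1) ^ 2)) β ≤ W z)
    (k : ℕ) (hk : 1 ≤ k) (a b : ℝ) (hab : a < b) :
    -- equicoercivity with respect to convergence in measure
    (∀ (ε : ℕ → ℝ) (u : ℕ → ℝ → ℝ), (∀ j, 0 < ε j) → Tendsto ε atTop (𝓝 0) →
      (∀ j, MemHk (Ioo a b) k (u j)) → (⨆ j, phaseEnergy a b k W (ε j) (u j)) < ⊤ →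
      ∃ v : ℝ → ℝ, MemBVPhase (Ioo a b) v ∧ ∃ φ : ℕ → ℕ, StrictMono φ ∧
        TendstoInMeasure (volume.restrict (Ioo a b)) (fun j => u (φ j)) atTop v) ∧
    -- the domain of the limit functional is `BV((a,b); {-1,1})`
    (∀ u : ℝ → ℝ, limitEnergy a b k W u < ⊤ ↔ MemBVPhase (Ioo a b) u) ∧
    -- `Γ`-convergence with respect to convergence in measure
    GammaConverges {u | AEStronglyMeasurable u (volume.restrict (Ioo a b))}
      (fun v u => TendstoInMeasure (volume.restrict (Ioo a b)) v atTop u)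
      (phaseEnergy a b k W) (limitEnergy a b k W) ∧
    -- `Γ`-convergence with respect to convergence in `L¹(a,b)`
    GammaConverges {u | Integrable u (volume.restrict (Ioo a b))}
      (fun v u => Tendsto (fun j => eLpNorm (v j - u) 1 (volume.restrict (Ioo a b)))
        atTop (𝓝 0))
      (phaseEnergy a b k W) (limitEnergy a b k W) ∧
    -- lower bound along all families converging in measure, and recovery families in `L¹(a,b)`
    (∀ u : ℝ → ℝ, MemBVPhase (Ioo a b) u →
      (∀ v : ℝ → ℝ → ℝ, (∀ ε, 0 < ε → MemHk (Ioo a b) k (v ε)) →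
        TendstoInMeasure (volume.restrict (Ioo a b)) v (𝓝[>] 0) u →
        profileConst k W * ((jumpSet a b u).encard : ℝ≥0∞) ≤
          liminf (fun ε => phaseEnergy a b k W ε (v ε)) (𝓝[>] 0)) ∧
      ∃ v : ℝ → ℝ → ℝ, (∀ ε, 0 < ε → MemHk (Ioo a b) k (v ε)) ∧
        Tendsto (fun ε => eLpNorm (v ε - u) 1 (volume.restrict (Ioo a b))) (𝓝[>] 0) (𝓝 0) ∧
        limsup (fun ε => phaseEnergy a b k W ε (v ε)) (𝓝[>] 0) =
          profileConst k W * ((jumpSet a b u).encard : ℝ≥0∞)) := by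
  refine ⟨?_, ?_, ?_, ?_, ?_⟩
  · intro ε u hε hε0 _ hsup
    exact exists_subseq_of_phaseEnergy_le hW0 hα hβ hWαβ hk hε hε0 hsup fun j =>
      le_iSup (fun j => phaseEnergy a b k W (ε j) (u j)) j
  · exact fun u => limitEnergy_lt_top_iff hW hWneg hWpos hk
  · intro ε hε hε0 u huD
    refine ⟨fun v _ hvu => limitEnergy_le_liminf hW hW0 hWneg hWpos hα hβ hWαβ hk hε hε0 hvu, ?_⟩
    by_cases hu : MemBVPhase (Ioo a b) u
    · obtain ⟨v, h1, h2, h3⟩ :=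
        exists_recovery_sequence hW hW0 hWneg hWpos hα hβ hWαβ hk hε hε0 hu
      exact ⟨v, fun j => (h1 j).1.aestronglyMeasurable, tendstoInMeasure_of_tendsto_eLpNorm
        one_ne_zero (fun j => (h1 j).1.aestronglyMeasurable) huD h2, h3⟩
    · refine ⟨fun _ => u, fun _ => huD, ?_, ?_⟩
      · exact tendstoInMeasure_of_tendsto_eLpNorm one_ne_zero (fun _ => huD) huD (by simp)
      · rw [limitEnergy, if_neg hu]; exact le_top
  · intro ε hε hε0 u huD
    refine ⟨fun v hvD hvu => limitEnergy_le_liminf hW hW0 hWneg hWpos hα hβ hWαβ hk hε hε0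
      (tendstoInMeasure_of_tendsto_eLpNorm one_ne_zero
        (fun j => (hvD j).aestronglyMeasurable) huD.aestronglyMeasurable hvu), ?_⟩
    by_cases hu : MemBVPhase (Ioo a b) u
    · obtain ⟨v, h1, h2, h3⟩ :=
        exists_recovery_sequence hW hW0 hWneg hWpos hα hβ hWαβ hk hε hε0 hu
      exact ⟨v, fun j => (h1 j).1.integrable (by norm_num), h2, h3⟩
    · refine ⟨fun _ => u, fun _ => huD, by simp, ?_⟩
      rw [limitEnergy, if_neg hu]; exact le_top
  · intro u hu
    have hpos : ∀ᶠ ε in 𝓝[>] (0 : ℝ), 0 < ε := self_mem_nhdsWithin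
    have hid : Tendsto (fun ε : ℝ => ε) (𝓝[>] 0) (𝓝 0) := tendsto_id.mono_left nhdsWithin_le_nhds
    have hliminf : ∀ v : ℝ → ℝ → ℝ,
        TendstoInMeasure (volume.restrict (Ioo a b)) v (𝓝[>] 0) u →
        profileConst k W * ((jumpSet a b u).encard : ℝ≥0∞) ≤
          liminf (fun ε => phaseEnergy a b k W ε (v ε)) (𝓝[>] 0) := fun v hvu =>
      le_liminf_phaseEnergy hW hW0 hWneg hWpos hα hβ hWαβ hk hpos hid hu hvu
    refine ⟨fun v _ hvu => hliminf v hvu, ?_⟩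
    obtain ⟨v, h1, h2, h3⟩ := exists_recovery hW hW0 hWneg hWpos hα hβ hWαβ hk hu
    refine ⟨v, h1, h2, le_antisymm h3 ?_⟩
    -- the values at `ε ≤ 0` need not be measurable; they are replaced by `u`
    classical
    have hv : ∀ ε, AEStronglyMeasurable (if 0 < ε then v ε else u)
        (volume.restrict (Ioo a b)) := fun ε => by
      by_cases hε : 0 < ε
      · rw [if_pos hε]; exact (h1 ε hε).1.aestronglyMeasurable
      · rw [if_neg hε]; exact hu.1.1.aestronglyMeasurable
    have heq : ∀ᶠ ε in 𝓝[>] (0 : ℝ), (if 0 < ε then v ε else u) = v ε :=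
      hpos.mono fun ε hε => if_pos hε
    have hlim : TendstoInMeasure (volume.restrict (Ioo a b)) v (𝓝[>] 0) u :=
      (tendstoInMeasure_of_tendsto_eLpNorm one_ne_zero hv hu.1.1.aestronglyMeasurable
        (h2.congr' (heq.mono fun ε hε => by simp only [hε]))).congr'
        (heq.mono fun ε hε => by rw [hε]) EventuallyEq.rfl
    exact (hliminf v hlim).trans liminf_le_limsup
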